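/- A two-player game graph $G=\langle V_1,V_2,v_0,E\rangle$ consists of disjoint finite sets $V_1,V_2$ of vertices, owned by Player 1 (Coverer) and Player 2 (Disruptor), with $V=V_1\cup V_2$, an initial vertex $v_0\in V$, and a total edge relation $E\subseteq V\times V$. A strategy for Player $i$ is a function $f_i:V^*\cdot V_i\to V$ with $\langle v,f_i(\rho\cdot v)\rangle\in E$ for all $\rho\in V^*$ and $v\in V_i$; a pair $\langle f_1,f_2\rangle$ of strategies generates an infinite play ${\sf outcome}(\langle f_1,f_2\rangle)\in V^\omega$ from $v_0$. A play $\rho$ satisfies the Büchi objective $\alpha\subseteq V$ if $\inf(\rho)\cap\alpha\neq\emptyset$, and the co-Büchi objective $\alpha$ if $\inf(\rho)\cap\alpha=\emptyset$, where $\inf(\rho)$ is the set of vertices visited infinitely often in $\rho$. A Büchi (respectively co-Büchi) coverage game is a tuple $\mathcal G=\langle G,k,\beta\rangle$, where $G$ is a game graph, $k\in\mathbb N$ is the number of agents of Coverer, and $\beta=\{\alpha_1,\ldots,\alpha_m\}$ is a set of Büchi (respectively co-Büchi) objectives $\alpha_j\subseteq V$. A covering strategy for Coverer is a tuple $\langle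 f_1^1,\ldots,f_1^k\rangle$ of strategies for Player 1 such that for every strategy $f_2$ of Player 2 and every objective $\alpha_j\in\beta$ there is an agent $i\in\{1,\ldots,k\}$ such that ${\sf outcome}(\langle f_1^i,f_2\rangle)$ satisfies $\alpha_j$. The coverage problem is to decide, given a coverage game $\mathcal G$, whether Coverer has a covering strategy in $\mathcal G$. The input is encoded as a word in which $V_1$, $v_0$, the rows of the adjacency matrix of $E$ and the objectives in $\beta$ (listed in some order) are written as bit vectors indexed by $V$, and $k$ is written in binary. **Theorem.** The coverage problem for Büchi coverage games and the coverage problem for co-Büchi coverage games are both in PSPACE: for each of the two types of objectives there is a deterministic Turing machine that, within space polynomial in the length of the input word, decides whether the word encodes a coverage game of that type in which Coverer has a covering strategy. -/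

import Mathlib

namespace CoverageGames

/-! ### Two-player game graphs, strategies, outcomes -/

/-- The two players: `one` is Coverer (Player 1), `two` is Disruptor (Player 2). -/
inductive Player
  | one
  | two

/-- A two-player game graph on the vertex set `V`. The partition of `V` into the sets `V₁`, `V₂`
of vertices owned by the two players is given by the function `owner`; the edge relation is
total. -/
structure GameGraph (V : Type*) where
  owner : V → Player
  init : V
  edge : V → V → Prop
  total : ∀ v, ∃ u, edge v u

/-- A strategy of player `p`: a function `V* · V_p → V` that respects the edges. The value at the
history `ρ · v`, with `v` owned by `p`, is `next ρ v`. -/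
structure Strategy {V : Type*} (G : GameGraph V) (p : Player) where
  next : List V → {v : V // G.owner v = p} → V
  legal : ∀ ρ v, G.edge v.1 (next ρ v)

/-- The vertex to which the token moves after the history `ρ · v`. -/
def move {V : Type*} {G : GameGraph V} (f₁ : Strategy G Player.one) (f₂ : Strategy G Player.two)
    (ρ : List V) (v : V) : V :=
  match h : G.owner v with
  | Player.one => f₁.next ρ ⟨v, h⟩
  | Player.two => f₂.next ρ ⟨v, h⟩

/-- The history `v₀ … v_j` generated by a profile, as the pair `(v₀ … v_{j-1}, v_j)`. -/
def history {V : Type*} {G : GameGraph V} (f₁ : Strategy G Player.one)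
    (f₂ : Strategy G Player.two) : ℕ → List V × V
  | 0 => ([], G.init)
  | j + 1 =>
    let h := history f₁ f₂ j
    (h.1 ++ [h.2], move f₁ f₂ h.1 h.2)

/-- The outcome `v₀, v₁, …` of the profile `⟨f₁, f₂⟩`. -/
def outcome {V : Type*} {G : GameGraph V} (f₁ : Strategy G Player.one)
    (f₂ : Strategy G Player.two) (j : ℕ) : V :=
  (history f₁ f₂ j).2

/-! ### Objectives -/

/-- The vertices that a play visits infinitely often. -/
def infSet {V : Type*} (ρ : ℕ → V) : Set V :=
  {v | {i : ℕ | ρ i = v}.Infinite}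

/-- The two types `γ ∈ {B, C}` of objectives. -/
inductive ObjectiveType
  | buchi
  | coBuchi

/-- The play `ρ` satisfies the objective `α` of type `γ`. -/
def Satisfies {V : Type*} (γ : ObjectiveType) (ρ : ℕ → V) (α : Set V) : Prop :=
  match γ with
  | ObjectiveType.buchi => (infSet ρ ∩ α).Nonempty
  | ObjectiveType.coBuchi => infSet ρ ∩ α = ∅

/-- The set of the objectives in `β` that the play `ρ` satisfies. -/
def sat {V : Type*} (γ : ObjectiveType) (ρ : ℕ → V) (β : Set (Set V)) : Set (Set V) :=
  {α ∈ β | Satisfies γ ρ α}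

/-! ### Coverage games -/

/-- A coverage game `⟨G, k, β⟩` on the vertex set `V`. -/
structure CoverageGame (V : Type*) where
  graph : GameGraph V
  agents : ℕ
  objectives : Set (Set V)

/-- A strategy of Coverer: one strategy for each of her agents. -/
abbrev CovererStrategy {V : Type*} (𝒢 : CoverageGame V) :=
  Fin 𝒢.agents → Strategy 𝒢.graph Player.one

/-- A strategy of Disruptor: a single strategy, used against all the agents. -/
abbrev DisruptorStrategy {V : Type*} (𝒢 : CoverageGame V) :=
  Strategy 𝒢.graph Player.two

/-- The profile `⟨F₁, f₂⟩` covers the set of objectives: each objective is satisfied in the play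
of at least one agent. -/
def Covers {V : Type*} (γ : ObjectiveType) (𝒢 : CoverageGame V) (F₁ : CovererStrategy 𝒢)
    (f₂ : DisruptorStrategy 𝒢) : Prop :=
  ⋃ i, sat γ (outcome (F₁ i) f₂) 𝒢.objectives = 𝒢.objectives

/-- `F₁` is a covering strategy. -/
def IsCoveringStrategy {V : Type*} (γ : ObjectiveType) (𝒢 : CoverageGame V)
    (F₁ : CovererStrategy 𝒢) : Prop :=
  ∀ f₂ : DisruptorStrategy 𝒢, Covers γ 𝒢 F₁ f₂

/-- Coverer wins the `γ`-coverage game `𝒢`. -/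
def CovererWins {V : Type*} (γ : ObjectiveType) (𝒢 : CoverageGame V) : Prop :=
  ∃ F₁ : CovererStrategy 𝒢, IsCoveringStrategy γ 𝒢 F₁

/-! ### Coverage games as input words

The vertices of an input game are `0, …, n - 1`. The input alphabet is `Option Bool`: two bits and
the separator `none`. -/

/-- The characteristic bit vector of a predicate on `{0, …, n - 1}`. -/
noncomputable def bitVector {n : ℕ} (P : Fin n → Prop) : List Bool :=
  open Classical in List.ofFn fun i => decide (P i)

/-- The blocks of bits, each of them followed by a separator. -/
def joinBlocks (bs : List (List Bool)) : List (Option Bool) :=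
  bs.flatMap fun b => b.map some ++ [none]

/-- The word for the game `𝒢` on `{0, …, n - 1}`, with its objectives listed as `l`. The blocks
are: the vector of the vertices owned by Coverer, the vector of the initial vertex, the number of
agents in binary (least significant bit first), the `n` rows of the adjacency matrix, and the
vectors of the objectives in `l`. -/
noncomputable def encode {n : ℕ} (𝒢 : CoverageGame (Fin n)) (l : List (Set (Fin n))) :
    List (Option Bool) :=
  joinBlocks <|
    bitVector (fun v => 𝒢.graph.owner v = Player.one) ::
    bitVector (fun v => v = 𝒢.graph.init) ::
    𝒢.agents.bits ::
    (List.ofFn fun v => bitVector (𝒢.graph.edge v)) ++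
    l.map (fun α => bitVector (· ∈ α))

/-- The coverage problem for `γ`-coverage games, as a language: the words that encode a
`γ`-coverage game in which Coverer has a covering strategy. The objectives may be listed in any
order. -/
def coverageProblem (γ : ObjectiveType) : Language (Option Bool) :=
  {w | ∃ (n : ℕ) (𝒢 : CoverageGame (Fin n)) (l : List (Set (Fin n))),
    {α | α ∈ l} = 𝒢.objectives ∧ w = encode 𝒢 l ∧ CovererWins γ 𝒢}

/-! ### Polynomial space -/

/-- The space that a configuration of a multi-stack Turing machine occupies: the total number of
symbols on its stacks, the input included. -/
def cfgSpace (tm : Turing.FinTM2) (c : tm.Cfg) : ℕ :=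
  open Turing.FinTM2 in
  letI := tm.kFin
  ∑ k : tm.K, (c.stk k).length

/-- The class of the languages over the alphabet `A` that some deterministic Turing machine decides
in polynomial space. The machine model is Mathlib's deterministic multi-stack machine, with finite
alphabets. The input is written on the stack `k₀`, the machine halts on every input word, and it
accepts by halting in an internal state from the set `acc`. Every configuration that occurs in the
computation on `w` occupies at most `p(|w|)` cells. -/
def PSPACE (A : Type) : Set (Language A) :=
  {L | ∃ (tm : Turing.FinTM2) (inp : A ↪ tm.Γ tm.k₀) (acc : Set tm.σ) (p : Polynomial ℕ),
    (∀ k, Finite (tm.Γ k)) ∧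
    ∀ w : List A,
      (∀ c, StateTransition.Reaches tm.step (Turing.initList tm (w.map inp)) c →
        cfgSpace tm c ≤ p.eval w.length) ∧
      ∃ c, StateTransition.Reaches tm.step (Turing.initList tm (w.map inp)) c ∧
        c.l = none ∧ (w ∈ L ↔ c.var ∈ acc)}

end CoverageGames

/-!
The coverage problem is reduced to the evaluation of an alternation: a string of polynomially many
quantifiers over numbers below `|w| + 1`, with a matrix that is a first-order formula about the
input word `w` and the array of the chosen numbers. A depth-first evaluation needs the array and
little more, so that alternations are decidable in polynomial space (`AltSpec.mem_PSPACE`). The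
evaluation is a program with loops on finitely many stacks (`Prog`), and such programs are compiled
to Turing machines (`mem_PSPACE_of_prog`).

The reduction needs a finite description of the winning region of Coverer.

* As long as the agents of Coverer move together, they are one agent; when they separate, the agents
  and the objectives are divided between two nonempty groups, each of which has to win on its own.
  Each objective can be assigned to a group that covers it against all strategies of Disruptor:
  otherwise he could combine a strategy against each of the groups, because the histories of the
  groups have become different. Thus `κ` agents cover a set `J` of objectives exactly if one agent
  can satisfy all of them, or reach a vertex from which the agents can be divided
  (`covered_eq_single`). More agents than objectives are of no use (`covered_iff_exists_le`), so
  that the number of agents, which is given in binary, may be bounded by the length of the input.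
* The game for one agent is a generalized Büchi or a co-Büchi game, with a set of vertices that win
  immediately. On `n` vertices it can be cut off after `n` visits to targets, each of them within
  `n` steps (`single_eq_outer`): a conjunction of Büchi objectives is treated by letting Disruptor
  choose the next target, and a conjunction of co-Büchi objectives is one co-Büchi objective.

Together this gives a game of polynomially many rounds on positions of polynomial size. Each round
is written down as a record of numbers, to which both players contribute a fixed number of cells
(`RecordGame`), and the matrix of the alternation says that Disruptor is the first to break the
rules (`alt_firstOffence`, `wins_iff_mem_region`). In the first round Coverer also describes the
format of the input and chooses the number of agents to use (`mem_coverageProblem_iff`). The rules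
are first-order conditions (`RuleFml`), in which the bits of the binary number of agents are
compared with those of a small number by means of shifts.
-/

namespace CoverageGames

open Turing

/-! ### Structured programs over stacks and their compilation to Turing machines -/

/-- The stack symbols: the input alphabet serves for all stacks. -/
abbrev Sym := Option Bool

/-- The contents of all stacks, the top symbol first. -/
abbrev Store := ℕ → List Sym

/-- Structured programs that operate on stacks numbered by `ℕ`. The tests of `ite` and `loop` see
the top symbol of one stack, which is `none` when that stack is empty. -/
inductive Prog
  | push (k : ℕ) (a : Sym)
  | pop (k : ℕ)
  | mov (k k' : ℕ)
  | seq (p q : Prog)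
  | ite (k : ℕ) (c : Option Sym → Bool) (p q : Prog)
  | loop (k : ℕ) (c : Option Sym → Bool) (p : Prog)

/-- Sequential composition. -/
infixr:60 " ;; " => Prog.seq

/-- `Runs S p s s'`: the program `p`, started on `s`, terminates on `s'`, and no push produces a
stack of height more than `S`. A `mov` needs a nonempty source. -/
inductive Runs (S : ℕ) : Prog → Store → Store → Prop
  | push {k a s} : (s k).length + 1 ≤ S →
      Runs S (.push k a) s (Function.update s k (a :: s k))
  | pop {k s} : Runs S (.pop k) s (Function.update s k (s k).tail)
  | mov {k k' a l s} : s k = a :: l → k ≠ k' → (s k').length + 1 ≤ S →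
      Runs S (.mov k k') s (Function.update (Function.update s k l) k' (a :: s k'))
  | seq {p q s t u} : Runs S p s t → Runs S q t u → Runs S (p ;; q) s u
  | iteT {k c p q s t} : c (s k).head? = true → Runs S p s t → Runs S (.ite k c p q) s t
  | iteF {k c p q s t} : c (s k).head? = false → Runs S q s t → Runs S (.ite k c p q) s t
  | loopT {k c p s t u} : c (s k).head? = true → Runs S p s t → Runs S (.loop k c p) t u →
      Runs S (.loop k c p) s u
  | loopF {k c p s} : c (s k).head? = false → Runs S (.loop k c p) s s

namespace Prog

/-- The program points. -/
def Label : Prog → Type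
  | push _ _ => Unit
  | pop _ => Unit
  | mov _ _ => Unit
  | seq p q => p.Label ⊕ q.Label
  | ite _ _ p q => Option (p.Label ⊕ q.Label)
  | loop _ _ p => Option p.Label

/-- There are finitely many program points. -/
@[reducible] def labelFintype : ∀ p : Prog, Fintype p.Label
  | push _ _ => inferInstanceAs (Fintype Unit)
  | pop _ => inferInstanceAs (Fintype Unit)
  | mov _ _ => inferInstanceAs (Fintype Unit)
  | seq p q =>
    letI := p.labelFintype
    letI := q.labelFintype
    inferInstanceAs (Fintype (p.Label ⊕ q.Label))
  | ite _ _ p q =>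
    letI := p.labelFintype
    letI := q.labelFintype
    inferInstanceAs (Fintype (Option (p.Label ⊕ q.Label)))
  | loop _ _ p =>
    letI := p.labelFintype
    inferInstanceAs (Fintype (Option p.Label))

/-- The point at which the execution of a program starts. -/
def entry : ∀ p : Prog, p.Label
  | push _ _ => ()
  | pop _ => ()
  | mov _ _ => ()
  | seq p _ => Sum.inl p.entry
  | ite _ _ _ _ => none
  | loop _ _ _ => none

/-- A bound on the numbers of the stacks that occur in a program. -/
def maxStack : Prog → ℕ
  | push k _ => k
  | pop k => k
  | mov k k' => max k k'
  | seq p q => max p.maxStack q.maxStack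
  | ite k _ p q => max k (max p.maxStack q.maxStack)
  | loop k _ p => max k p.maxStack

/-- The machine code of `p`, placed at the labels `emb`, with control passed to `exit` at the end.
The internal state of the machine only buffers the symbol read last. -/
def code (R : ℕ) {Λ : Type} : ∀ p : Prog, (p.Label → Λ) → Λ → p.Label →
    TM2.Stmt (fun _ : Fin (R + 1) => Sym) Λ (Option Sym)
  | push k a, _, exit => fun _ => .push (Fin.ofNat (R + 1) k) (fun _ => a) (.goto fun _ => exit)
  | pop k, _, exit => fun _ => .pop (Fin.ofNat (R + 1) k) (fun _ t => t) (.goto fun _ => exit)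
  | mov k k', _, exit => fun _ => .pop (Fin.ofNat (R + 1) k) (fun _ t => t)
      (.push (Fin.ofNat (R + 1) k') (fun v => v.getD none) (.goto fun _ => exit))
  | seq p q, emb, exit => Sum.elim
      (p.code R (fun l => emb (Sum.inl l)) (emb (Sum.inr q.entry)))
      (q.code R (fun l => emb (Sum.inr l)) exit)
  | ite k c p q, emb, exit => fun l => Option.elim l
      (.peek (Fin.ofNat (R + 1) k) (fun _ t => t) (.branch c
        (.goto fun _ => emb (some (Sum.inl p.entry)))
        (.goto fun _ => emb (some (Sum.inr q.entry)))))
      (Sum.elim (p.code R (fun l => emb (some (Sum.inl l))) exit)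
        (q.code R (fun l => emb (some (Sum.inr l))) exit))
  | loop k c p, emb, exit => fun l => Option.elim l
      (.peek (Fin.ofNat (R + 1) k) (fun _ t => t) (.branch c
        (.goto fun _ => emb (some p.entry)) (.goto fun _ => exit)))
      (p.code R (fun l => emb (some l)) (emb none))

end Prog

/-- The stacks `0, …, R` of a store. -/
def Store.restrict (R : ℕ) (s : Store) : Fin (R + 1) → List Sym := fun k => s k

theorem Store.restrict_update {R k : ℕ} (hk : k ≤ R) (s : Store) (l : List Sym) :
    Function.update (s.restrict R) (Fin.ofNat (R + 1) k) l =
      Store.restrict R (Function.update s k l) := by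
  have hk' : ((Fin.ofNat (R + 1) k : Fin (R + 1)) : ℕ) = k := Nat.mod_eq_of_lt (by omega)
  funext i
  simp only [Store.restrict, Function.update_apply, Fin.ext_iff, hk']

theorem Store.restrict_ofNat {R k : ℕ} (hk : k ≤ R) (s : Store) :
    s.restrict R (Fin.ofNat (R + 1) k) = s k := by
  have hk' : ((Fin.ofNat (R + 1) k : Fin (R + 1)) : ℕ) = k := Nat.mod_eq_of_lt (by omega)
  simp only [Store.restrict, hk']

/-- Reachability in a multi-stack machine through configurations all of whose stacks have height
at most `S`. -/
def ReachesWithin {R : ℕ} {Λ : Type} (S : ℕ)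
    (M : Λ → TM2.Stmt (fun _ : Fin (R + 1) => Sym) Λ (Option Sym)) :
    TM2.Cfg (fun _ : Fin (R + 1) => Sym) Λ (Option Sym) →
    TM2.Cfg (fun _ : Fin (R + 1) => Sym) Λ (Option Sym) → Prop :=
  Relation.ReflTransGen fun c c' => TM2.step M c = some c' ∧ ∀ k, (c'.stk k).length ≤ S

theorem Runs.bounded {S : ℕ} {p : Prog} {s s' : Store} (h : Runs S p s s')
    (hs : ∀ k, (s k).length ≤ S) : ∀ k, (s' k).length ≤ S := by
  induction h with
  | push h =>
    intro i
    rw [Function.update_apply]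
    split_ifs
    · simpa using h
    · exact hs i
  | @pop k s =>
    intro i
    rw [Function.update_apply]
    split_ifs
    · have := hs k
      simp only [List.length_tail]
      omega
    · exact hs i
  | @mov k k' a l s h₁ h₂ h₃ =>
    intro i
    rw [Function.update_apply, Function.update_apply]
    split_ifs
    · simpa using h₃
    · have := hs k
      rw [h₁, List.length_cons] at this
      omega
    · exact hs i
  | seq _ _ ih₁ ih₂ => exact ih₂ (ih₁ hs)
  | iteT _ _ ih => exact ih hs
  | iteF _ _ ih => exact ih hs
  | loopT _ _ _ ih₁ ih₂ => exact ih₂ (ih₁ hs)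
  | loopF _ => exact hs

theorem Runs.reachesWithin {R S : ℕ} {Λ : Type}
    {M : Λ → TM2.Stmt (fun _ : Fin (R + 1) => Sym) Λ (Option Sym)} {p : Prog} {s s' : Store}
    (h : Runs S p s s') (hs : ∀ k, (s k).length ≤ S) (hR : p.maxStack ≤ R)
    {emb : p.Label → Λ} {exit : Λ} (hM : ∀ l, M (emb l) = p.code R emb exit l) (v : Option Sym) :
    ∃ v', ReachesWithin S M ⟨some (emb p.entry), v, s.restrict R⟩
      ⟨some exit, v', s'.restrict R⟩ := by
  induction h generalizing v exit with
  | @push k a s h =>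
    have hk : k ≤ R := hR
    have hb := (Runs.push (a := a) h).bounded hs
    refine ⟨v, .single ⟨?_, fun k => hb k⟩⟩
    have e := hM (Prog.push k a).entry
    simp only [Prog.code] at e
    rw [TM2.step, e]
    simp only [TM2.stepAux, Store.restrict_update hk, Store.restrict_ofNat hk]
  | @pop k s =>
    have hk : k ≤ R := hR
    have hb := (Runs.pop (S := S) (k := k) (s := s)).bounded hs
    refine ⟨(s k).head?, .single ⟨?_, fun k => hb k⟩⟩
    have e := hM (Prog.pop k).entry
    simp only [Prog.code] at e
    rw [TM2.step, e]
    simp only [TM2.stepAux, Store.restrict_update hk, Store.restrict_ofNat hk]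
  | @mov k k' a l s h₁ h₂ h₃ =>
    have hb := (Runs.mov h₁ h₂ h₃).bounded hs
    refine ⟨some a, .single ⟨?_, fun k => hb k⟩⟩
    have e := hM (Prog.mov k k').entry
    simp only [Prog.code] at e
    simp only [Prog.maxStack, max_le_iff] at hR
    rw [TM2.step, e]
    simp only [TM2.stepAux, Store.restrict_update hR.1, Store.restrict_ofNat hR.1,
      Store.restrict_update hR.2, Store.restrict_ofNat hR.2, h₁, List.tail_cons, List.head?_cons,
      Option.getD_some, Function.update_of_ne h₂.symm]
  | @seq p q s t u h₁ h₂ ih₁ ih₂ =>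
    simp only [Prog.maxStack, max_le_iff] at hR
    obtain ⟨v₁, r₁⟩ := ih₁ hs hR.1 (emb := fun l => emb (Sum.inl l))
      (exit := emb (Sum.inr q.entry)) (fun l => hM (Sum.inl l)) v
    obtain ⟨v₂, r₂⟩ := ih₂ (h₁.bounded hs) hR.2 (emb := fun l => emb (Sum.inr l))
      (exit := exit) (fun l => hM (Sum.inr l)) v₁
    exact ⟨v₂, r₁.trans r₂⟩
  | @iteT k c p q s t hc h ih =>
    simp only [Prog.maxStack, max_le_iff] at hR
    obtain ⟨v₁, r₁⟩ := ih hs hR.2.1 (emb := fun l => emb (some (Sum.inl l)))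
      (exit := exit) (fun l => hM (some (Sum.inl l))) (s k).head?
    refine ⟨v₁, .head ⟨?_, fun k => hs k⟩ r₁⟩
    have e := hM (Prog.ite k c p q).entry
    simp only [Prog.code, Prog.entry, Option.elim_none] at e
    rw [TM2.step, Prog.entry, e]
    simp only [TM2.stepAux, Store.restrict_ofNat hR.1, hc, cond_true]
  | @iteF k c p q s t hc h ih =>
    simp only [Prog.maxStack, max_le_iff] at hR
    obtain ⟨v₁, r₁⟩ := ih hs hR.2.2 (emb := fun l => emb (some (Sum.inr l)))
      (exit := exit) (fun l => hM (some (Sum.inr l))) (s k).head?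
    refine ⟨v₁, .head ⟨?_, fun k => hs k⟩ r₁⟩
    have e := hM (Prog.ite k c p q).entry
    simp only [Prog.code, Prog.entry, Option.elim_none] at e
    rw [TM2.step, Prog.entry, e]
    simp only [TM2.stepAux, Store.restrict_ofNat hR.1, hc, cond_false]
  | @loopT k c p s t u hc h₁ h₂ ih₁ ih₂ =>
    have hR' := hR
    simp only [Prog.maxStack, max_le_iff] at hR
    obtain ⟨v₁, r₁⟩ := ih₁ hs hR.2 (emb := fun l => emb (some l))
      (exit := emb none) (fun l => hM (some l)) (s k).head?
    obtain ⟨v₂, r₂⟩ := ih₂ (h₁.bounded hs) hR' hM v₁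
    refine ⟨v₂, .head ⟨?_, fun k => hs k⟩ (r₁.trans r₂)⟩
    have e := hM (Prog.loop k c p).entry
    simp only [Prog.code, Prog.entry, Option.elim_none] at e
    rw [TM2.step, Prog.entry, e]
    simp only [TM2.stepAux, Store.restrict_ofNat hR.1, hc, cond_true]
  | @loopF k c p s hc =>
    simp only [Prog.maxStack, max_le_iff] at hR
    refine ⟨(s k).head?, .single ⟨?_, fun k => hs k⟩⟩
    have e := hM (Prog.loop k c p).entry
    simp only [Prog.code, Prog.entry, Option.elim_none] at e
    rw [TM2.step, Prog.entry, e]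
    simp only [TM2.stepAux, Store.restrict_ofNat hR.1, hc, cond_false]

/-- The stack on which programs leave their results. -/
abbrev resStack : ℕ := 4

/-- The Turing machine that runs `p` on the stacks `0, …, R` and then reads the top of the result
stack into its internal state and halts. -/
def Prog.machine (R : ℕ) (p : Prog) : FinTM2 :=
  letI := p.labelFintype
  { K := Fin (R + 1)
    k₀ := 0
    k₁ := 0
    Γ := fun _ => Sym
    Λ := Option p.Label
    main := some p.entry
    σ := Option Sym
    initialState := none
    Γk₀Fin := inferInstanceAs (Fintype Sym)
    m := fun l => Option.elim l
      (.peek (Fin.ofNat (R + 1) resStack) (fun _ t => t) .halt) (p.code R some none) }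

/-- The store with `w` on the input stack and all other stacks empty. -/
def initStore (w : List Sym) : Store := fun k => if k = 0 then w else []

/-- A deterministic run that halts is the only one, so a bound along it bounds every reachable
configuration. -/
theorem ReachesWithin.le_of_reaches {R S : ℕ} {Λ : Type}
    {M : Λ → TM2.Stmt (fun _ : Fin (R + 1) => Sym) Λ (Option Sym)}
    {c c' d : TM2.Cfg (fun _ : Fin (R + 1) => Sym) Λ (Option Sym)}
    (h : ReachesWithin S M c c') (hc : ∀ k, (c.stk k).length ≤ S) (hc' : TM2.step M c' = none)
    (hd : StateTransition.Reaches (TM2.step M) c d) : ∀ k, (d.stk k).length ≤ S := by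
  induction h using Relation.ReflTransGen.head_induction_on with
  | refl =>
    rcases Relation.ReflTransGen.cases_head hd with rfl | ⟨e, he, _⟩
    · exact hc
    · rw [hc'] at he
      cases he
  | head h₁ _ ih =>
    rcases Relation.ReflTransGen.cases_head hd with rfl | ⟨e, he, hed⟩
    · exact hc
    · rw [h₁.1] at he
      cases he
      exact ih h₁.2 hed

theorem initList_stk_self (tm : FinTM2) (s : List (tm.Γ tm.k₀)) :
    (Turing.initList tm s).stk tm.k₀ = s := by
  unfold Turing.initList
  exact dif_pos rfl

theorem initList_stk_of_ne (tm : FinTM2) (s : List (tm.Γ tm.k₀)) {k : tm.K} (hk : k ≠ tm.k₀) :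
    (Turing.initList tm s).stk k = [] := by
  unfold Turing.initList
  exact dif_neg hk

/-- A language is in polynomial space if a structured program decides it with polynomially high
stacks. -/
theorem mem_PSPACE_of_prog {L : Language (Option Bool)} (p : Prog) (S : Polynomial ℕ)
    (h : ∀ w : List (Option Bool), w.length ≤ S.eval w.length ∧
      ∃ s', Runs (S.eval w.length) p (initStore w) s' ∧
        (w ∈ L ↔ (s' resStack).head? = some (some true))) :
    L ∈ PSPACE (Option Bool) := by
  classical
  set R := max p.maxStack resStack with hR
  refine ⟨p.machine R, Function.Embedding.refl _, {some (some true)},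
    Polynomial.C (R + 1) * S, fun k => inferInstanceAs (Finite Sym), fun w => ?_⟩
  obtain ⟨hw, s', hr, hL⟩ := h w
  have hinit : Turing.initList (p.machine R) (w.map (Function.Embedding.refl (Option Bool))) =
      (⟨some (some p.entry), none, (initStore w).restrict R⟩ :
        TM2.Cfg (fun _ : Fin (R + 1) => Sym) (Option p.Label) (Option Sym)) := by
    have hmap : w.map (Function.Embedding.refl (Option Bool)) = w := List.map_id w
    have hstk : (Turing.initList (p.machine R)
        (w.map (Function.Embedding.refl (Option Bool)))).stk = (initStore w).restrict R := by
      funext k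
      by_cases hk : k = (0 : Fin (R + 1))
      · subst hk
        refine (initList_stk_self (p.machine R) _).trans ?_
        simp only [Store.restrict, initStore, Fin.val_zero, if_true]
        exact hmap
      · refine (initList_stk_of_ne (p.machine R) _ hk).trans ?_
        have : Fin.val (n := R + 1) k ≠ 0 := fun h => hk (Fin.ext h)
        simp only [Store.restrict, initStore]
        exact (if_neg this).symm
    rw [← hstk]
    rfl
  have hb : ∀ k, (initStore w k).length ≤ S.eval w.length := by
    intro k
    unfold initStore
    split_ifs
    · exact hw
    · simp
  obtain ⟨v, hreach⟩ := hr.reachesWithin (M := (p.machine R).m) (emb := some) (exit := none) hb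
    (le_max_left _ _) (fun l => rfl) none
  have hlast : TM2.step (p.machine R).m (⟨some none, v, s'.restrict R⟩ :
      TM2.Cfg (fun _ : Fin (R + 1) => Sym) (Option p.Label) (Option Sym)) =
      some ⟨none, (s' resStack).head?, s'.restrict R⟩ := by
    change some (TM2.Cfg.mk none (s'.restrict R (Fin.ofNat (R + 1) resStack)).head? _) = _
    rw [Store.restrict_ofNat (le_max_right p.maxStack resStack)]
    rfl
  have hreach' := hreach.tail ⟨hlast, fun k => hr.bounded hb k⟩
  refine hinit ▸ ?_
  constructor
  · intro c hc
    have hle := ReachesWithin.le_of_reaches hreach' (fun k => hb k) rfl hc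
    rw [Polynomial.eval_mul, Polynomial.eval_C]
    calc cfgSpace (p.machine R) c = ∑ k : Fin (R + 1), (c.stk k).length := rfl
      _ ≤ ∑ _k : Fin (R + 1), S.eval w.length := Finset.sum_le_sum fun k _ => hle k
      _ = (R + 1) * S.eval w.length := by simp
  · exact ⟨⟨none, (s' resStack).head?, s'.restrict R⟩,
      hreach'.lift id fun _ _ h => h.1, rfl, hL⟩

/-! ### Basic commands on a structured memory -/

/-- A structured view of the stacks: the input and the array, each with an auxiliary stack for the
part that has been read past, the stack of results, a control stack, and number variables. -/
@[ext] structure Mem where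
  inp : List Sym
  inpA : List Sym
  arr : List Sym
  arrA : List Sym
  res : List Sym
  ctl : List Sym
  env : ℕ → ℕ

/-- The stacks of a memory; the variables are stored in unary. -/
def Mem.store (m : Mem) : Store
  | 0 => m.inp
  | 1 => m.inpA
  | 2 => m.arr
  | 3 => m.arrA
  | 4 => m.res
  | 5 => m.ctl
  | i + 6 => List.replicate (m.env i) none

/-- Replaces the values of the variables. -/
abbrev Mem.withEnv (m : Mem) (e : ℕ → ℕ) : Mem := { m with env := e }

theorem Runs.cast {S : ℕ} {p : Prog} {s t t' : Store} (h : Runs S p s t) (e : t = t') :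
    Runs S p s t' := e ▸ h

theorem Runs.castMem {S : ℕ} {p : Prog} {s : Store} {m m' : Mem} (h : Runs S p s m.store)
    (e : m = m') : Runs S p s m'.store := e ▸ h

/-- The command without effect. -/
def skip : Prog := .loop 0 (fun _ => false) (.pop 0)

/-- Increments a variable. -/
def inc (i : ℕ) : Prog := .push (i + 6) none

/-- Decrements a variable. -/
def dec (i : ℕ) : Prog := .pop (i + 6)

/-- Pushes a result. -/
def pushRes (b : Bool) : Prog := .push resStack (some b)

/-- Removes a result. -/
def popRes : Prog := .pop resStack

/-- Counts the variable `i` down to `0`, running `p` after each decrement. -/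
def forVar (i : ℕ) (p : Prog) : Prog := .loop (i + 6) Option.isSome (dec i ;; p)

/-- The test for the top symbol `a`. -/
def isTop (a : Sym) : Option Sym → Bool := fun t => t == some a

section Commands

variable {S : ℕ}

theorem runs_skip {s : Store} : Runs S skip s s := .loopF rfl

theorem Mem.store_update_env (m : Mem) (i v : ℕ) :
    Function.update m.store (i + 6) (List.replicate v none) =
      (m.withEnv (Function.update m.env i v)).store := by
  funext k
  match k with
  | 0 | 1 | 2 | 3 | 4 | 5 => simp [Mem.store]
  | k + 6 =>
    by_cases h : k = i
    · subst h
      simp [Mem.store]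
    · simp [Mem.store, h]

theorem runs_inc {m : Mem} {i : ℕ} (h : m.env i + 1 ≤ S) :
    Runs S (inc i) m.store
      (m.withEnv (Function.update m.env i (m.env i + 1))).store := by
  rw [← Mem.store_update_env]
  exact Runs.push (by simpa [Mem.store] using h)

theorem runs_dec {m : Mem} {i : ℕ} :
    Runs S (dec i) m.store
      (m.withEnv (Function.update m.env i (m.env i - 1))).store := by
  rw [← Mem.store_update_env]
  refine Runs.cast .pop ?_
  simp [Mem.store]

theorem runs_pushRes {m : Mem} {b : Bool} (h : m.res.length + 1 ≤ S) :
    Runs S (pushRes b) m.store (Mem.store { m with res := some b :: m.res }) := by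
  refine Runs.cast (Runs.push h) ?_
  funext k
  match k with
  | 0 | 1 | 2 | 3 | 4 | 5 | k + 6 => simp [Mem.store, resStack]

theorem runs_popRes {m : Mem} :
    Runs S popRes m.store (Mem.store { m with res := m.res.tail }) := by
  refine Runs.cast Runs.pop ?_
  funext k
  match k with
  | 0 | 1 | 2 | 3 | 4 | 5 | k + 6 => simp [Mem.store, resStack]

theorem runs_pushCtl {m : Mem} {b : Sym} (h : m.ctl.length + 1 ≤ S) :
    Runs S (.push 5 b) m.store (Mem.store { m with ctl := b :: m.ctl }) := by
  refine Runs.cast (Runs.push h) ?_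
  funext k
  match k with
  | 0 | 1 | 2 | 3 | 4 | 5 | k + 6 => simp [Mem.store]

theorem runs_popCtl {m : Mem} :
    Runs S (.pop 5) m.store (Mem.store { m with ctl := m.ctl.tail }) := by
  refine Runs.cast Runs.pop ?_
  funext k
  match k with
  | 0 | 1 | 2 | 3 | 4 | 5 | k + 6 => simp [Mem.store]

theorem runs_pushArr {m : Mem} {b : Sym} (h : m.arr.length + 1 ≤ S) :
    Runs S (.push 2 b) m.store (Mem.store { m with arr := b :: m.arr }) := by
  refine Runs.cast (Runs.push h) ?_
  funext k
  match k with
  | 0 | 1 | 2 | 3 | 4 | 5 | k + 6 => simp [Mem.store]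

theorem runs_popArr {m : Mem} :
    Runs S (.pop 2) m.store (Mem.store { m with arr := m.arr.tail }) := by
  refine Runs.cast Runs.pop ?_
  funext k
  match k with
  | 0 | 1 | 2 | 3 | 4 | 5 | k + 6 => simp [Mem.store]

theorem runs_movInp {m : Mem} {a : Sym} {l : List Sym} (h : m.inp = a :: l)
    (hS : m.inpA.length + 1 ≤ S) :
    Runs S (.mov 0 1) m.store (Mem.store { m with inp := l, inpA := a :: m.inpA }) := by
  refine Runs.cast (Runs.mov h (by decide) hS) ?_
  funext k
  match k with
  | 0 | 1 | 2 | 3 | 4 | 5 | k + 6 => simp [Mem.store]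

theorem runs_movInpBack {m : Mem} {a : Sym} {l : List Sym} (h : m.inpA = a :: l)
    (hS : m.inp.length + 1 ≤ S) :
    Runs S (.mov 1 0) m.store (Mem.store { m with inp := a :: m.inp, inpA := l }) := by
  refine Runs.cast (Runs.mov h (by decide) hS) ?_
  funext k
  match k with
  | 0 | 1 | 2 | 3 | 4 | 5 | k + 6 => simp [Mem.store]

theorem runs_movArr {m : Mem} {a : Sym} {l : List Sym} (h : m.arr = a :: l)
    (hS : m.arrA.length + 1 ≤ S) :
    Runs S (.mov 2 3) m.store (Mem.store { m with arr := l, arrA := a :: m.arrA }) := by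
  refine Runs.cast (Runs.mov h (by decide) hS) ?_
  funext k
  match k with
  | 0 | 1 | 2 | 3 | 4 | 5 | k + 6 => simp [Mem.store]

theorem runs_movArrBack {m : Mem} {a : Sym} {l : List Sym} (h : m.arrA = a :: l)
    (hS : m.arr.length + 1 ≤ S) :
    Runs S (.mov 3 2) m.store (Mem.store { m with arr := a :: m.arr, arrA := l }) := by
  refine Runs.cast (Runs.mov h (by decide) hS) ?_
  funext k
  match k with
  | 0 | 1 | 2 | 3 | 4 | 5 | k + 6 => simp [Mem.store]

theorem isSome_head?_var (m : Mem) (i : ℕ) :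
    (m.store (i + 6)).head?.isSome = decide (m.env i ≠ 0) := by
  cases h : m.env i <;> simp [Mem.store, h, List.replicate_succ]

theorem runs_forVar {i n : ℕ} {p : Prog} {m m' : Mem} (f : ℕ → Mem) (hm : m = f n) (hm' : f 0 = m')
    (hf : ∀ k ≤ n, (f k).env i = k)
    (h : ∀ k < n, Runs S p
      ((f (k + 1)).withEnv (Function.update (f (k + 1)).env i k)).store (f k).store) :
    Runs S (forVar i p) m.store m'.store := by
  subst hm hm'
  induction n with
  | zero =>
    refine Runs.loopF ?_
    rw [isSome_head?_var, hf 0 le_rfl]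
    rfl
  | succ n ih =>
    refine Runs.loopT (t := (f n).store) ?_ (Runs.seq (runs_dec (i := i)) ?_) ?_
    · rw [isSome_head?_var, hf _ le_rfl]
      simp
    · rw [hf _ le_rfl]
      exact h n (Nat.lt_succ_self n)
    · exact ih (fun k hk => hf k (by omega)) fun k hk => h k (by omega)

theorem runs_rewindInp (m : Mem) (hS : m.inp.length + m.inpA.length ≤ S) :
    Runs S (.loop 1 Option.isSome (.mov 1 0)) m.store
      (Mem.store { m with inp := m.inpA.reverse ++ m.inp, inpA := [] }) := by
  obtain ⟨l, hl⟩ : ∃ l, m.inpA = l := ⟨_, rfl⟩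
  induction l generalizing m with
  | nil =>
    refine (Runs.loopF (by simp [Mem.store, hl])).castMem ?_
    ext1 <;> simp [hl]
  | cons a l ih =>
    rw [hl, List.length_cons] at hS
    refine (Runs.loopT (by simp [Mem.store, hl]) (runs_movInpBack hl (by omega))
      (ih _ (by simp only [List.length_cons]; omega) rfl)).castMem ?_
    ext1 <;> simp [hl]

theorem runs_rewindArr (m : Mem) (hS : m.arr.length + m.arrA.length ≤ S) :
    Runs S (.loop 3 Option.isSome (.mov 3 2)) m.store
      (Mem.store { m with arr := m.arrA.reverse ++ m.arr, arrA := [] }) := by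
  obtain ⟨l, hl⟩ : ∃ l, m.arrA = l := ⟨_, rfl⟩
  induction l generalizing m with
  | nil =>
    refine (Runs.loopF (by simp [Mem.store, hl])).castMem ?_
    ext1 <;> simp [hl]
  | cons a l ih =>
    rw [hl, List.length_cons] at hS
    refine (Runs.loopT (by simp [Mem.store, hl]) (runs_movArrBack hl (by omega))
      (ih _ (by simp only [List.length_cons]; omega) rfl)).castMem ?_
    ext1 <;> simp [hl]

theorem runs_unwindArr (m : Mem) (hS : m.arr.length + m.arrA.length ≤ S) :
    Runs S (.loop 2 Option.isSome (.mov 2 3)) m.store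
      (Mem.store { m with arr := [], arrA := m.arr.reverse ++ m.arrA }) := by
  obtain ⟨l, hl⟩ : ∃ l, m.arr = l := ⟨_, rfl⟩
  induction l generalizing m with
  | nil =>
    refine (Runs.loopF (by simp [Mem.store, hl])).castMem ?_
    ext1 <;> simp [hl]
  | cons a l ih =>
    rw [hl, List.length_cons] at hS
    refine (Runs.loopT (by simp [Mem.store, hl]) (runs_movArr hl (by omega))
      (ih _ (by simp only [List.length_cons]; omega) rfl)).castMem ?_
    ext1 <;> simp [hl]

/-- Adds the variable `i` to the variable `j` and clears `i`. -/
def moveVar (i j : ℕ) : Prog := forVar i (inc j)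

theorem runs_moveVar {m : Mem} {i j : ℕ} (hij : i ≠ j) (hS : m.env i + m.env j ≤ S) :
    Runs S (moveVar i j) m.store (m.withEnv
      (Function.update (Function.update m.env i 0) j (m.env i + m.env j))).store := by
  refine runs_forVar (n := m.env i) (fun k => m.withEnv
      (Function.update (Function.update m.env i k) j (m.env i - k + m.env j)))
    (by simp) (by simp) (fun k _ => by simp [hij]) fun k hk => (runs_inc ?_).castMem ?_
  · simp [hij.symm]
    omega
  · ext1 <;> try rfl
    funext x
    simp only [Function.update_apply]
    split_ifs <;> omega

/-- Adds the variable `i` to the variable `j`, with the help of the cleared variable `d`. -/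
def copyVar (i j d : ℕ) : Prog := moveVar i d ;; forVar d (inc i ;; inc j)

theorem runs_copyVar {m : Mem} {i j d : ℕ} (hij : i ≠ j) (hid : i ≠ d) (hjd : j ≠ d)
    (hd : m.env d = 0) (hS : m.env i + m.env j ≤ S) :
    Runs S (copyVar i j d) m.store (m.withEnv
      (Function.update m.env j (m.env j + m.env i))).store := by
  refine Runs.seq (runs_moveVar hid (by omega)) (runs_forVar (n := m.env i)
    (fun k => m.withEnv (Function.update (Function.update (Function.update m.env d k) i
      (m.env i - k)) j (m.env i - k + m.env j))) ?_ ?_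
    (fun k _ => by simp [hjd.symm, hid.symm]) fun k hk =>
      (Runs.seq (runs_inc ?_) (runs_inc ?_)).castMem ?_)
  · ext1 <;> try rfl
    funext x
    simp only [Function.update_apply]
    split_ifs <;> simp_all
  · ext1 <;> try rfl
    funext x
    simp only [Function.update_apply]
    split_ifs <;> simp_all
    omega
  · simp [hij, hid]
    omega
  · simp [hij.symm, hjd]
    omega
  · ext1 <;> try rfl
    funext x
    simp only [Function.update_apply]
    split_ifs <;> omega

/-- Halves the variable `d`, with the help of the cleared variable `e`. -/
def halve (d e : ℕ) : Prog :=
  .loop (d + 6) Option.isSome (dec d ;; .ite (d + 6) Option.isSome (dec d ;; inc e) skip) ;;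
  moveVar e d

theorem runs_halve {m : Mem} {d e : ℕ} (hde : d ≠ e) (he : m.env e = 0) (hS : m.env d ≤ S) :
    Runs S (halve d e) m.store
      (m.withEnv (Function.update m.env d (m.env d / 2))).store := by
  have key : ∀ (v : ℕ) (m : Mem), m.env d = v → m.env d + m.env e ≤ S →
      Runs S (.loop (d + 6) Option.isSome
        (dec d ;; .ite (d + 6) Option.isSome (dec d ;; inc e) skip)) m.store
        (m.withEnv
          (Function.update (Function.update m.env d 0) e (m.env e + v / 2))).store := by
    intro v
    induction v using Nat.strong_induction_on with
    | _ v ih =>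
      intro m hv hS
      match v with
      | 0 =>
        refine (Runs.loopF (by simp [isSome_head?_var, hv])).castMem ?_
        ext1 <;> try rfl
        funext x
        simp only [Function.update_apply]
        split_ifs <;> simp_all
      | 1 =>
        refine (Runs.loopT (by simp [isSome_head?_var, hv])
          (Runs.seq runs_dec (Runs.iteF ?_ runs_skip))
          (ih 0 (by omega) _ ?_ ?_)).castMem ?_
        · simp [isSome_head?_var, hv]
        · simp [hv]
        · simp [hv, hde.symm]; omega
        · ext1 <;> try rfl
          funext x
          simp only [Function.update_apply]
          split_ifs <;> simp_all
      | v + 2 =>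
        refine (Runs.loopT (by simp [isSome_head?_var, hv]) (Runs.seq runs_dec
          (Runs.iteT ?_ (Runs.seq runs_dec (runs_inc ?_)))) (ih v (by omega) _ ?_ ?_)).castMem ?_
        · simp [isSome_head?_var, hv]
        · simp [hde.symm]; omega
        · simp [hv, hde]
        · simp [hv, hde, hde.symm]; omega
        · ext1 <;> try rfl
          funext x
          simp only [Function.update_apply]
          split_ifs <;> simp_all
          omega
  refine (Runs.seq (key _ m rfl (by omega)) (runs_moveVar hde.symm ?_)).castMem ?_
  · simp [hde, he]; omega
  · ext1 <;> try rfl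
    funext x
    simp only [Function.update_apply]
    split_ifs <;> simp_all

end Commands

/-! ### The array of numbers -/

/-- The symbols for a list of numbers: each number is a separator followed by a unary block. -/
def unaryBlocks (a : List ℕ) : List Sym :=
  a.flatMap fun x => none :: List.replicate x (some true)

@[simp] theorem unaryBlocks_nil : unaryBlocks [] = [] := rfl

@[simp] theorem unaryBlocks_cons (x : ℕ) (a : List ℕ) :
    unaryBlocks (x :: a) = none :: (List.replicate x (some true) ++ unaryBlocks a) := rfl

@[simp] theorem unaryBlocks_append (a b : List ℕ) :
    unaryBlocks (a ++ b) = unaryBlocks a ++ unaryBlocks b := List.flatMap_append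

theorem head?_unaryBlocks_ne (a : List ℕ) : (unaryBlocks a).head? ≠ some (some true) := by
  cases a <;> simp

theorem length_unaryBlocks_le {a : List ℕ} {B : ℕ} (h : ∀ x ∈ a, x ≤ B) :
    (unaryBlocks a).length ≤ a.length * (B + 1) := by
  induction a with
  | nil => simp
  | cons x a ih =>
    have h₁ := h x (by simp)
    have h₂ := ih fun y hy => h y (by simp [hy])
    simp only [unaryBlocks_cons, List.length_cons, List.length_append, List.length_replicate]
    rw [Nat.add_mul]
    omega

section ArrayCommands

variable {S : ℕ}

/-- Moves the unary block on top of the auxiliary array stack back. -/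
def skipOnes : Prog := .loop 3 (isTop (some true)) (.mov 3 2)

theorem runs_skipOnes {x : ℕ} {r : List Sym} (hr : r.head? ≠ some (some true)) {m : Mem}
    (hm : m.arrA = List.replicate x (some true) ++ r) (hS : m.arr.length + m.arrA.length ≤ S) :
    Runs S skipOnes m.store (Mem.store { m with
      arr := List.replicate x (some true) ++ m.arr, arrA := r }) := by
  induction x generalizing m with
  | zero =>
    simp only [List.replicate_zero, List.nil_append] at hm
    refine (Runs.loopF ?_).castMem ?_
    · simp only [Mem.store, hm, isTop]
      simpa using hr
    · ext1 <;> simp [hm]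
  | succ x ih =>
    rw [List.replicate_succ, List.cons_append] at hm
    rw [hm, List.length_cons] at hS
    refine (Runs.loopT (by simp [Mem.store, hm, isTop]) (runs_movArrBack hm (by omega))
      (ih rfl ?_)).castMem ?_
    · simp only [List.length_cons]
      omega
    · ext1 <;> simp [List.replicate_succ']

/-- Moves the unary block on top of the auxiliary array stack back and adds its length to the
variable `i`. -/
def countOnes (i : ℕ) : Prog := .loop 3 (isTop (some true)) (.mov 3 2 ;; inc i)

theorem runs_countOnes {x : ℕ} {r : List Sym} (hr : r.head? ≠ some (some true)) {m : Mem} {i : ℕ}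
    (hm : m.arrA = List.replicate x (some true) ++ r) (hS : m.arr.length + m.arrA.length ≤ S)
    (hi : m.env i + x ≤ S) :
    Runs S (countOnes i) m.store (Mem.store { m with
      arr := List.replicate x (some true) ++ m.arr, arrA := r,
      env := Function.update m.env i (m.env i + x) }) := by
  induction x generalizing m with
  | zero =>
    simp only [List.replicate_zero, List.nil_append] at hm
    refine (Runs.loopF ?_).castMem ?_
    · simp only [Mem.store, hm, isTop]
      simpa using hr
    · ext1 <;> simp [hm]
  | succ x ih =>
    rw [List.replicate_succ, List.cons_append] at hm
    rw [hm, List.length_cons] at hS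
    refine (Runs.loopT (by simp [Mem.store, hm, isTop]) (Runs.seq
      (runs_movArrBack hm (by omega)) (runs_inc (i := i) ?_)) (ih rfl ?_ ?_)).castMem ?_
    · simp only
      omega
    · simp only [List.length_cons]
      omega
    · simp
      omega
    · ext1 <;> simp [List.replicate_succ', Nat.add_assoc, Nat.add_comm 1 x]

/-- Moves the entry on top of the auxiliary array stack back, if there is one. -/
def skipEntry : Prog := .ite 3 (isTop none) (.mov 3 2 ;; skipOnes) skip

theorem runs_skipEntry {m : Mem} {l : List ℕ} (hm : m.arrA = unaryBlocks l)
    (hS : m.arr.length + m.arrA.length ≤ S) :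
    Runs S skipEntry m.store (Mem.store { m with
      arr := (unaryBlocks (l.take 1)).reverse ++ m.arr, arrA := unaryBlocks (l.drop 1) }) := by
  cases l with
  | nil =>
    refine (Runs.iteF (by simp [Mem.store, hm, isTop]) runs_skip).castMem ?_
    ext1 <;> simp [hm]
  | cons x l =>
    rw [unaryBlocks_cons] at hm
    rw [hm, List.length_cons] at hS
    refine (Runs.iteT (by simp [Mem.store, hm, isTop]) (Runs.seq (runs_movArrBack hm (by omega))
      (runs_skipOnes (x := x) (head?_unaryBlocks_ne l) rfl ?_))).castMem ?_
    · simp only [List.length_cons]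
      omega
    · ext1 <;> simp

/-- Moves the entry on top of the auxiliary array stack back, if there is one, and adds it to the
variable `i`. -/
def countEntry (i : ℕ) : Prog := .ite 3 (isTop none) (.mov 3 2 ;; countOnes i) skip

theorem runs_countEntry {m : Mem} {l : List ℕ} {i : ℕ} (hm : m.arrA = unaryBlocks l)
    (hS : m.arr.length + m.arrA.length ≤ S) (hi : m.env i + l.headD 0 ≤ S) :
    Runs S (countEntry i) m.store (Mem.store { m with
      arr := (unaryBlocks (l.take 1)).reverse ++ m.arr, arrA := unaryBlocks (l.drop 1),
      env := Function.update m.env i (m.env i + l.headD 0) }) := by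
  cases l with
  | nil =>
    refine (Runs.iteF (by simp [Mem.store, hm, isTop]) runs_skip).castMem ?_
    ext1 <;> simp [hm]
  | cons x l =>
    rw [unaryBlocks_cons] at hm
    rw [hm, List.length_cons] at hS
    refine (Runs.iteT (by simp [Mem.store, hm, isTop]) (Runs.seq (runs_movArrBack hm (by omega))
      (runs_countOnes (x := x) (head?_unaryBlocks_ne l) rfl ?_ ?_))).castMem ?_
    · simp only [List.length_cons]
      omega
    · simpa using hi
    · ext1 <;> simp

/-- Adds the array entry whose index is the variable `d` to the variable `i`, and clears `d`. -/
def readArray (d i : ℕ) : Prog :=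
  .loop 2 Option.isSome (.mov 2 3) ;; forVar d skipEntry ;; countEntry i ;;
    .loop 3 Option.isSome (.mov 3 2)

theorem runs_readArray {m : Mem} {a : List ℕ} {d i : ℕ} (hdi : d ≠ i)
    (hm : m.arr = (unaryBlocks a).reverse) (hA : m.arrA = []) (hS : m.arr.length ≤ S)
    (hi : m.env i + a.getD (m.env d) 0 ≤ S) :
    Runs S (readArray d i) m.store (m.withEnv (Function.update (Function.update m.env d 0) i
      (m.env i + a.getD (m.env d) 0))).store := by
  have hlen : ∀ j, (unaryBlocks (a.take j)).length + (unaryBlocks (a.drop j)).length =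
      m.arr.length := fun j => by
    rw [hm, List.length_reverse, ← List.length_append, ← unaryBlocks_append, List.take_append_drop]
  refine (Runs.seq (runs_unwindArr m (by simp [hA, hS])) (Runs.seq (runs_forVar (n := m.env d)
    (m' := { m with
      arr := (unaryBlocks (a.take (m.env d))).reverse
      arrA := unaryBlocks (a.drop (m.env d))
      env := Function.update m.env d 0 })
    (fun k => { m with
      arr := (unaryBlocks (a.take (m.env d - k))).reverse
      arrA := unaryBlocks (a.drop (m.env d - k))
      env := Function.update m.env d k }) ?_ ?_ ?_ ?_) (Runs.seq (runs_countEntry (i := i)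
      (l := a.drop (m.env d)) rfl ?_ ?_) (runs_rewindArr _ ?_)))).castMem ?_
  · ext1 <;> simp [hm, hA]
  · simp
  · simp
  · intro k hk
    refine (runs_skipEntry rfl ?_).castMem ?_
    · simp only [List.length_reverse, hlen]
      exact hS
    · have e : m.env d - k = (m.env d - (k + 1)) + 1 := by omega
      ext1 <;> simp only
      · rw [e, List.take_add, unaryBlocks_append, List.reverse_append]
      · rw [e, List.drop_drop]
      · simp
  · simp only [List.length_reverse, hlen]
    exact hS
  · simp only [Function.update_of_ne hdi.symm]
    rw [List.headD_eq_head?_getD, List.head?_drop, ← List.getD_eq_getElem?_getD]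
    exact hi
  · have := hlen (m.env d + 1)
    have h2 := congrArg (List.length ∘ unaryBlocks) (List.take_add (l := a) (i := m.env d) (j := 1))
    simp only [Function.comp, unaryBlocks_append, List.length_append] at h2
    simp only [List.length_append, List.length_reverse, List.drop_drop]
    omega
  · have h3 : unaryBlocks a = unaryBlocks (a.take (m.env d)) ++
        (unaryBlocks ((a.drop (m.env d)).take 1) ++ unaryBlocks ((a.drop (m.env d)).drop 1)) := by
      rw [← unaryBlocks_append, List.take_append_drop, ← unaryBlocks_append,
        List.take_append_drop]
    ext1 <;> try rfl
    · simp only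
      rw [hm, h3]
      simp only [List.reverse_append, List.append_assoc]
    · simp only [hA]
    · simp only [Function.update_of_ne hdi.symm]
      rw [List.headD_eq_head?_getD, List.head?_drop, ← List.getD_eq_getElem?_getD]

end ArrayCommands

/-! ### Terms -/

/-- Arithmetic terms. `arr t` is the array entry with index `t`, and `shr t u` is `t` shifted
right by `u` bits. -/
inductive Tm
  | var (x : ℕ)
  | const (c : ℕ)
  | add (t u : Tm)
  | mul (t u : Tm)
  | shr (t u : Tm)
  | arr (t : Tm)

namespace Tm

/-- The value of a term for the array `a` and the values `e` of the variables. -/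
def eval (a : List ℕ) (e : ℕ → ℕ) : Tm → ℕ
  | var x => e x
  | const c => c
  | add t u => t.eval a e + u.eval a e
  | mul t u => t.eval a e * u.eval a e
  | shr t u => t.eval a e / 2 ^ u.eval a e
  | arr t => a.getD (t.eval a e) 0

/-- A bound on all numbers that the evaluation of a term produces, if `B` bounds the variables and
the array entries. -/
def bd (B : ℕ) : Tm → ℕ
  | var _ => B
  | const c => c
  | add t u => t.bd B + u.bd B
  | mul t u => t.bd B * u.bd B + t.bd B + u.bd B
  | shr t u => t.bd B + u.bd B
  | arr t => B + t.bd B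

theorem eval_le_bd {a : List ℕ} {e : ℕ → ℕ} {B : ℕ} (he : ∀ i, e i ≤ B) (ha : ∀ x ∈ a, x ≤ B) :
    ∀ t : Tm, t.eval a e ≤ t.bd B
  | var x => he x
  | const c => le_rfl
  | add t u => Nat.add_le_add (eval_le_bd he ha t) (eval_le_bd he ha u)
  | mul t u => by
    have := Nat.mul_le_mul (eval_le_bd he ha t) (eval_le_bd he ha u)
    simp only [eval, bd]
    omega
  | shr t u => by
    have := Nat.div_le_self (t.eval a e) (2 ^ u.eval a e)
    have := eval_le_bd he ha t
    simp only [eval, bd]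
    omega
  | arr t => by
    simp only [eval, bd, List.getD_eq_getElem?_getD]
    rcases h : a[t.eval a e]? with _ | x
    · simp
    · have := ha x (List.mem_of_getElem? h)
      simp only [Option.getD_some]
      omega

/-- The program that adds `c` to the variable `j`. -/
def addConst (j : ℕ) : ℕ → Prog
  | 0 => skip
  | c + 1 => inc j ;; addConst j c

/-- The program that adds the value of a term to the variable `j`. The variables below `d₀` are
those of the term, while those from `d` on are cleared and serve as auxiliary variables. -/
def addTo (d₀ : ℕ) : Tm → ℕ → ℕ → Prog
  | var x, d, j => if x < d₀ then copyVar x j d else skip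
  | const c, _, j => addConst j c
  | add t u, d, j => t.addTo d₀ d j ;; u.addTo d₀ d j
  | mul t u, d, j => t.addTo d₀ (d + 1) d ;; forVar d (u.addTo d₀ (d + 1) j)
  | shr t u, d, j => t.addTo d₀ (d + 1) d ;; u.addTo d₀ (d + 2) (d + 1) ;;
      forVar (d + 1) (halve d (d + 2)) ;; moveVar d j
  | arr t, d, j => t.addTo d₀ (d + 1) d ;; readArray d j

theorem runs_addConst {S c : ℕ} {m : Mem} {j : ℕ} (h : m.env j + c ≤ S) :
    Runs S (addConst j c) m.store (m.withEnv (Function.update m.env j (m.env j + c))).store := by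
  induction c generalizing m with
  | zero => exact runs_skip.castMem (by simp)
  | succ c ih =>
    refine (Runs.seq (runs_inc (by omega)) (ih ?_)).castMem ?_
    · simp
      omega
    · simp [Nat.add_assoc, Nat.add_comm 1 c]

theorem runs_addTo {S B d₀ : ℕ} {a : List ℕ} {e : ℕ → ℕ} (he : ∀ i, e i ≤ B)
    (ha : ∀ x ∈ a, x ≤ B) (he₀ : ∀ i, d₀ ≤ i → e i = 0) (t : Tm) {d j : ℕ} {m : Mem}
    (hj : d₀ ≤ j) (hjd : j < d) (hm : m.arr = (unaryBlocks a).reverse) (hA : m.arrA = [])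
    (hme : ∀ i < d₀, m.env i = e i) (hmd : ∀ i, d ≤ i → m.env i = 0) (hS : m.arr.length ≤ S)
    (hb : m.env j + t.bd B ≤ S) :
    Runs S (t.addTo d₀ d j) m.store
      (m.withEnv (Function.update m.env j (m.env j + t.eval a e))).store := by
  induction t generalizing d j m with
  | var x =>
    simp only [bd] at hb
    unfold addTo
    split_ifs with hx
    · have := he x
      rw [← hme x hx] at this
      refine (runs_copyVar (by omega) (by omega) (by omega) (hmd d le_rfl) (by omega)).castMem ?_
      simp only [eval, hme x hx]
    · refine runs_skip.castMem ?_
      simp [eval, he₀ x (by omega)]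
  | const c => exact runs_addConst hb
  | add t u iht ihu =>
    simp only [bd] at hb
    have := eval_le_bd he ha t
    refine (Runs.seq (iht hj hjd hm hA hme hmd hS (by omega))
      (ihu hj hjd hm hA ?_ ?_ hS ?_)).castMem ?_
    · intro i hi
      simp [Function.update_of_ne (show i ≠ j by omega), hme i hi]
    · intro i hi
      simp [Function.update_of_ne (show i ≠ j by omega), hmd i hi]
    · simp
      omega
    · simp [eval, Nat.add_assoc]
  | mul t u iht ihu =>
    simp only [bd] at hb
    have ht := eval_le_bd he ha t
    have hu := eval_le_bd he ha u
    have hd := hmd d le_rfl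
    refine Runs.seq (iht (d := d + 1) (j := d) (by omega) (by omega) hm hA hme
      (fun i hi => hmd i (by omega)) hS (by omega)) (runs_forVar (n := t.eval a e)
      (fun k => m.withEnv (Function.update (Function.update m.env d k) j
        (m.env j + (t.eval a e - k) * u.eval a e))) ?_ ?_ ?_ ?_)
    · ext1 <;> try rfl
      funext x
      by_cases hx : x = j
      · subst hx
        simp [Function.update_of_ne (show x ≠ d by omega)]
      · simp [hx, hd]
    · ext1 <;> try rfl
      funext x
      by_cases hx : x = j
      · simp [hx, eval]
      · by_cases hx' : x = d
        · simp [hx', hd, Function.update_of_ne (show d ≠ j by omega)]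
        · simp [hx, hx']
    · intro k _
      simp [Function.update_of_ne (show d ≠ j by omega)]
    · intro k hk
      have hm1 : (t.eval a e - (k + 1)) * u.eval a e ≤ t.bd B * u.bd B :=
        Nat.mul_le_mul (by omega) hu
      have hm2 : (t.eval a e - k) * u.eval a e =
          (t.eval a e - (k + 1)) * u.eval a e + u.eval a e := by
        rw [← Nat.succ_mul]
        congr 1
        omega
      refine (ihu (d := d + 1) (j := j) hj (by omega) (by exact hm) (by exact hA) ?_ ?_
        (by exact hS) ?_).castMem ?_
      · intro i hi
        simp [Function.update_of_ne (show i ≠ j by omega),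
          Function.update_of_ne (show i ≠ d by omega), hme i hi]
      · intro i hi
        simp [Function.update_of_ne (show i ≠ j by omega),
          Function.update_of_ne (show i ≠ d by omega), hmd i (by omega)]
      · simp [Function.update_of_ne (show j ≠ d by omega)]
        omega
      · ext1 <;> try rfl
        funext x
        by_cases hx : x = j
        · subst hx
          simp [Function.update_of_ne (show x ≠ d by omega), hm2, Nat.add_assoc]
        · by_cases hx' : x = d
          · simp [hx', Function.update_of_ne (show d ≠ j by omega)]
          · simp [hx, hx']
  | shr t u iht ihu =>
    simp only [bd] at hb
    have ht := eval_le_bd he ha t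
    have hu := eval_le_bd he ha u
    have hd := hmd d le_rfl
    have hd1 := hmd (d + 1) (by omega)
    have hdiv : t.eval a e / 2 ^ u.eval a e ≤ t.eval a e := Nat.div_le_self _ _
    refine (Runs.seq (iht (d := d + 1) (j := d) (by omega) (by omega) hm hA hme
      (fun i hi => hmd i (by omega)) hS (by omega)) (Runs.seq (ihu (d := d + 2) (j := d + 1)
      (by omega) (by omega) hm hA ?_ ?_ hS ?_) (Runs.seq (runs_forVar (n := u.eval a e)
      (m' := m.withEnv (Function.update m.env d (t.eval a e / 2 ^ u.eval a e)))
      (fun k => m.withEnv (Function.update (Function.update m.env d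
        (t.eval a e / 2 ^ (u.eval a e - k))) (d + 1) k)) ?_ ?_ ?_ ?_)
      (runs_moveVar (i := d) (j := j) (by omega) ?_)))).castMem ?_
    · intro i hi
      simp [Function.update_of_ne (show i ≠ d by omega), hme i hi]
    · intro i hi
      simp [Function.update_of_ne (show i ≠ d by omega), hmd i (by omega)]
    · simp [hd1]
      omega
    · ext1 <;> try rfl
      funext x
      by_cases hx : x = d + 1
      · simp [hx, hd1]
      · simp [hx, hd]
    · ext1 <;> try rfl
      funext x
      by_cases hx : x = d + 1
      · simp [hx, hd1]
      · simp [hx]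
    · simp
    · intro k hk
      refine (runs_halve (by omega) ?_ ?_).castMem ?_
      · simp [hmd (d + 2) (by omega)]
      · have : t.eval a e / 2 ^ (u.eval a e - (k + 1)) ≤ t.eval a e := Nat.div_le_self _ _
        simp
        omega
      · have e1 : u.eval a e - k = (u.eval a e - (k + 1)) + 1 := by omega
        ext1 <;> try rfl
        funext x
        simp only [e1, pow_succ, ← Nat.div_div_eq_div_mul]
        by_cases hx : x = d + 1
        · simp [hx]
        · by_cases hx' : x = d
          · simp [hx']
          · simp [hx, hx']
    · simp [Function.update_of_ne (show j ≠ d by omega)]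
      omega
    · ext1 <;> try rfl
      funext x
      by_cases hx : x = j
      · simp [hx, eval, Function.update_of_ne (show j ≠ d by omega), Nat.add_comm]
      · by_cases hx' : x = d
        · simp [hx', hd, Function.update_of_ne (show d ≠ j by omega)]
        · simp [hx, hx']
  | arr t iht =>
    simp only [bd] at hb
    have ht := eval_le_bd he ha t
    have hd := hmd d le_rfl
    have hx : a.getD (t.eval a e) 0 ≤ B := by
      rw [List.getD_eq_getElem?_getD]
      rcases h : a[t.eval a e]? with _ | x
      · simp
      · simpa using ha x (List.mem_of_getElem? h)
    refine (Runs.seq (iht (d := d + 1) (j := d) (by omega) (by omega) hm hA hme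
      (fun i hi => hmd i (by omega)) hS (by omega)) (runs_readArray (a := a) (by omega) hm hA hS
      ?_)).castMem ?_
    · simp [Function.update_of_ne (show j ≠ d by omega), hd, -List.getD_eq_getElem?_getD]
      omega
    · ext1 <;> try rfl
      funext x
      by_cases hx : x = j
      · simp [hx, eval, hd, Function.update_of_ne (show j ≠ d by omega)]
      · by_cases hx' : x = d
        · simp [hx', hd, Function.update_of_ne (show d ≠ j by omega)]
        · simp [hx, hx']

end Tm

/-! ### Formulas -/

/-- First-order formulas about a word, an array of numbers and the values of variables. `inp t c`
says that `c` is the letter at position `t` of the word. The quantifier `ex t φ` ranges over the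
numbers below `t` and binds the variable whose number is the quantifier depth. -/
inductive Fml
  | lt (t u : Tm)
  | inp (t : Tm) (c : Sym)
  | neg (φ : Fml)
  | conj (φ ψ : Fml)
  | ex (t : Tm) (φ : Fml)

namespace Fml

/-- The truth of a formula at quantifier depth `d`. -/
def eval (w : List Sym) (a : List ℕ) : ℕ → (ℕ → ℕ) → Fml → Prop
  | _, e, lt t u => t.eval a e < u.eval a e
  | _, e, inp t c => w[t.eval a e]? = some c
  | d, e, neg φ => ¬ φ.eval w a d e
  | d, e, conj φ ψ => φ.eval w a d e ∧ ψ.eval w a d e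
  | d, e, ex t φ => ∃ x < t.eval a e, φ.eval w a (d + 1) (Function.update e d x)

/-- A bound on all numbers that the evaluation of a formula produces, if `B` bounds the variables
and the array entries. -/
def bd : ℕ → Fml → ℕ
  | B, lt t u => t.bd B + u.bd B
  | B, inp t _ => t.bd B
  | B, neg φ => φ.bd B
  | B, conj φ ψ => φ.bd B + ψ.bd B
  | B, ex t φ => t.bd B + φ.bd (B + t.bd B)

/-- The number of results that the evaluation of a formula stacks up. -/
def height : Fml → ℕ
  | lt _ _ => 1
  | inp _ _ => 1
  | neg φ => φ.height
  | conj φ ψ => φ.height + ψ.height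
  | ex _ φ => φ.height + 1

theorem one_le_height : ∀ φ : Fml, 1 ≤ φ.height
  | lt _ _ => le_rfl
  | inp _ _ => le_rfl
  | neg φ => φ.one_le_height
  | conj φ _ => φ.one_le_height.trans (Nat.le_add_right _ _)
  | ex _ _ => Nat.le_add_left _ _

/-- The program that evaluates a formula at quantifier depth `d` and pushes the truth value. -/
def prog : Fml → ℕ → Prog
  | lt t u, d => t.addTo d (d + 1) d ;; u.addTo d (d + 2) (d + 1) ;; forVar d (dec (d + 1)) ;;
      .ite (d + 1 + 6) Option.isSome (pushRes true) (pushRes false) ;; forVar (d + 1) skip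
  | inp t c, d => t.addTo d (d + 1) d ;; forVar d (.ite 0 Option.isSome (.mov 0 1) skip) ;;
      .ite 0 (isTop c) (pushRes true) (pushRes false) ;; .loop 1 Option.isSome (.mov 1 0)
  | neg φ, d => φ.prog d ;;
      .ite resStack (isTop (some true)) (popRes ;; pushRes false) (popRes ;; pushRes true)
  | conj φ ψ, d => φ.prog d ;; ψ.prog d ;;
      .ite resStack (isTop (some true)) popRes (popRes ;; popRes ;; pushRes false)
  | ex t φ, d => t.addTo d (d + 1) d ;; pushRes false ;; forVar d (φ.prog (d + 1) ;;
      .ite resStack (isTop (some true)) (popRes ;; popRes ;; pushRes true) popRes)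

theorem update_zero {e : ℕ → ℕ} {d : ℕ} (h : e d = 0) : Function.update e d 0 = e := by
  rw [← h, Function.update_eq_self]

open Classical in
theorem runs_prog {S B : ℕ} {w : List Sym} {a : List ℕ} (φ : Fml) {d : ℕ} {m : Mem}
    (hw : m.inp = w) (hwA : m.inpA = []) (hm : m.arr = (unaryBlocks a).reverse) (hA : m.arrA = [])
    (he : ∀ i, m.env i ≤ B) (ha : ∀ x ∈ a, x ≤ B) (he₀ : ∀ i, d ≤ i → m.env i = 0)
    (hwS : w.length ≤ S) (hS : m.arr.length ≤ S) (hb : φ.bd B ≤ S)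
    (hr : m.res.length + φ.height ≤ S) :
    Runs S (φ.prog d) m.store
      (Mem.store { m with res := some (decide (φ.eval w a d m.env)) :: m.res }) := by
  induction φ generalizing d m B with
  | lt t u =>
    simp only [bd, height] at hb hr
    have hd := he₀ d le_rfl
    have hd1 := he₀ (d + 1) (by omega)
    have hT := Tm.eval_le_bd he ha t
    have hU := Tm.eval_le_bd he ha u
    have hres : Runs S (.ite (d + 1 + 6) Option.isSome (pushRes true) (pushRes false))
        (m.withEnv (Function.update m.env (d + 1) (u.eval a m.env - t.eval a m.env))).store
        (Mem.store { m with
          env := Function.update m.env (d + 1) (u.eval a m.env - t.eval a m.env)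
          res := some (decide (t.eval a m.env < u.eval a m.env)) :: m.res }) := by
      by_cases h : t.eval a m.env < u.eval a m.env
      · refine Runs.iteT ?_ ((runs_pushRes (by exact hr)).castMem (by simp [h]))
        rw [isSome_head?_var]
        simp
        omega
      · refine Runs.iteF ?_ ((runs_pushRes (by exact hr)).castMem (by simp [h]))
        rw [isSome_head?_var]
        simp
        omega
    refine Runs.seq (Tm.runs_addTo he ha he₀ t le_rfl (by omega) hm hA (fun _ _ => rfl)
      (fun i hi => he₀ i (by omega)) hS (by omega)) (Runs.seq (Tm.runs_addTo he ha he₀ u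
      (by omega) (by omega) (by exact hm) (by exact hA) ?_ ?_ (by exact hS) ?_)
      (Runs.seq (runs_forVar (n := t.eval a m.env)
        (fun k => m.withEnv (Function.update (Function.update m.env d k) (d + 1)
          (u.eval a m.env - (t.eval a m.env - k)))) ?_ ?_ ?_ ?_) (Runs.seq hres
      (runs_forVar (n := u.eval a m.env - t.eval a m.env)
        (fun k => { m with
          env := Function.update m.env (d + 1) k
          res := some (decide (t.eval a m.env < u.eval a m.env)) :: m.res }) rfl ?_ ?_ ?_))))
    · intro i hi
      simp [Function.update_of_ne (show i ≠ d by omega)]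
    · intro i hi
      simp [Function.update_of_ne (show i ≠ d by omega), he₀ i (by omega)]
    · simp [hd1]
      omega
    · ext1 <;> try rfl
      simp [hd, hd1]
    · ext1 <;> try rfl
      simp [update_zero hd]
    · intro k hk
      simp
    · intro k hk
      refine runs_dec.castMem ?_
      ext1 <;> try rfl
      funext x
      by_cases hx : x = d + 1
      · simp [hx]
        omega
      · by_cases hx' : x = d
        · simp [hx']
        · simp [hx, hx']
    · ext1 <;> simp [update_zero hd1, eval]
      exact decide_eq_decide.2 Iff.rfl
    · simp
    · intro k hk
      refine runs_skip.castMem ?_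
      simp
  | inp t c =>
    simp only [bd, height] at hb hr
    have hd := he₀ d le_rfl
    have hT := Tm.eval_le_bd he ha t
    set n := t.eval a m.env with hn
    have hlen : (w.drop n).length + (w.take n).length = w.length := by
      rw [List.length_drop, List.length_take]
      omega
    have hres : Runs S (.ite 0 (isTop c) (pushRes true) (pushRes false))
        (Mem.store { m with inp := w.drop n, inpA := (w.take n).reverse })
        (Mem.store { m with
          inp := w.drop n
          inpA := (w.take n).reverse
          res := some (decide (w[n]? = some c)) :: m.res }) := by
      by_cases h : w[n]? = some c
      · refine Runs.iteT ?_ ((runs_pushRes (by exact hr)).castMem (by simp [h]))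
        simp [Mem.store, isTop, h]
      · refine Runs.iteF ?_ ((runs_pushRes (by exact hr)).castMem (by simp [h]))
        simp [Mem.store, isTop, h]
    refine (Runs.seq (Tm.runs_addTo he ha he₀ t le_rfl (by omega) hm hA (fun _ _ => rfl)
      (fun i hi => he₀ i (by omega)) hS (by omega)) (Runs.seq (runs_forVar (n := n)
      (fun k => { m with
        inp := w.drop (n - k)
        inpA := (w.take (n - k)).reverse
        env := Function.update m.env d k }) ?_ ?_ ?_ ?_) (Runs.seq hres
      (runs_rewindInp _ ?_)))).castMem ?_
    · ext1 <;> simp [hw, hwA, hd, hn]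
    · ext1 <;> simp [hd]
    · simp
    · intro k hk
      have e1 : n - k = (n - (k + 1)) + 1 := by omega
      by_cases h : n - (k + 1) < w.length
      · refine (Runs.iteT ?_ (runs_movInp (List.drop_eq_getElem_cons h) ?_)).castMem ?_
        · simp [Mem.store, h]
        · simp
          omega
        · have e2 := congrArg List.reverse (List.take_succ_eq_append_getElem h)
          rw [← e1, List.reverse_append] at e2
          ext1 <;> simp only
          · rw [← e1]
          · rw [e2]
            rfl
          · simp
      · refine (Runs.iteF ?_ runs_skip).castMem ?_
        · simp [Mem.store, h]
        · rw [List.drop_eq_nil_of_le (by omega), List.drop_eq_nil_of_le (by omega),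
            List.take_of_length_le (by omega), List.take_of_length_le (by omega)]
          ext1 <;> simp
    · simp only [List.length_reverse]
      omega
    · ext1 <;> simp [hw, hwA, eval, hn]
      exact decide_eq_decide.2 Iff.rfl
  | neg φ ih =>
    simp only [bd, height] at hb hr
    have := φ.one_le_height
    refine Runs.seq (ih hw hwA hm hA he ha he₀ hS hb hr) ?_
    by_cases h : φ.eval w a d m.env
    · exact Runs.iteT (by simp [Mem.store, isTop, h]) ((Runs.seq runs_popRes
        (runs_pushRes (by simp; omega))).castMem (by simp [h, eval]))
    · exact Runs.iteF (by simp [Mem.store, isTop, h]) ((Runs.seq runs_popRes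
        (runs_pushRes (by simp; omega))).castMem (by simp [h, eval]))
  | conj φ ψ ih₁ ih₂ =>
    simp only [bd, height] at hb hr
    have := φ.one_le_height
    refine Runs.seq (ih₁ hw hwA hm hA he ha he₀ hS (by omega) (by omega)) (Runs.seq
      (ih₂ (by exact hw) (by exact hwA) (by exact hm) (by exact hA) (by exact he) ha (by exact he₀)
        (by exact hS) (by omega) ?_) ?_)
    · simp
      omega
    · by_cases h : ψ.eval w a d m.env
      · exact Runs.iteT (by simp [Mem.store, isTop, h]) (runs_popRes.castMem (by simp [h, eval]))
      · exact Runs.iteF (by simp [Mem.store, isTop, h]) ((Runs.seq runs_popRes (Runs.seq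
          runs_popRes (runs_pushRes (by simp; omega)))).castMem (by simp [h, eval]))
  | ex t φ ih =>
    simp only [bd, height] at hb hr
    have hd := he₀ d le_rfl
    have hT := Tm.eval_le_bd he ha t
    have := φ.one_le_height
    set n := t.eval a m.env with hn
    refine (Runs.seq (Tm.runs_addTo he ha he₀ t le_rfl (by omega) hm hA (fun _ _ => rfl)
      (fun i hi => he₀ i (by omega)) hS (by omega)) (Runs.seq (runs_pushRes (by simp; omega))
      (runs_forVar (n := n)
        (m' := { m with res := some (decide ((ex t φ).eval w a d m.env)) :: m.res })
      (fun k => { m with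
        res := some (decide (∃ x, k ≤ x ∧ x < n ∧
          φ.eval w a (d + 1) (Function.update m.env d x))) :: m.res
        env := Function.update m.env d k }) ?_ ?_ ?_ ?_))).castMem rfl
    · ext1 <;> simp [hd, hn]
      intro x h1 h2
      omega
    · ext1 <;> simp [update_zero hd, hn, eval]
      exact decide_eq_decide.2 Iff.rfl
    · simp
    · intro k hk
      refine Runs.seq (ih (B := B + t.bd B) (by exact hw) (by exact hwA) (by exact hm)
        (by exact hA) ?_ ?_ ?_ (by exact hS) (by omega) ?_) ?_
      · intro i
        simp only [Function.update_apply]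
        split_ifs
        · omega
        · exact (he i).trans (by omega)
      · exact fun x hx => (ha x hx).trans (by omega)
      · intro i hi
        simp [Function.update_of_ne (show i ≠ d by omega), he₀ i (by omega)]
      · simp
        omega
      · simp only [Function.update_idem]
        by_cases h : φ.eval w a (d + 1) (Function.update m.env d k)
        · have h' : ∃ x, k ≤ x ∧ x < n ∧ φ.eval w a (d + 1) (Function.update m.env d x) :=
            ⟨k, le_rfl, hk, h⟩
          exact Runs.iteT (by simp [Mem.store, isTop, h]) ((Runs.seq runs_popRes (Runs.seq
            runs_popRes (runs_pushRes (by simp; omega)))).castMem (by simp [h']))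
        · have h' : (∃ x, k < x ∧ x < n ∧ φ.eval w a (d + 1) (Function.update m.env d x)) ↔
              ∃ x, k ≤ x ∧ x < n ∧ φ.eval w a (d + 1) (Function.update m.env d x) := by
            constructor
            · rintro ⟨x, h1, h2⟩
              exact ⟨x, by omega, h2⟩
            · rintro ⟨x, h1, h2, h3⟩
              rcases Nat.eq_or_lt_of_le h1 with rfl | h1
              · exact absurd h3 h
              · exact ⟨x, h1, h2, h3⟩
          exact Runs.iteF (by simp [Mem.store, isTop, h]) (runs_popRes.castMem (by simp [h']))

end Fml

/-! ### Polynomially long alternation -/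

/-- The value of a string of `f` alternating quantifiers over numbers below `C`. The numbers chosen
so far form the list `a`, the next quantifier is existential if `Q a.length` holds and universal
otherwise, and `φ` evaluates the complete list. -/
def Alt (C : ℕ) (Q : ℕ → Prop) (φ : List ℕ → Prop) : ℕ → List ℕ → Prop
  | 0, a => φ a
  | f + 1, a => (Q a.length ∧ ∃ x < C, Alt C Q φ f (a ++ [x])) ∨
      (¬ Q a.length ∧ ∀ x < C, Alt C Q φ f (a ++ [x]))

/-- The values of the variables for an input of length `L` and an array of length `l`. -/
def baseEnv (L l : ℕ) : ℕ → ℕ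
  | 0 => L
  | 1 => l
  | _ + 2 => 0

/-- A description of an alternation by terms and formulas: the range of the quantifiers and their
number depend on the length of the input only, and the type of a quantifier depends also on the
number of the preceding quantifiers. -/
structure AltSpec where
  rangeTm : Tm
  lengthTm : Tm
  quantFml : Fml
  leafFml : Fml
  range : ℕ → ℕ
  length : ℕ → ℕ
  quant : ℕ → ℕ → Prop
  range_pos : ∀ L, 0 < range L
  range_spec : ∀ a e, rangeTm.eval a e = range (e 0)
  length_spec : ∀ a e, lengthTm.eval a e = length (e 0)
  quant_spec : ∀ w a e, quantFml.eval w a 2 e ↔ quant (e 0) (e 1)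

namespace AltSpec

variable (A : AltSpec)

/-- The truth of the leaf formula. -/
def Leaf (w : List Sym) (a : List ℕ) : Prop :=
  A.leafFml.eval w a 2 (baseEnv w.length a.length)

/-- The truth of the alternation for the word `w`. -/
def Holds (w : List Sym) : Prop :=
  Alt (A.range w.length) (A.quant w.length) (A.Leaf w) (A.length w.length) []

/-- Removes the last number of the array. -/
def clearLast : Prog := .loop 2 (isTop (some true)) (.pop 2) ;; .pop 2

/-- Replaces the last number of the array by its successor and removes the result, or removes the
number if the successor is out of range. -/
def nextLast : Prog :=
  .loop 2 (isTop (some true)) (.pop 2 ;; inc 2) ;;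
  (Fml.lt (.add (.var 2) (.const 1)) A.rangeTm).prog 3 ;;
  .ite resStack (isTop (some true))
    (popRes ;; popRes ;; .push 2 (some true) ;; forVar 2 (.push 2 (some true)) ;; inc 1)
    (popRes ;; forVar 2 skip ;; .pop 2)

/-- One step of the depth-first evaluation of the alternation. Without a result, the step descends:
it appends the number `0` to the array, or evaluates the leaf if the array is complete. With a
result, the step ascends: it proceeds to the next value of the last number if the result does not
decide the quantifier, and removes that number otherwise. -/
def step : Prog :=
  .ite resStack Option.isNone
    ((Fml.lt (.var 1) A.lengthTm).prog 2 ;;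
      .ite resStack (isTop (some true)) (popRes ;; .push 2 none ;; inc 1)
        (popRes ;; A.leafFml.prog 2))
    (.ite 2 Option.isNone (.pop 5)
      (dec 1 ;; A.quantFml.prog 2 ;;
        .ite resStack (isTop (some true))
          (popRes ;; .ite resStack (isTop (some true)) clearLast A.nextLast)
          (popRes ;; .ite resStack (isTop (some true)) A.nextLast clearLast)))

/-- The depth-first evaluation of the alternation. It runs as long as the control stack is not
empty. -/
def main : Prog := .loop 5 Option.isSome A.step

/-- The program that decides the alternation. -/
def prog : Prog :=
  .loop 0 Option.isSome (.mov 0 1 ;; inc 0) ;; .loop 1 Option.isSome (.mov 1 0) ;;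
  .push 5 none ;; A.main

/-- The memory during the evaluation. -/
def mem (w : List Sym) (a : List ℕ) (l : ℕ) (r c : List Sym) : Mem where
  inp := w
  inpA := []
  arr := (unaryBlocks a).reverse
  arrA := []
  res := r
  ctl := c
  env := baseEnv w.length l

/-- A bound on the variables and the array entries for an input of length `L`. -/
def numBound (L : ℕ) : ℕ := L + A.length L + A.range L

/-- A bound on the stacks for an input of length `L`. -/
def space (L : ℕ) : ℕ :=
  A.numBound L + A.length L * (A.numBound L + 1) +
    (A.leafFml.bd (A.numBound L) + A.quantFml.bd (A.numBound L) + A.rangeTm.bd (A.numBound L) +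
      A.lengthTm.bd (A.numBound L)) + (A.leafFml.height + A.quantFml.height + 10)

section Steps

variable {A} {S : ℕ} {w : List Sym} {a : List ℕ}

theorem baseEnv_le {L l B : ℕ} (hL : L ≤ B) (hl : l ≤ B) (i : ℕ) : baseEnv L l i ≤ B := by
  match i with
  | 0 => exact hL
  | 1 => exact hl
  | _ + 2 => exact Nat.zero_le _

theorem baseEnv_eq_zero {L l : ℕ} (i : ℕ) (hi : 2 ≤ i) : baseEnv L l i = 0 := by
  match i, hi with
  | _ + 2, _ => rfl

theorem update_baseEnv_one {L l l' : ℕ} :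
    Function.update (baseEnv L l) 1 l' = baseEnv L l' := by
  funext i
  match i with
  | 0 | 1 => simp [baseEnv]
  | i + 2 => simp [baseEnv]

theorem unaryBlocks_snoc_reverse (a : List ℕ) (x : ℕ) :
    (unaryBlocks (a ++ [x])).reverse =
      List.replicate x (some true) ++ none :: (unaryBlocks a).reverse := by
  simp

/-- The array has at most as many entries as there are quantifiers, and they are in range. -/
def Valid (A : AltSpec) (w : List Sym) (a : List ℕ) : Prop :=
  a.length ≤ A.length w.length ∧ ∀ x ∈ a, x < A.range w.length

theorem Valid.arr_le (h : A.Valid w a) :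
    (unaryBlocks a).reverse.length ≤ A.length w.length * (A.numBound w.length + 1) := by
  rw [List.length_reverse]
  refine (length_unaryBlocks_le (B := A.numBound w.length) fun x hx => ?_).trans
    (Nat.mul_le_mul_right _ h.1)
  have := h.2 x hx
  unfold numBound
  omega

theorem Valid.le_numBound (h : A.Valid w a) : ∀ x ∈ a, x ≤ A.numBound w.length := fun x hx => by
  have := h.2 x hx
  unfold numBound
  omega

open Classical in
/-- Evaluation of a formula on the memory. -/
theorem runs_fml (φ : Fml) (h : A.Valid w a) {l : ℕ} {r c : List Sym} (hS : A.space w.length ≤ S)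
    (hl : l ≤ A.length w.length) (hb : φ.bd (A.numBound w.length) ≤ A.space w.length)
    (hr : r.length + φ.height ≤ A.space w.length) :
    Runs S (φ.prog 2) (mem w a l r c).store
      (mem w a l (some (decide (φ.eval w a 2 (baseEnv w.length l))) :: r) c).store := by
  have h1 := h.arr_le
  have h2 : w.length ≤ A.numBound w.length := by
    unfold numBound
    omega
  have h3 : l ≤ A.numBound w.length := by
    unfold numBound
    omega
  have h4 : A.numBound w.length + A.length w.length * (A.numBound w.length + 1) ≤
      A.space w.length := by
    unfold space
    omega
  refine φ.runs_prog (B := A.numBound w.length) rfl rfl rfl rfl (baseEnv_le h2 h3)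
    h.le_numBound (baseEnv_eq_zero) (by omega) ?_ (by omega) ?_
  · change (unaryBlocks a).reverse.length ≤ S
    omega
  · exact hr.trans hS

theorem bd_lt_le_space : (Fml.lt (.var 1) A.lengthTm).bd (A.numBound w.length) ≤
    A.space w.length := by
  simp only [Fml.bd, Tm.bd, space]
  omega

theorem runs_step_push (h : A.Valid w a) (hS : A.space w.length ≤ S)
    (hlt : a.length < A.length w.length) {c : List Sym} :
    Runs S A.step (mem w a a.length [] c).store
      (mem w (a ++ [0]) (a ++ [0]).length [] c).store := by
  have h1 := h.arr_le
  have hsp : A.numBound w.length + A.length w.length * (A.numBound w.length + 1) + 10 ≤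
      A.space w.length := by
    unfold space
    omega
  have hN : A.length w.length ≤ A.numBound w.length := by
    unfold numBound
    omega
  refine Runs.iteT (by simp [Mem.store, mem]) (Runs.seq
    (runs_fml _ h hS h.1 bd_lt_le_space ?_) (Runs.iteT ?_ ?_))
  · simp only [Fml.height, List.length_nil]
    omega
  · simp only [Mem.store, mem, Fml.eval, Tm.eval, baseEnv, length_spec, hlt]
    rfl
  · refine (Runs.seq runs_popRes (Runs.seq (runs_pushArr ?_) (runs_inc ?_))).castMem ?_
    · simp only [mem]
      omega
    · simp only [mem, baseEnv]
      omega
    · simp only [mem, update_baseEnv_one]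
      ext1 <;> simp [baseEnv]

open Classical in
theorem runs_step_leaf (h : A.Valid w a) (hS : A.space w.length ≤ S)
    (hlt : a.length = A.length w.length) {c : List Sym} :
    Runs S A.step (mem w a a.length [] c).store
      (mem w a a.length [some (decide (A.Leaf w a))] c).store := by
  have hsp : A.leafFml.bd (A.numBound w.length) + A.leafFml.height + 10 ≤
      A.space w.length := by
    unfold space
    omega
  refine Runs.iteT (by simp [Mem.store, mem]) (Runs.seq
    (runs_fml _ h hS h.1 bd_lt_le_space ?_) (Runs.iteF ?_ (Runs.seq runs_popRes
    ((runs_fml A.leafFml h hS h.1 (by omega) ?_)))))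
  · simp only [Fml.height, List.length_nil]
    omega
  · simp [Mem.store, mem, Fml.eval, Tm.eval, baseEnv, length_spec, hlt, isTop]
  · change 0 + _ ≤ _
    omega

theorem runs_step_done {v : Bool} {c : Sym} :
    Runs S A.step (mem w [] 0 [some v] [c]).store (mem w [] 0 [some v] []).store :=
  Runs.iteF (by simp [Mem.store, mem]) (Runs.iteT (by simp [Mem.store, mem])
    (runs_popCtl.castMem rfl))

theorem runs_clearLast {m : Mem} {x : ℕ} {r : List Sym}
    (hm : m.arr = List.replicate x (some true) ++ none :: r) :
    Runs S clearLast m.store (Mem.store { m with arr := r }) := by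
  induction x generalizing m with
  | zero =>
    simp only [List.replicate_zero, List.nil_append] at hm
    refine Runs.seq (Runs.loopF (by simp [Mem.store, hm, isTop])) (runs_popArr.castMem ?_)
    simp [hm]
  | succ x ih =>
    rw [List.replicate_succ, List.cons_append] at hm
    have := ih (m := { m with arr := List.replicate x (some true) ++ none :: r }) rfl
    unfold clearLast at this ⊢
    cases this with
    | seq h₁ h₂ =>
      refine Runs.seq (Runs.loopT (by simp [Mem.store, hm, isTop]) (runs_popArr.castMem ?_) h₁) h₂
      simp [hm]

/-- Removal of the last number of the array counts it. -/
theorem runs_countLast {m : Mem} {x : ℕ} {r : List Sym}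
    (hm : m.arr = List.replicate x (some true) ++ none :: r) (hS : m.env 2 + x ≤ S) :
    Runs S (.loop 2 (isTop (some true)) (.pop 2 ;; inc 2)) m.store (Mem.store { m with
      arr := none :: r, env := Function.update m.env 2 (m.env 2 + x) }) := by
  induction x generalizing m with
  | zero =>
    simp only [List.replicate_zero, List.nil_append] at hm
    refine (Runs.loopF (by simp [Mem.store, hm, isTop])).castMem ?_
    ext1 <;> simp [hm]
  | succ x ih =>
    rw [List.replicate_succ, List.cons_append] at hm
    refine (Runs.loopT (by simp [Mem.store, hm, isTop]) (Runs.seq runs_popArr (runs_inc ?_))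
      (ih (by simp [hm]) ?_)).castMem ?_
    · simp only
      omega
    · simp
      omega
    · ext1 <;> simp [Nat.add_assoc, Nat.add_comm 1 x]

/-- The memory after the removal of the last number of the array, with that number counted. -/
def midMem (w : List Sym) (a : List ℕ) (x : ℕ) (r c : List Sym) : Mem where
  inp := w
  inpA := []
  arr := (unaryBlocks (a ++ [0])).reverse
  arrA := []
  res := r
  ctl := c
  env := Function.update (baseEnv w.length a.length) 2 x

open Classical in
theorem runs_nextLast_test {x : ℕ} (h : A.Valid w (a ++ [x])) (hS : A.space w.length ≤ S) {v : Bool}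
    {c : List Sym} :
    Runs S (.loop 2 (isTop (some true)) (.pop 2 ;; inc 2) ;;
      (Fml.lt (.add (.var 2) (.const 1)) A.rangeTm).prog 3)
      (mem w (a ++ [x]) a.length [some v] c).store
      (midMem w a x [some (decide (x + 1 < A.range w.length)), some v] c).store := by
  have hx : x < A.range w.length := h.2 x (by simp)
  have hv : A.Valid w (a ++ [0]) := by
    refine ⟨by simpa using h.1, fun y hy => ?_⟩
    rcases List.mem_append.1 hy with hy | hy
    · exact h.2 y (by simp [hy])
    · simp only [List.mem_singleton] at hy
      omega
  have h1 := hv.arr_le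
  have h2 : w.length + A.length w.length + A.range w.length ≤ A.numBound w.length := le_rfl
  have h3 : A.numBound w.length + A.length w.length * (A.numBound w.length + 1) + 10 ≤
      A.space w.length := by
    unfold space
    omega
  have h4 : a.length + 1 ≤ A.length w.length := by simpa using h.1
  refine Runs.seq (t := (midMem w a x [some v] c).store)
    ((runs_countLast (x := x) (unaryBlocks_snoc_reverse a x) ?_).castMem ?_)
    ((Fml.runs_prog (w := w) (a := a ++ [0]) (B := A.numBound w.length) _ rfl rfl rfl rfl ?_
      hv.le_numBound ?_ (by omega) ?_ ?_ ?_).castMem ?_)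
  · simp only [mem, baseEnv]
    omega
  · ext1 <;> simp [mem, midMem, baseEnv]
  · intro i
    simp only [midMem, Function.update_apply]
    split_ifs
    · omega
    · exact baseEnv_le (by omega) (by omega) i
  · intro i hi
    simp only [midMem]
    rw [Function.update_of_ne (by omega), baseEnv_eq_zero i (by omega)]
  · change (unaryBlocks (a ++ [0])).reverse.length ≤ S
    omega
  · have : (Fml.lt (.add (.var 2) (.const 1)) A.rangeTm).bd (A.numBound w.length) ≤
        A.space w.length := by
      simp only [Fml.bd, Tm.bd, space]
      omega
    omega
  · simp only [midMem, List.length_cons, List.length_nil, Fml.height]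
    omega
  · ext1 <;> simp [midMem, Fml.eval, Tm.eval, range_spec, baseEnv]

theorem runs_nextLast_next {x : ℕ} (h : A.Valid w (a ++ [x])) (hS : A.space w.length ≤ S) {v : Bool}
    {c : List Sym} (hx : x + 1 < A.range w.length) :
    Runs S A.nextLast (mem w (a ++ [x]) a.length [some v] c).store
      (mem w (a ++ [x + 1]) (a ++ [x + 1]).length [] c).store := by
  have hv : A.Valid w (a ++ [x + 1]) := by
    refine ⟨by simpa using h.1, fun y hy => ?_⟩
    rcases List.mem_append.1 hy with hy | hy
    · exact h.2 y (by simp [hy])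
    · simp only [List.mem_singleton] at hy
      omega
  have h1 := hv.arr_le
  rw [unaryBlocks_snoc_reverse, List.length_append, List.length_replicate, List.length_cons] at h1
  have h2 : w.length + A.length w.length + A.range w.length ≤ A.numBound w.length := le_rfl
  have h3 : A.numBound w.length + A.length w.length * (A.numBound w.length + 1) + 10 ≤
      A.space w.length := by
    unfold space
    omega
  have h4 : a.length + 1 ≤ A.length w.length := by simpa using h.1
  cases runs_nextLast_test h hS (v := v) (c := c) with
  | seq t₁ t₂ =>
  refine Runs.seq t₁ (Runs.seq t₂ (Runs.iteT ?_ (Runs.seq runs_popRes (Runs.seq runs_popRes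
    (Runs.seq (runs_pushArr ?_) (Runs.seq (runs_forVar (n := x)
    (m' := { mem w (a ++ [x + 1]) a.length [] c with })
    (fun k => { mem w (a ++ [x + 1]) a.length [] c with
      arr := List.replicate (x - k + 1) (some true) ++ none :: (unaryBlocks a).reverse
      env := Function.update (baseEnv w.length a.length) 2 k }) ?_ ?_ ?_ ?_)
    ((runs_inc ?_).castMem ?_)))))))
  · simp [midMem, Mem.store, isTop, hx]
  · simp only [midMem, unaryBlocks_snoc_reverse, List.replicate_zero, List.nil_append,
      List.length_cons]
    omega
  · ext1 <;> simp [midMem, mem]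
  · ext1 <;> simp [mem, baseEnv]
  · simp
  · intro k hk
    refine (runs_pushArr ?_).castMem ?_
    · simp only [List.length_append, List.length_replicate, List.length_cons]
      omega
    · have e : x - k = x - (k + 1) + 1 := by omega
      ext1 <;> simp [mem]
      rw [e, List.replicate_succ (n := x - (k + 1) + 1)]
      rfl
  · simp only [mem, baseEnv]
    omega
  · ext1 <;> simp [mem, baseEnv, update_baseEnv_one]

theorem runs_nextLast_last {x : ℕ} (h : A.Valid w (a ++ [x])) (hS : A.space w.length ≤ S) {v : Bool}
    {c : List Sym} (hx : ¬ x + 1 < A.range w.length) :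
    Runs S A.nextLast (mem w (a ++ [x]) a.length [some v] c).store
      (mem w a a.length [some v] c).store := by
  cases runs_nextLast_test h hS (v := v) (c := c) with
  | seq t₁ t₂ =>
  refine Runs.seq t₁ (Runs.seq t₂ (Runs.iteF ?_ (Runs.seq runs_popRes (Runs.seq
    (runs_forVar (n := x) (m' := midMem w a 0 [some v] c)
    (fun k => midMem w a k [some v] c) rfl rfl ?_ ?_) (runs_popArr.castMem ?_)))))
  · simpa [midMem, Mem.store, isTop] using hx
  · simp [midMem]
  · intro k _
    exact runs_skip.castMem (by ext1 <;> simp [midMem])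
  · ext1 <;> simp [midMem, mem, baseEnv]

open Classical in
/-- The beginning of an ascending step, up to the decision about the last number. -/
theorem runs_step_up {x : ℕ} (h : A.Valid w (a ++ [x])) (hS : A.space w.length ≤ S) {v : Bool}
    {c : List Sym} {t : Store}
    (ht : Runs S (if v = decide (A.quant w.length a.length) then clearLast else A.nextLast)
      (mem w (a ++ [x]) a.length [some v] c).store t) :
    Runs S A.step (mem w (a ++ [x]) (a ++ [x]).length [some v] c).store t := by
  have hsp : A.quantFml.bd (A.numBound w.length) + A.quantFml.height + 10 ≤
      A.space w.length := by
    unfold space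
    omega
  have h4 : a.length + 1 ≤ A.length w.length := by simpa using h.1
  have hdec : Runs S (dec 1) (mem w (a ++ [x]) (a ++ [x]).length [some v] c).store
      (mem w (a ++ [x]) a.length [some v] c).store := by
    refine runs_dec.castMem ?_
    ext1 <;> simp [mem, baseEnv, update_baseEnv_one]
  refine Runs.iteF (by simp [Mem.store, mem]) (Runs.iteF ?_ (Runs.seq hdec (Runs.seq
    (runs_fml A.quantFml h hS (by omega) (by omega) ?_) ?_)))
  · simp only [Mem.store, mem, unaryBlocks_snoc_reverse]
    cases x <;> simp [List.replicate_succ]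
  · simp only [List.length_cons, List.length_nil]
    omega
  · simp only [quant_spec, baseEnv]
    by_cases hq : A.quant w.length a.length
    · refine Runs.iteT (by simp [Mem.store, mem, hq, isTop]) (Runs.seq
        (runs_popRes.castMem (m' := mem w (a ++ [x]) a.length [some v] c) rfl) ?_)
      cases v
      · refine Runs.iteF (by simp [Mem.store, mem, isTop]) ?_
        simpa [hq] using ht
      · refine Runs.iteT (by simp [Mem.store, mem, isTop]) ?_
        simpa [hq] using ht
    · refine Runs.iteF (by simp [Mem.store, mem, hq, isTop]) (Runs.seq
        (runs_popRes.castMem (m' := mem w (a ++ [x]) a.length [some v] c) rfl) ?_)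
      cases v
      · refine Runs.iteF (by simp [Mem.store, mem, isTop]) ?_
        simpa [hq] using ht
      · refine Runs.iteT (by simp [Mem.store, mem, isTop]) ?_
        simpa [hq] using ht

open Classical in
/-- The evaluation computes the value of the alternation below every array. The statement is in
continuation-passing form: the rest of the loop is arbitrary. -/
theorem runs_main_of (hS : A.space w.length ≤ S) {t : Store} {c : Sym} (f : ℕ) :
    ∀ a : List ℕ, A.Valid w a → a.length + f = A.length w.length →
      Runs S A.main (mem w a a.length [some (decide (Alt (A.range w.length) (A.quant w.length)
        (A.Leaf w) f a))] [c]).store t →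
      Runs S A.main (mem w a a.length [] [c]).store t := by
  induction f with
  | zero =>
    intro a ha hf ht
    exact Runs.loopT (by simp [Mem.store, mem]) (runs_step_leaf ha hS (by omega)) ht
  | succ f ih =>
    intro a ha hf ht
    have hR := A.range_pos w.length
    have hval : ∀ x, x < A.range w.length → A.Valid w (a ++ [x]) := fun x hx => by
      refine ⟨by simp; omega, fun y hy => ?_⟩
      rcases List.mem_append.1 hy with hy | hy
      · exact ha.2 y hy
      · simpa using (List.mem_singleton.1 hy) ▸ hx
    -- The values of the last number below `x` have not decided the quantifier.
    have key : ∀ g x, x < A.range w.length → x + g + 1 = A.range w.length →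
        (∀ y < x, (Alt (A.range w.length) (A.quant w.length) (A.Leaf w) f (a ++ [y]) ↔
          ¬ A.quant w.length a.length)) →
        Runs S A.main (mem w (a ++ [x]) (a ++ [x]).length [] [c]).store t := by
      intro g
      induction g with
      | zero =>
        intro x hx hg hy
        refine ih (a ++ [x]) (hval x hx) (by simp; omega) (Runs.loopT (by simp [Mem.store, mem])
          (runs_step_up (hval x hx) hS (t := (mem w a a.length [some (decide (Alt
            (A.range w.length) (A.quant w.length) (A.Leaf w) f (a ++ [x])))] [c]).store) ?_) ?_)
        · split_ifs
          · exact (runs_clearLast (unaryBlocks_snoc_reverse a x)).castMem rfl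
          · exact runs_nextLast_last (hval x hx) hS (by omega)
        · convert! ht using 6
          simp only [Alt]
          have hlast : ∀ y < A.range w.length, y = x ∨ y < x := fun y hy => by omega
          by_cases hq : A.quant w.length a.length
          · simp only [hq, not_true, iff_false, true_and, false_and, or_false] at hy ⊢
            constructor
            · exact fun h => ⟨x, hx, h⟩
            · rintro ⟨y, hyR, h⟩
              rcases hlast y hyR with rfl | hlt
              · exact h
              · exact absurd h (hy y hlt)
          · simp only [hq, not_false_eq_true, iff_true, true_and, false_and, false_or] at hy ⊢
            constructor
            · intro h y hyR
              rcases hlast y hyR with rfl | hlt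
              · exact h
              · exact hy y hlt
            · exact fun h => h x hx
      | succ g ihg =>
        intro x hx hg hy
        by_cases hd : Alt (A.range w.length) (A.quant w.length) (A.Leaf w) f (a ++ [x]) ↔
            A.quant w.length a.length
        · refine ih (a ++ [x]) (hval x hx) (by simp; omega) (Runs.loopT
            (by simp [Mem.store, mem]) (runs_step_up (hval x hx) hS
            (t := (mem w a a.length [some (decide (Alt (A.range w.length) (A.quant w.length)
              (A.Leaf w) f (a ++ [x])))] [c]).store) ?_) ?_)
          · rw [if_pos (decide_eq_decide.2 hd)]
            exact (runs_clearLast (unaryBlocks_snoc_reverse a x)).castMem rfl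
          · convert! ht using 6
            simp only [Alt, hd]
            by_cases hq : A.quant w.length a.length
            · simp only [hq, not_true, true_and, false_and, or_false, true_iff]
              exact ⟨x, hx, hd.2 hq⟩
            · simp only [hq, not_false_eq_true, true_and, false_and, false_or, false_iff]
              exact fun h => hq (hd.1 (h x hx))
        · refine ih (a ++ [x]) (hval x hx) (by simp; omega) (Runs.loopT
            (by simp [Mem.store, mem]) (runs_step_up (hval x hx) hS
            (t := (mem w (a ++ [x + 1]) (a ++ [x + 1]).length [] [c]).store) ?_) ?_)
          · rw [if_neg (fun h => hd (decide_eq_decide.1 h))]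
            exact runs_nextLast_next (hval x hx) hS (by omega)
          · refine ihg (x + 1) (by omega) (by omega) fun y hyx => ?_
            rcases Nat.lt_succ_iff_lt_or_eq.1 hyx with h | rfl
            · exact hy y h
            · tauto
    exact Runs.loopT (by simp [Mem.store, mem]) (runs_step_push ha hS (by omega))
      (key (A.range w.length - 1) 0 hR (by omega) (by simp))

/-- The memory with the input only. -/
theorem initStore_eq (w : List Sym) : initStore w =
    Mem.store { inp := w, inpA := [], arr := [], arrA := [], res := [], ctl := [],
                env := fun _ => 0 } := by
  funext k
  match k with
  | 0 | 1 | 2 | 3 | 4 | 5 | k + 6 => simp [initStore, Mem.store]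

/-- Computation of the length of the input. -/
theorem runs_countInp (m : Mem) (hS : m.inp.length + m.inpA.length ≤ S)
    (hm : m.inp.length + m.env 0 ≤ S) :
    Runs S (.loop 0 Option.isSome (.mov 0 1 ;; inc 0)) m.store (Mem.store { m with
      inp := []
      inpA := m.inp.reverse ++ m.inpA
      env := Function.update m.env 0 (m.env 0 + m.inp.length) }) := by
  obtain ⟨l, hl⟩ : ∃ l, m.inp = l := ⟨_, rfl⟩
  induction l generalizing m with
  | nil =>
    refine (Runs.loopF (by simp [Mem.store, hl])).castMem ?_
    ext1 <;> simp [hl]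
  | cons a l ih =>
    rw [hl, List.length_cons] at hS hm
    refine (Runs.loopT (by simp [Mem.store, hl]) (Runs.seq (runs_movInp hl (by omega))
      (runs_inc (by simp only; omega))) (ih _ ?_ ?_ rfl)).castMem ?_
    · simp only [List.length_cons]
      omega
    · simp only [Function.update_self]
      omega
    · ext1 <;> simp [hl, Nat.add_assoc, Nat.add_comm 1 l.length]

open Classical in
theorem runs_prog (hS : A.space w.length ≤ S) :
    Runs S A.prog (initStore w) (mem w [] 0 [some (decide (A.Holds w))] []).store := by
  have hsp : w.length + 10 ≤ A.space w.length := by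
    unfold space numBound
    omega
  rw [initStore_eq]
  refine Runs.seq (runs_countInp _ ?_ ?_) (Runs.seq (runs_rewindInp _ ?_) (Runs.seq
    ((runs_pushCtl ?_).castMem (m' := mem w [] 0 [] [none]) ?_)
    (runs_main_of hS (A.length w.length) [] ⟨by simp, by simp⟩ (by simp) ?_)))
  · simp only [List.length_nil]
    omega
  · simp only
    omega
  · simp
    omega
  · simp only [List.length_nil]
    omega
  · ext1 <;> simp [mem]
    funext i
    match i with
    | 0 | 1 => simp [baseEnv]
    | i + 2 => simp [baseEnv]
  · exact Runs.loopT (by simp [Mem.store, mem]) runs_step_done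
      (Runs.loopF (by simp [Mem.store, mem]))

end Steps

end AltSpec

/-! ### Polynomial bounds -/

/-- The function `f` is bounded by a polynomial. -/
def PolyBounded (f : ℕ → ℕ) : Prop := ∃ p : Polynomial ℕ, ∀ x, f x ≤ p.eval x

namespace PolyBounded

variable {f g : ℕ → ℕ}

theorem const (c : ℕ) : PolyBounded fun _ => c := ⟨Polynomial.C c, fun x => by simp⟩

theorem id : PolyBounded fun x => x := ⟨Polynomial.X, fun x => by simp⟩

theorem add (hf : PolyBounded f) (hg : PolyBounded g) : PolyBounded fun x => f x + g x := by
  obtain ⟨p, hp⟩ := hf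
  obtain ⟨q, hq⟩ := hg
  exact ⟨p + q, fun x => by
    rw [Polynomial.eval_add]
    exact Nat.add_le_add (hp x) (hq x)⟩

theorem mul (hf : PolyBounded f) (hg : PolyBounded g) : PolyBounded fun x => f x * g x := by
  obtain ⟨p, hp⟩ := hf
  obtain ⟨q, hq⟩ := hg
  exact ⟨p * q, fun x => by
    rw [Polynomial.eval_mul]
    exact Nat.mul_le_mul (hp x) (hq x)⟩

theorem tm_bd (hf : PolyBounded f) : ∀ t : Tm, PolyBounded fun x => t.bd (f x)
  | .var _ => hf
  | .const c => const c
  | .add t u => (tm_bd hf t).add (tm_bd hf u)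
  | .mul t u => (((tm_bd hf t).mul (tm_bd hf u)).add (tm_bd hf t)).add (tm_bd hf u)
  | .shr t u => (tm_bd hf t).add (tm_bd hf u)
  | .arr t => hf.add (tm_bd hf t)

theorem fml_bd (hf : PolyBounded f) (φ : Fml) : PolyBounded fun x => φ.bd (f x) := by
  induction φ generalizing f with
  | lt t u => exact (tm_bd hf t).add (tm_bd hf u)
  | inp t _ => exact tm_bd hf t
  | neg φ ih => exact ih hf
  | conj φ ψ ih₁ ih₂ => exact (ih₁ hf).add (ih₂ hf)
  | ex t φ ih => exact (tm_bd hf t).add (ih (hf.add (tm_bd hf t)))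

end PolyBounded

/-- Polynomially long alternation with a first-order matrix can be decided in polynomial space. -/
theorem AltSpec.mem_PSPACE (A : AltSpec) (hR : PolyBounded A.range) (hL : PolyBounded A.length) :
    ({w | A.Holds w} : Language (Option Bool)) ∈ PSPACE (Option Bool) := by
  classical
  have hN : PolyBounded A.numBound := (PolyBounded.id.add hL).add hR
  obtain ⟨p, hp⟩ : PolyBounded A.space :=
    ((hN.add (hL.mul (hN.add (.const 1)))).add
      ((((hN.fml_bd _).add (hN.fml_bd _)).add (hN.tm_bd _)).add (hN.tm_bd _))).add (.const _)
  refine mem_PSPACE_of_prog A.prog p fun w => ⟨?_, _, A.runs_prog (hp _), ?_⟩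
  · refine le_trans ?_ (hp _)
    unfold AltSpec.space AltSpec.numBound
    omega
  · change A.Holds w ↔ _
    simp [Mem.store, mem]

/-! ### Plays from arbitrary vertices -/

section Plays

variable {V : Type*}

/-- The histories that arise from `v` when the move at each history is given by `m`. -/
def unroll (m : List V → V → V) (v : V) : ℕ → List V × V
  | 0 => ([], v)
  | j + 1 => ((unroll m v j).1 ++ [(unroll m v j).2], m (unroll m v j).1 (unroll m v j).2)

theorem length_unroll (m : List V → V → V) (v : V) (j : ℕ) : (unroll m v j).1.length = j := by
  induction j with
  | zero => rfl
  | succ j ih => simp [unroll, ih]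

theorem unroll_add (m : List V → V → V) (v : V) (a b : ℕ) :
    unroll m v (a + b) = ((unroll m v a).1 ++
      (unroll (fun h u => m ((unroll m v a).1 ++ h) u) (unroll m v a).2 b).1,
      (unroll (fun h u => m ((unroll m v a).1 ++ h) u) (unroll m v a).2 b).2) := by
  induction b with
  | zero => simp [unroll]
  | succ b ih => simp [unroll, ih]

theorem unroll_congr {m m' : List V → V → V} {v : V} {N : ℕ}
    (h : ∀ j < N, m' (unroll m v j).1 (unroll m v j).2 = m (unroll m v j).1 (unroll m v j).2) :
    ∀ j ≤ N, unroll m' v j = unroll m v j := by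
  intro j hj
  induction j with
  | zero => rfl
  | succ j ih =>
    have := h j (by omega)
    simp only [unroll, ih (by omega), this]

/-- The history up to and including the current vertex, as a list. -/
theorem unroll_fst_append (m : List V → V → V) (v : V) (j : ℕ) :
    (unroll m v j).1 ++ [(unroll m v j).2] =
      (List.range (j + 1)).map fun i => (unroll m v i).2 := by
  induction j with
  | zero => rfl
  | succ j ih =>
    rw [List.range_succ, List.map_append, ← ih]
    rfl

theorem unroll_fst (m : List V → V → V) (v : V) (j : ℕ) :
    (unroll m v j).1 = (List.range j).map fun i => (unroll m v i).2 := by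
  cases j with
  | zero => rfl
  | succ j => exact unroll_fst_append m v j

variable {G : GameGraph V}

theorem move_one (f₁ : Strategy G .one) (f₂ : Strategy G .two) (ρ : List V) {v : V}
    (h : G.owner v = .one) : move f₁ f₂ ρ v = f₁.next ρ ⟨v, h⟩ := by
  unfold move
  split
  · rfl
  · rename_i h'
    rw [h] at h'
    cases h'

theorem move_two (f₁ : Strategy G .one) (f₂ : Strategy G .two) (ρ : List V) {v : V}
    (h : G.owner v = .two) : move f₁ f₂ ρ v = f₂.next ρ ⟨v, h⟩ := by
  unfold move
  split
  · rename_i h'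
    rw [h] at h'
    cases h'
  · rfl

theorem edge_move (f₁ : Strategy G .one) (f₂ : Strategy G .two) (ρ : List V) (v : V) :
    G.edge v (move f₁ f₂ ρ v) := by
  cases h : G.owner v with
  | one =>
    rw [move_one _ _ _ h]
    exact f₁.legal ρ ⟨v, h⟩
  | two =>
    rw [move_two _ _ _ h]
    exact f₂.legal ρ ⟨v, h⟩

/-- The play from `v` that a pair of strategies generates. -/
def play (f₁ : Strategy G .one) (f₂ : Strategy G .two) (v : V) (j : ℕ) : V :=
  (unroll (move f₁ f₂) v j).2

/-- The history of the first `j` moves of a play, without the current vertex. -/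
def past (f₁ : Strategy G .one) (f₂ : Strategy G .two) (v : V) (j : ℕ) : List V :=
  (unroll (move f₁ f₂) v j).1

theorem outcome_eq_play (f₁ : Strategy G .one) (f₂ : Strategy G .two) :
    outcome f₁ f₂ = play f₁ f₂ G.init := by
  have : ∀ j, history f₁ f₂ j = unroll (move f₁ f₂) G.init j := by
    intro j
    induction j with
    | zero => rfl
    | succ j ih => simp only [history, unroll, ih]
  funext j
  exact congrArg Prod.snd (this j)

/-- The strategy that remains after the history `ρ`. -/
def Strategy.shift {p : Player} (f : Strategy G p) (ρ : List V) : Strategy G p where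
  next h v := f.next (ρ ++ h) v
  legal h v := f.legal (ρ ++ h) v

theorem move_shift (f₁ : Strategy G .one) (f₂ : Strategy G .two) (ρ : List V) :
    move (f₁.shift ρ) (f₂.shift ρ) = fun h u => move f₁ f₂ (ρ ++ h) u := by
  funext h u
  cases hu : G.owner u with
  | one => rw [move_one _ _ _ hu, move_one _ _ _ hu, Strategy.shift]
  | two => rw [move_two _ _ _ hu, move_two _ _ _ hu, Strategy.shift]

theorem play_add (f₁ : Strategy G .one) (f₂ : Strategy G .two) (v : V) (a b : ℕ) :
    play f₁ f₂ v (a + b) = play (f₁.shift (past f₁ f₂ v a)) (f₂.shift (past f₁ f₂ v a))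
      (play f₁ f₂ v a) b := by
  unfold play past
  rw [unroll_add, move_shift]

open Classical in
/-- The strategy that plays `f` until the history `ρ` and `f'` from then on. -/
noncomputable def Strategy.graft {p : Player} (f : Strategy G p) (ρ : List V) (f' : Strategy G p) :
    Strategy G p where
  next h v := if ρ <+: h then f'.next (h.drop ρ.length) v else f.next h v
  legal h v := by
    split_ifs
    · exact f'.legal _ v
    · exact f.legal h v

theorem Strategy.shift_graft {p : Player} (f : Strategy G p) (ρ : List V) (f' : Strategy G p) :
    (f.graft ρ f').shift ρ = f' := by
  unfold Strategy.graft Strategy.shift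
  simp

theorem unroll_graft (f₁ : Strategy G .one) (f₂ f' : Strategy G .two) (v : V) (a : ℕ) :
    ∀ j ≤ a, unroll (move f₁ (f₂.graft (past f₁ f₂ v a) f')) v j = unroll (move f₁ f₂) v j := by
  refine unroll_congr fun j hj => ?_
  cases h : G.owner (unroll (move f₁ f₂) v j).2 with
  | one => rw [move_one _ _ _ h, move_one _ _ _ h]
  | two =>
    rw [move_two _ _ _ h, move_two _ _ _ h, Strategy.graft]
    refine if_neg fun hp => ?_
    have := hp.length_le
    rw [past, length_unroll, length_unroll] at this
    omega

theorem play_graft (f₁ : Strategy G .one) (f₂ f' : Strategy G .two) (v : V) (a b : ℕ) :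
    play f₁ (f₂.graft (past f₁ f₂ v a) f') v (a + b) =
      play (f₁.shift (past f₁ f₂ v a)) f' (play f₁ f₂ v a) b := by
  rw [play_add]
  have h := unroll_graft f₁ f₂ f' v a a le_rfl
  have h1 : past f₁ (f₂.graft (past f₁ f₂ v a) f') v a = past f₁ f₂ v a := congrArg Prod.fst h
  have h2 : play f₁ (f₂.graft (past f₁ f₂ v a) f') v a = play f₁ f₂ v a := congrArg Prod.snd h
  rw [h1, h2, Strategy.shift_graft]

/-! ### Satisfaction of objectives -/

theorem infSet_shift (ρ : ℕ → V) (a : ℕ) : infSet (fun t => ρ (a + t)) = infSet ρ := by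
  ext v
  simp only [infSet, Set.mem_ofPred_eq, ← Nat.frequently_atTop_iff_infinite,
    Filter.frequently_atTop]
  constructor
  · intro h N
    obtain ⟨t, ht, hv⟩ := h N
    exact ⟨a + t, by omega, hv⟩
  · intro h N
    obtain ⟨t, ht, hv⟩ := h (a + N)
    exact ⟨t - a, by omega, by rwa [Nat.add_sub_cancel' (by omega)]⟩

theorem satisfies_shift (γ : ObjectiveType) (ρ : ℕ → V) (a : ℕ) (s : Set V) :
    Satisfies γ (fun t => ρ (a + t)) s ↔ Satisfies γ ρ s := by
  unfold Satisfies
  rw [infSet_shift]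

theorem infSet_inter_nonempty [Finite V] (ρ : ℕ → V) (s : Set V) :
    (infSet ρ ∩ s).Nonempty ↔ {t | ρ t ∈ s}.Infinite := by
  constructor
  · rintro ⟨v, hv, hs⟩
    exact hv.mono fun t (ht : ρ t = v) => by
      change ρ t ∈ s
      rwa [ht]
  · intro h
    by_contra hne
    refine h ?_
    have : {t | ρ t ∈ s} ⊆ ⋃ v ∈ s, {t | ρ t = v} := fun t ht => by
      simp only [Set.mem_iUnion]
      exact ⟨ρ t, ht, rfl⟩
    refine ((Set.toFinite s).biUnion fun v hv => ?_).subset this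
    by_contra hinf
    exact hne ⟨v, hinf, hv⟩

theorem satisfies_buchi [Finite V] (ρ : ℕ → V) (s : Set V) :
    Satisfies .buchi ρ s ↔ {t | ρ t ∈ s}.Infinite := infSet_inter_nonempty ρ s

theorem forall_satisfies_coBuchi [Finite V] {ι : Type*} (ρ : ℕ → V) (α : ι → Set V) (J : Set ι) :
    (∀ j ∈ J, Satisfies .coBuchi ρ (α j)) ↔ {t | ρ t ∈ ⋃ j ∈ J, α j}.Finite := by
  rw [← Set.not_infinite, ← infSet_inter_nonempty, Set.not_nonempty_iff_eq_empty]
  simp only [Satisfies, Set.inter_iUnion, Set.iUnion_eq_empty]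

end Plays

/-! ### Covering strategies and separation of the agents -/

section Covering

variable {V : Type*} (γ : ObjectiveType) (G : GameGraph V) (α : ℕ → Set V)

/-- The vertices from which `κ` agents can cover the objectives with indices in `J`. -/
def Covered (κ : ℕ) (J : Set ℕ) : Set V :=
  {v | ∃ F : Fin κ → Strategy G .one, ∀ f₂, ∀ j ∈ J, ∃ i, Satisfies γ (play (F i) f₂ v) (α j)}

/-- The vertices from which one agent can reach `S` or satisfy all objectives with indices in
`J`. -/
def Single (S : Set V) (J : Set ℕ) : Set V :=
  {v | ∃ σ : Strategy G .one, ∀ f₂, (∃ t, play σ f₂ v t ∈ S) ∨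
    ∀ j ∈ J, Satisfies γ (play σ f₂ v) (α j)}

/-- The vertices at which `κ` agents with the objectives `J` can be divided into two nonempty
groups that divide the objectives among them. -/
def Divisible (κ : ℕ) (J : Set ℕ) : Set V :=
  {v | ∃ κ₁ X, 0 < κ₁ ∧ κ₁ < κ ∧ v ∈ Covered γ G α κ₁ (J ∩ X) ∧
    v ∈ Covered γ G α (κ - κ₁) (J \ X)}

variable {γ G α}

theorem covered_of_fintype {I : Type*} [Fintype I] {J : Set ℕ} {v : V} (F : I → Strategy G .one)
    (h : ∀ f₂, ∀ j ∈ J, ∃ i, Satisfies γ (play (F i) f₂ v) (α j)) :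
    v ∈ Covered γ G α (Fintype.card I) J := by
  refine ⟨fun i => F ((Fintype.equivFin I).symm i), fun f₂ j hj => ?_⟩
  obtain ⟨i, hi⟩ := h f₂ j hj
  exact ⟨Fintype.equivFin I i, by simpa using hi⟩

theorem divisible_subset_covered (κ : ℕ) (J : Set ℕ) :
    Divisible γ G α κ J ⊆ Covered γ G α κ J := by
  rintro v ⟨κ₁, X, h0, hκ, ⟨F, hF⟩, ⟨F', hF'⟩⟩
  have h : v ∈ Covered γ G α (Fintype.card (Fin κ₁ ⊕ Fin (κ - κ₁))) J := by
    refine covered_of_fintype (Sum.elim F F') fun f₂ j hj => ?_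
    by_cases hX : j ∈ X
    · obtain ⟨i, hi⟩ := hF f₂ j ⟨hj, hX⟩
      exact ⟨Sum.inl i, hi⟩
    · obtain ⟨i, hi⟩ := hF' f₂ j ⟨hj, hX⟩
      exact ⟨Sum.inr i, hi⟩
  rw [Fintype.card_sum, Fintype.card_fin, Fintype.card_fin, Nat.add_sub_cancel' hκ.le] at h
  exact h

theorem covered_mono_agents {κ κ' : ℕ} (h0 : 0 < κ) (h : κ ≤ κ') (J : Set ℕ) :
    Covered γ G α κ J ⊆ Covered γ G α κ' J := by
  rintro v ⟨F, hF⟩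
  refine ⟨fun i => if hi : i < κ then F ⟨i, hi⟩ else F ⟨0, h0⟩, fun f₂ j hj => ?_⟩
  obtain ⟨i, hi⟩ := hF f₂ j hj
  exact ⟨⟨i, by omega⟩, by simpa using hi⟩

theorem covered_anti_objectives {κ : ℕ} {J J' : Set ℕ} (h : J' ⊆ J) :
    Covered γ G α κ J ⊆ Covered γ G α κ J' := by
  rintro v ⟨F, hF⟩
  exact ⟨F, fun f₂ j hj => hF f₂ j (h hj)⟩

open Classical in
/-- The strategy that plays `f` in the plays that move from the initial vertex to `u`, and `f'` in
the others. -/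
noncomputable def Strategy.branch {p : Player} (u : V) (f f' : Strategy G p) : Strategy G p where
  next h v := if (h ++ [v.1])[1]? = some u then f.next h v else f'.next h v
  legal h v := by
    split_ifs
    · exact f.legal h v
    · exact f'.legal h v

theorem getElem?_one_unroll (m : List V → V → V) (w : V) {s : ℕ} (hs : s ≠ 0) :
    ((unroll m w s).1 ++ [(unroll m w s).2])[1]? = some (m [] w) := by
  rw [unroll_fst_append, List.getElem?_map, List.getElem?_range (by omega)]
  rfl

/-- Against a branching strategy, the play is determined by the first move. -/
theorem play_branch_of_eq {f₁ : Strategy G .one} {w u : V} (hw : G.owner w = .one)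
    (hu : f₁.next [] ⟨w, hw⟩ = u) (f f' : Strategy G .two) :
    play f₁ (Strategy.branch u f f') w = play f₁ f w := by
  funext s
  unfold play
  rw [unroll_congr (m := move f₁ f) (N := s) ?_ s le_rfl]
  intro j _
  cases h : G.owner (unroll (move f₁ f) w j).2 with
  | one => rw [move_one _ _ _ h, move_one _ _ _ h]
  | two =>
    rw [move_two _ _ _ h, move_two _ _ _ h, Strategy.branch]
    refine if_pos ?_
    rw [getElem?_one_unroll, move_one _ _ _ hw, hu]
    rintro rfl
    rw [unroll, hw] at h
    cases h

theorem play_branch_of_ne {f₁ : Strategy G .one} {w u : V} (hw : G.owner w = .one)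
    (hu : f₁.next [] ⟨w, hw⟩ ≠ u) (f f' : Strategy G .two) :
    play f₁ (Strategy.branch u f f') w = play f₁ f' w := by
  funext s
  unfold play
  rw [unroll_congr (m := move f₁ f') (N := s) ?_ s le_rfl]
  intro j _
  cases h : G.owner (unroll (move f₁ f') w j).2 with
  | one => rw [move_one _ _ _ h, move_one _ _ _ h]
  | two =>
    rw [move_two _ _ _ h, move_two _ _ _ h, Strategy.branch]
    refine if_neg ?_
    rw [getElem?_one_unroll, move_one _ _ _ hw]
    · simpa using hu
    · rintro rfl
      rw [unroll, hw] at h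
      cases h

open Classical in
/-- At a vertex at which the agents of a covering strategy separate for the first time, the
objectives can be divided among those that choose a certain successor and the others. Otherwise
Disruptor could defeat both groups at the same objective, as he plays against the groups
independently after the separation. -/
theorem mem_divisible_of_separate {κ : ℕ} {J : Set ℕ} {v : V} {F : Fin κ → Strategy G .one}
    (hF : ∀ f₂, ∀ j ∈ J, ∃ i, Satisfies γ (play (F i) f₂ v) (α j)) {f₂ : Strategy G .two} {t : ℕ}
    {ρ : List V} {w : V} (ht : ∀ i, unroll (move (F i) f₂) v t = (ρ, w)) (hw : G.owner w = .one)
    {i₀ i₁ : Fin κ} (hne : (F i₁).next ρ ⟨w, hw⟩ ≠ (F i₀).next ρ ⟨w, hw⟩) :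
    w ∈ Divisible γ G α κ J := by
  set u := (F i₀).next ρ ⟨w, hw⟩ with hu
  set X : Set ℕ := {j | ∀ f, ∃ i : {i // (F i).next ρ ⟨w, hw⟩ = u},
    Satisfies γ (play ((F i).shift ρ) f w) (α j)} with hX
  have hpast : ∀ i, past (F i) f₂ v t = ρ := fun i => congrArg Prod.fst (ht i)
  have hplay : ∀ i, play (F i) f₂ v t = w := fun i => congrArg Prod.snd (ht i)
  have hcard : Fintype.card {i // ¬ (F i).next ρ ⟨w, hw⟩ = u} =
      κ - Fintype.card {i // (F i).next ρ ⟨w, hw⟩ = u} := by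
    rw [Fintype.card_subtype_compl, Fintype.card_fin]
  refine ⟨Fintype.card {i // (F i).next ρ ⟨w, hw⟩ = u}, X, Fintype.card_pos_iff.2 ⟨⟨i₀, rfl⟩⟩, ?_,
    covered_of_fintype (fun i => (F i).shift ρ) fun f j hj => hj.2 f, ?_⟩
  · have := Fintype.card_subtype_lt (p := fun i => (F i).next ρ ⟨w, hw⟩ = u) hne
    rwa [Fintype.card_fin] at this
  · rw [← hcard]
    refine covered_of_fintype (fun i => (F i).shift ρ) fun f' j hj => ?_
    by_contra hno
    push Not at hno
    have hjX := hj.2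
    simp only [hX, Set.mem_ofPred_eq, not_forall, not_exists] at hjX
    obtain ⟨f, hf⟩ := hjX
    obtain ⟨i, hi⟩ := hF (f₂.graft ρ (Strategy.branch u f f')) j hj.1
    have e : (fun s => play (F i) (f₂.graft ρ (Strategy.branch u f f')) v (t + s)) =
        play ((F i).shift ρ) (Strategy.branch u f f') w := by
      funext s
      have := play_graft (F i) f₂ (Strategy.branch u f f') v t s
      rwa [hpast i, hplay i] at this
    rw [← satisfies_shift _ _ t, e] at hi
    have e' : ((F i).shift ρ).next [] ⟨w, hw⟩ = (F i).next ρ ⟨w, hw⟩ := by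
      simp [Strategy.shift]
    by_cases hiu : (F i).next ρ ⟨w, hw⟩ = u
    · rw [play_branch_of_eq hw (e'.trans hiu)] at hi
      exact hf ⟨i, hiu⟩ hi
    · rw [play_branch_of_ne hw (fun h => hiu (e'.symm.trans h))] at hi
      exact hno ⟨i, hiu⟩ hi

/-- As long as no vertex of `Divisible` is reached, all agents of a covering strategy move
together. -/
theorem covered_subset_single {κ : ℕ} (hκ : 0 < κ) (J : Set ℕ) :
    Covered γ G α κ J ⊆ Single γ G α (Divisible γ G α κ J) J := by
  rintro v ⟨F, hF⟩
  refine ⟨F ⟨0, hκ⟩, fun f₂ => ?_⟩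
  by_contra! hno
  obtain ⟨hS, j, hj, hsat⟩ := hno
  have key : ∀ t i, unroll (move (F i) f₂) v t = unroll (move (F ⟨0, hκ⟩) f₂) v t := by
    intro t
    induction t with
    | zero => exact fun i => rfl
    | succ t ih =>
      intro i
      simp only [unroll, ih i, Prod.mk.injEq, true_and]
      cases h : G.owner (unroll (move (F ⟨0, hκ⟩) f₂) v t).2 with
      | two => rw [move_two _ _ _ h, move_two _ _ _ h]
      | one =>
        rw [move_one _ _ _ h, move_one _ _ _ h]
        by_contra hne
        exact hS t (mem_divisible_of_separate hF (fun i => ih i) h hne)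
  obtain ⟨i, hi⟩ := hF f₂ j hj
  have : play (F i) f₂ v = play (F ⟨0, hκ⟩) f₂ v := funext fun t => congrArg Prod.snd (key t i)
  rw [this] at hi
  exact hsat hi

open Classical in
/-- The strategy that plays `σ` until the first visit to `S` and then the strategy that `T` assigns
to the vertex visited. -/
noncomputable def Strategy.switch {p : Player} (σ : Strategy G p) (S : Set V)
    (T : V → Strategy G p) : Strategy G p where
  next h v :=
    if (h ++ [v.1]).findIdx (fun x => decide (x ∈ S)) < (h ++ [v.1]).length then
      (T ((h ++ [v.1]).getD ((h ++ [v.1]).findIdx (fun x => decide (x ∈ S))) v.1)).next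
        (h.drop ((h ++ [v.1]).findIdx (fun x => decide (x ∈ S)))) v
    else σ.next h v
  legal h v := by
    split_ifs
    · exact (T _).legal _ v
    · exact σ.legal h v

theorem unroll_switch {σ : Strategy G .one} {S : Set V} (T : V → Strategy G .one)
    {f₂ : Strategy G .two} {v : V} {a : ℕ} (ha : ∀ s < a, play σ f₂ v s ∉ S) :
    ∀ j ≤ a, unroll (move (σ.switch S T) f₂) v j = unroll (move σ f₂) v j := by
  refine unroll_congr fun j hj => ?_
  cases h : G.owner (unroll (move σ f₂) v j).2 with
  | two => rw [move_two _ _ _ h, move_two _ _ _ h]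
  | one =>
    rw [move_one _ _ _ h, move_one _ _ _ h, Strategy.switch]
    refine if_neg ?_
    rw [List.findIdx_lt_length]
    push Not
    intro x hx
    rw [unroll_fst_append, List.mem_map] at hx
    obtain ⟨i, hi, rfl⟩ := hx
    have := ha i (by have := List.mem_range.1 hi; omega)
    simpa [play] using this

theorem play_switch_of_forall {σ : Strategy G .one} {S : Set V} (T : V → Strategy G .one)
    {f₂ : Strategy G .two} {v : V} (h : ∀ s, play σ f₂ v s ∉ S) :
    play (σ.switch S T) f₂ v = play σ f₂ v :=
  funext fun s => congrArg Prod.snd (unroll_switch T (fun s _ => h s) s le_rfl)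

open Classical in
theorem play_switch_of_mem {σ : Strategy G .one} {S : Set V} (T : V → Strategy G .one)
    {f₂ : Strategy G .two} {v : V} {a : ℕ} (ha : ∀ s < a, play σ f₂ v s ∉ S)
    (hS : play σ f₂ v a ∈ S) (b : ℕ) :
    play (σ.switch S T) f₂ v (a + b) =
      play (T (play σ f₂ v a)) (f₂.shift (past σ f₂ v a)) (play σ f₂ v a) b := by
  rw [play_add]
  have h := unroll_switch T ha a le_rfl
  have h1 : past (σ.switch S T) f₂ v a = past σ f₂ v a := congrArg Prod.fst h
  have h2 : play (σ.switch S T) f₂ v a = play σ f₂ v a := congrArg Prod.snd h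
  rw [h1, h2]
  set w := play σ f₂ v a with hw
  unfold play
  rw [unroll_congr (m := move (T w) (f₂.shift (past σ f₂ v a))) (N := b) ?_ b le_rfl]
  intro j _
  cases h : G.owner (unroll (move (T w) (f₂.shift (past σ f₂ v a))) w j).2 with
  | two => rw [move_two _ _ _ h, move_two _ _ _ h]
  | one =>
    rw [move_one _ _ _ h, move_one _ _ _ h]
    set h' := (unroll (move (T w) (f₂.shift (past σ f₂ v a))) w j) with hh'
    have hcons : ∃ l, h'.1 ++ [h'.2] = w :: l := by
      rw [hh', unroll_fst_append, List.range_succ_eq_map, List.map_cons]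
      exact ⟨_, rfl⟩
    obtain ⟨l, hl⟩ := hcons
    have hlen : (past σ f₂ v a).length = a := length_unroll _ _ _
    have hidx : ((past σ f₂ v a ++ h'.1) ++ [h'.2]).findIdx (fun x => decide (x ∈ S)) = a := by
      rw [List.append_assoc, hl, List.findIdx_append, List.findIdx_cons]
      have : ¬ (past σ f₂ v a).findIdx (fun x => decide (x ∈ S)) < (past σ f₂ v a).length := by
        rw [List.findIdx_lt_length]
        push Not
        intro x hx
        rw [past, unroll_fst, List.mem_map] at hx
        obtain ⟨i, hi, rfl⟩ := hx
        simpa [play] using ha i (List.mem_range.1 hi)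
      rw [if_neg this, hlen]
      simp [hS]
    have hget : ((past σ f₂ v a ++ h'.1) ++ [h'.2]).getD a h'.2 = w := by
      rw [List.append_assoc, hl, List.getD_append_right _ _ _ _ (by omega), hlen, Nat.sub_self]
      rfl
    change (σ.switch S T).next (past σ f₂ v a ++ h'.1) ⟨h'.2, h⟩ = _
    simp only [Strategy.switch, hidx, hget]
    rw [if_pos ?_, List.drop_append_of_le_length (by omega), List.drop_eq_nil_of_le (by omega)]
    · rfl
    · simp only [List.length_append, hlen, List.length_cons]
      omega

/-- Each agent follows a strategy for `Single` until the target is reached. -/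
theorem single_subset_covered {κ : ℕ} (hκ : 0 < κ) {S : Set V} {J : Set ℕ}
    (hS : S ⊆ Covered γ G α κ J) : Single γ G α S J ⊆ Covered γ G α κ J := by
  classical
  rintro v ⟨σ, hσ⟩
  have : ∀ w, ∃ F : Fin κ → Strategy G .one, w ∈ S → ∀ f₂, ∀ j ∈ J, ∃ i,
      Satisfies γ (play (F i) f₂ w) (α j) := fun w => by
    by_cases hw : w ∈ S
    · obtain ⟨F, hF⟩ := hS hw
      exact ⟨F, fun _ => hF⟩
    · exact ⟨fun _ => σ, fun h => absurd h hw⟩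
  choose F hF using this
  refine ⟨fun i => σ.switch S fun w => F w i, fun f₂ j hj => ?_⟩
  by_cases hr : ∃ t, play σ f₂ v t ∈ S
  · have hmin := fun s (hs : s < Nat.find hr) => Nat.find_min hr hs
    obtain ⟨i, hi⟩ := hF _ (Nat.find_spec hr) (f₂.shift (past σ f₂ v (Nat.find hr))) j hj
    refine ⟨i, ?_⟩
    rw [← satisfies_shift _ _ (Nat.find hr)]
    convert hi using 1
    funext s
    exact play_switch_of_mem (fun w => F w i) hmin (Nat.find_spec hr) s
  · push Not at hr
    refine ⟨⟨0, hκ⟩, ?_⟩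
    rw [play_switch_of_forall _ hr]
    exact ((hσ f₂).resolve_left fun ⟨t, ht⟩ => hr t ht) j hj

theorem covered_eq_single {κ : ℕ} (hκ : 0 < κ) (J : Set ℕ) :
    Covered γ G α κ J = Single γ G α (Divisible γ G α κ J) J :=
  (covered_subset_single hκ J).antisymm
    (single_subset_covered hκ (divisible_subset_covered κ J))

/-- An agent that can reach a vertex from which she wins, or win on the way, wins. -/
theorem single_single_subset (S : Set V) (J : Set ℕ) :
    Single γ G α (Single γ G α S J) J ⊆ Single γ G α S J := by
  classical
  rintro v ⟨σ, hσ⟩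
  have : ∀ w, ∃ τ : Strategy G .one, w ∈ Single γ G α S J → ∀ f₂, (∃ t, play τ f₂ w t ∈ S) ∨
      ∀ j ∈ J, Satisfies γ (play τ f₂ w) (α j) := fun w => by
    by_cases hw : w ∈ Single γ G α S J
    · obtain ⟨τ, hτ⟩ := hw
      exact ⟨τ, fun _ => hτ⟩
    · exact ⟨σ, fun h => absurd h hw⟩
  choose T hT using this
  refine ⟨σ.switch (Single γ G α S J) T, fun f₂ => ?_⟩
  by_cases hr : ∃ t, play σ f₂ v t ∈ Single γ G α S J
  · have hmin := fun s (hs : s < Nat.find hr) => Nat.find_min hr hs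
    have hplay := play_switch_of_mem T hmin (Nat.find_spec hr)
    rcases hT _ (Nat.find_spec hr) (f₂.shift (past σ f₂ v (Nat.find hr))) with ⟨t, ht⟩ | h
    · refine Or.inl ⟨Nat.find hr + t, ?_⟩
      rwa [hplay]
    · refine Or.inr fun j hj => ?_
      rw [← satisfies_shift _ _ (Nat.find hr)]
      convert h j hj using 1
      funext s
      exact hplay s
  · push Not at hr
    rw [play_switch_of_forall _ hr]
    exact Or.inr ((hσ f₂).resolve_left fun ⟨t, ht⟩ => hr t ht)

theorem covered_one_of_covered {k : ℕ} (hk : 0 < k) (j : ℕ) :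
    Covered γ G α k {j} ⊆ Covered γ G α 1 {j} := by
  induction k using Nat.strong_induction_on with
  | _ k ih =>
    rw [covered_eq_single hk]
    refine single_subset_covered one_pos ?_
    rintro v ⟨κ₁, X, h0, h1, h2, h3⟩
    by_cases hX : j ∈ X
    · exact ih κ₁ h1 h0 (covered_anti_objectives (by simpa using hX) h2)
    · exact ih (k - κ₁) (by omega) (by omega) (covered_anti_objectives (by simpa using hX) h3)

/-- More agents than objectives are of no use. -/
theorem covered_iff_exists_le {k c : ℕ} (hk : 0 < k) (hc : 0 < c) {J : Set ℕ}
    (hJ : ∀ j ∈ J, j < c) (v : V) :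
    v ∈ Covered γ G α k J ↔ ∃ κ, 0 < κ ∧ κ ≤ k ∧ κ ≤ c ∧ v ∈ Covered γ G α κ J := by
  classical
  constructor
  · intro h
    by_cases hkc : k ≤ c
    · exact ⟨k, hk, le_rfl, hkc, h⟩
    · have : ∀ i : Fin c, ∃ σ : Strategy G .one, (i : ℕ) ∈ J → ∀ f₂,
          Satisfies γ (play σ f₂ v) (α i) := by
        intro i
        by_cases hi : (i : ℕ) ∈ J
        · obtain ⟨F, hF⟩ := covered_one_of_covered hk i
            (covered_anti_objectives (Set.singleton_subset_iff.2 hi) h)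
          refine ⟨F 0, fun _ f₂ => ?_⟩
          obtain ⟨i', hi'⟩ := hF f₂ i rfl
          rwa [Subsingleton.elim i' 0] at hi'
        · obtain ⟨F, -⟩ := h
          exact ⟨F ⟨0, hk⟩, fun h => absurd h hi⟩
      choose F hF using this
      exact ⟨c, hc, by omega, le_rfl, F, fun f₂ j hj => ⟨⟨j, hJ j hj⟩, hF ⟨j, hJ j hj⟩ hj f₂⟩⟩
  · rintro ⟨κ, h0, h1, -, h⟩
    exact covered_mono_agents h0 h1 J h

end Covering

/-! ### Bounded approximations of the winning regions -/

section Approximations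

variable {V : Type*} (γ : ObjectiveType) (G : GameGraph V) (α : ℕ → Set V)

/-- The vertices from which Coverer can move to `X` in one step. -/
def Pre (X : Set V) : Set V :=
  {v | (G.owner v = .one ∧ ∃ u, G.edge v u ∧ u ∈ X) ∨
    (G.owner v = .two ∧ ∀ u, G.edge v u → u ∈ X)}

/-- The target sets whose infinitely many visits matter: a Büchi objective is a target of its own,
while a conjunction of co-Büchi objectives is one co-Büchi objective. -/
def targets (J : Set ℕ) : Set (Set V) :=
  match γ with
  | .buchi => {h | ∃ j ∈ J, h = α j}
  | .coBuchi => {⋃ j ∈ J, α j}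

/-- The outcome of a game in which the time for the next visit to the target has run out. -/
def timeout : Set V :=
  match γ with
  | .buchi => ∅
  | .coBuchi => Set.univ

/-- The outcome of a game in which the required number of visits to targets has been made. -/
def completed : Set V :=
  match γ with
  | .buchi => Set.univ
  | .coBuchi => ∅

/-- The vertices from which Coverer wins if she also wins upon reaching `S`, and the game ends
with a visit to `h`, followed by a move that should lead to `Y`, or after `t` steps. -/
def Inner (S h Y : Set V) : ℕ → Set V
  | 0 => timeout γ
  | t + 1 => S ∪ (h ∩ Pre G Y) ∪ (hᶜ ∩ Pre G (Inner S h Y t))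

/-- The vertices from which Coverer wins if she also wins upon reaching `S`, and the game ends
after `i` visits to targets chosen by Disruptor, each of them within `N` steps. -/
def Outer (S : Set V) (J : Set ℕ) (N : ℕ) : ℕ → Set V
  | 0 => completed γ
  | i + 1 => {v | ∀ h ∈ targets γ α J, v ∈ Inner γ G S h (Outer S J N i) N}

variable {γ G α}

theorem pre_mono {X Y : Set V} (h : X ⊆ Y) : Pre G X ⊆ Pre G Y := by
  rintro v (⟨ho, u, hu, hX⟩ | ⟨ho, hX⟩)
  · exact Or.inl ⟨ho, u, hu, h hX⟩
  · exact Or.inr ⟨ho, fun u hu => h (hX u hu)⟩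

open Classical in
/-- The strategy that moves into the set that `D` assigns to the history, whenever it can. -/
noncomputable def aim {p : Player} (D : List V → V → Set V) : Strategy G p where
  next ρ v := if h : ∃ u, G.edge v.1 u ∧ u ∈ D ρ v.1 then h.choose else (G.total v.1).choose
  legal ρ v := by
    split_ifs with h
    · exact h.choose_spec.1
    · exact (G.total v.1).choose_spec

theorem aim_mem {p : Player} {D : List V → V → Set V} {ρ : List V} {v : V} (hv : G.owner v = p)
    (h : ∃ u, G.edge v u ∧ u ∈ D ρ v) : (aim (p := p) D).next ρ ⟨v, hv⟩ ∈ D ρ v := by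
  simp only [aim]
  rw [dif_pos h]
  exact h.choose_spec.2

theorem move_mem_of_mem_pre {D : List V → V → Set V} {ρ : List V} {v : V} (h : v ∈ Pre G (D ρ v))
    (f₂ : Strategy G .two) : move (aim D) f₂ ρ v ∈ D ρ v := by
  rcases h with ⟨ho, h⟩ | ⟨_, h⟩
  · rw [move_one _ _ _ ho]
    exact aim_mem ho h
  · exact h _ (edge_move _ _ _ _)

theorem move_mem_of_not_mem_pre {D : List V → V → Set V} {ρ : List V} {v : V} {X : Set V}
    (h : v ∉ Pre G X) (hX : Xᶜ ⊆ D ρ v) (σ : Strategy G .one) :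
    move σ (aim D) ρ v ∈ D ρ v := by
  cases ho : G.owner v with
  | one =>
    refine hX fun hm => h (Or.inl ⟨ho, _, edge_move _ _ _ _, hm⟩)
  | two =>
    rw [move_two _ _ _ ho]
    refine aim_mem ho ?_
    by_contra! hno
    exact h (Or.inr ⟨ho, fun u hu => by_contra fun hm => hno u hu (hX hm)⟩)

/-- An increasing sequence of subsets of a finite set that does not grow any more once it stops
growing is constant from the cardinality of the set on. -/
theorem eq_succ_of_monotone [Fintype V] {s : ℕ → Set V} (hs : Monotone s)
    (hstep : ∀ t, s t = s (t + 1) → s (t + 1) = s (t + 2)) :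
    s (Fintype.card V) = s (Fintype.card V + 1) := by
  by_contra hne
  have hlt : ∀ t ≤ Fintype.card V, s t ≠ s (t + 1) := by
    intro t ht heq
    have : ∀ d, s (t + d) = s (t + d + 1) := by
      intro d
      induction d with
      | zero => exact heq
      | succ d ih => exact hstep _ ih
    have := this (Fintype.card V - t)
    rw [Nat.add_sub_cancel' ht] at this
    exact hne this
  have hcard : ∀ t ≤ Fintype.card V + 1, t ≤ (s t).ncard := by
    intro t
    induction t with
    | zero => exact fun _ => Nat.zero_le _
    | succ t ih =>
      intro ht
      have h1 := ih (by omega)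
      have h2 : (s t).ncard < (s (t + 1)).ncard :=
        Set.ncard_lt_ncard ((hs (Nat.le_succ t)).ssubset_of_ne (hlt t (by omega)))
          (Set.toFinite _)
      omega
  have h1 := hcard _ le_rfl
  have h2 := Set.ncard_le_card (s (Fintype.card V + 1))
  rw [Nat.card_eq_fintype_card] at h2
  omega

theorem eq_succ_of_antitone [Fintype V] {s : ℕ → Set V} (hs : Antitone s)
    (hstep : ∀ t, s t = s (t + 1) → s (t + 1) = s (t + 2)) :
    s (Fintype.card V) = s (Fintype.card V + 1) := by
  have := eq_succ_of_monotone (s := fun t => (s t)ᶜ)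
    (fun a b h => Set.compl_subset_compl.2 (hs h)) fun t h => by
      rw [hstep t (compl_injective h)]
  exact compl_injective this

theorem inner_step (S h Y : Set V) (t : ℕ)
    (e : Inner γ G S h Y t = Inner γ G S h Y (t + 1)) :
    Inner γ G S h Y (t + 1) = Inner γ G S h Y (t + 2) := by
  rw [Inner, Inner, ← e]

theorem outer_step (S : Set V) (J : Set ℕ) (N i : ℕ)
    (e : Outer γ G α S J N i = Outer γ G α S J N (i + 1)) :
    Outer γ G α S J N (i + 1) = Outer γ G α S J N (i + 2) := by
  rw [Outer, Outer, ← e]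

theorem inner_mono {S h Y Y' : Set V} (hY : Y ⊆ Y') (t : ℕ) :
    Inner γ G S h Y t ⊆ Inner γ G S h Y' t := by
  induction t with
  | zero => exact subset_rfl
  | succ t ih =>
    exact Set.union_subset_union (Set.union_subset_union_right _
      (Set.inter_subset_inter_right _ (pre_mono hY))) (Set.inter_subset_inter_right _ (pre_mono ih))

theorem outer_succ_mono {S : Set V} {J : Set ℕ} {N i i' : ℕ}
    (h : Outer γ G α S J N i ⊆ Outer γ G α S J N i') :
    Outer γ G α S J N (i + 1) ⊆ Outer γ G α S J N (i' + 1) :=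
  fun _ hv s hs => inner_mono h N (hv s hs)

theorem inner_buchi_monotone (S h Y : Set V) : Monotone (Inner .buchi G S h Y) := by
  refine monotone_nat_of_le_succ fun t => ?_
  induction t with
  | zero => exact Set.empty_subset _
  | succ t ih => exact Set.union_subset_union_right _ (Set.inter_subset_inter_right _ (pre_mono ih))

theorem inner_coBuchi_antitone (S h Y : Set V) : Antitone (Inner .coBuchi G S h Y) := by
  refine antitone_nat_of_succ_le fun t => ?_
  induction t with
  | zero => exact Set.subset_univ _
  | succ t ih => exact Set.union_subset_union_right _ (Set.inter_subset_inter_right _ (pre_mono ih))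

theorem outer_buchi_antitone (S : Set V) (J : Set ℕ) (N : ℕ) :
    Antitone (Outer .buchi G α S J N) := by
  refine antitone_nat_of_succ_le fun i => ?_
  induction i with
  | zero => exact Set.subset_univ _
  | succ i ih => exact outer_succ_mono ih

theorem outer_coBuchi_monotone (S : Set V) (J : Set ℕ) (N : ℕ) :
    Monotone (Outer .coBuchi G α S J N) := by
  refine monotone_nat_of_le_succ fun i => ?_
  induction i with
  | zero => exact Set.empty_subset _
  | succ i ih => exact outer_succ_mono ih

/-- The rest of a winning strategy is winning. -/
theorem play_mem_single {S : Set V} {J : Set ℕ} {v : V} {σ : Strategy G .one}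
    (hσ : ∀ f₂, (∃ t, play σ f₂ v t ∈ S) ∨ ∀ j ∈ J, Satisfies γ (play σ f₂ v) (α j))
    (f₂ : Strategy G .two) {a : ℕ} (ha : ∀ s < a, play σ f₂ v s ∉ S) :
    play σ f₂ v a ∈ Single γ G α S J := by
  refine ⟨σ.shift (past σ f₂ v a), fun f' => ?_⟩
  have hpl : ∀ s, play σ (f₂.graft (past σ f₂ v a) f') v (a + s) =
      play (σ.shift (past σ f₂ v a)) f' (play σ f₂ v a) s := play_graft σ f₂ f' v a
  rcases hσ (f₂.graft (past σ f₂ v a) f') with ⟨t, ht⟩ | h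
  · left
    rcases Nat.lt_or_ge t a with hlt | hge
    · have := congrArg Prod.snd (unroll_graft σ f₂ f' v a t hlt.le)
      change play σ (f₂.graft (past σ f₂ v a) f') v t = play σ f₂ v t at this
      rw [this] at ht
      exact absurd ht (ha t hlt)
    · refine ⟨t - a, ?_⟩
      rwa [← hpl, Nat.add_sub_cancel' hge]
  · right
    intro j hj
    rw [← funext hpl, satisfies_shift]
    exact h j hj

variable [Fintype V]

theorem inner_card_eq (S h Y : Set V) :
    Inner γ G S h Y (Fintype.card V) = Inner γ G S h Y (Fintype.card V + 1) := by
  cases γ with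
  | buchi => exact eq_succ_of_monotone (inner_buchi_monotone S h Y) fun t => inner_step S h Y t
  | coBuchi => exact eq_succ_of_antitone (inner_coBuchi_antitone S h Y) fun t => inner_step S h Y t

theorem outer_card_eq (S : Set V) (J : Set ℕ) (N : ℕ) :
    Outer γ G α S J N (Fintype.card V) = Outer γ G α S J N (Fintype.card V + 1) := by
  cases γ with
  | buchi => exact eq_succ_of_antitone (outer_buchi_antitone S J N) fun t => outer_step S J N t
  | coBuchi => exact eq_succ_of_monotone (outer_coBuchi_monotone S J N) fun t => outer_step S J N t

/-! ### Büchi objectives -/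

/-- From outside the attractor of a target, Disruptor can avoid the target or leave the winning
region at the first visit to it. -/
theorem single_buchi_subset_inner (S : Set V) {J : Set ℕ} {j : ℕ} (hj : j ∈ J) :
    Single .buchi G α S J ⊆
      Inner .buchi G S (α j) (Single .buchi G α S J) (Fintype.card V) := by
  classical
  intro v hv
  by_contra hvA
  set Z := Single .buchi G α S J with hZ
  set A := Inner .buchi G S (α j) Z (Fintype.card V) with hA
  have hfix : A = S ∪ (α j ∩ Pre G Z) ∪ ((α j)ᶜ ∩ Pre G A) := inner_card_eq S (α j) Z
  obtain ⟨σ, hσ⟩ := hv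
  set f₂ : Strategy G .two := aim fun _ w => if w ∈ α j then Zᶜ else Aᶜ with hf₂
  have hA0 : ∀ s, (∀ r < s, play σ f₂ v r ∉ α j) → play σ f₂ v s ∉ A := by
    intro s
    induction s with
    | zero => exact fun _ => hvA
    | succ s ih =>
      intro hr
      have h1 := ih fun r hrs => hr r (by omega)
      have h2 := hr s (by omega)
      have h3 : play σ f₂ v s ∉ Pre G A := fun h => h1 (by
        rw [hfix]
        exact Or.inr ⟨h2, h⟩)
      have := move_mem_of_not_mem_pre (D := fun _ w => if w ∈ α j then Zᶜ else Aᶜ)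
        (ρ := past σ f₂ v s) h3 (by rw [if_neg h2]) σ
      rw [if_neg h2] at this
      exact this
  have hSA : S ⊆ A := fun x hx => by
    rw [hfix]
    exact Or.inl (Or.inl hx)
  by_cases hhit : ∃ s, play σ f₂ v s ∈ α j
  · have hmin := fun r (hr : r < Nat.find hhit) => Nat.find_min hhit hr
    have h1 := hA0 _ hmin
    have h2 := Nat.find_spec hhit
    have h3 : play σ f₂ v (Nat.find hhit) ∉ Pre G Z := fun h => h1 (by
      rw [hfix]
      exact Or.inl (Or.inr ⟨h2, h⟩))
    have h4 := move_mem_of_not_mem_pre (D := fun _ w => if w ∈ α j then Zᶜ else Aᶜ)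
      (ρ := past σ f₂ v (Nat.find hhit)) h3 (by rw [if_pos h2]) σ
    rw [if_pos h2] at h4
    refine h4 (play_mem_single hσ f₂ (a := Nat.find hhit + 1) fun s hs hS => ?_)
    exact hA0 s (fun r hr => hmin r (by omega)) (hSA hS)
  · push Not at hhit
    rcases hσ f₂ with ⟨t, ht⟩ | h
    · exact hA0 t (fun r _ => hhit r) (hSA ht)
    · have := (satisfies_buchi _ _).1 (h j hj)
      refine this ?_
      simp [hhit]

theorem single_buchi_subset_outer (S : Set V) (J : Set ℕ) (i : ℕ) :
    Single .buchi G α S J ⊆ Outer .buchi G α S J (Fintype.card V) i := by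
  induction i with
  | zero => exact Set.subset_univ _
  | succ i ih =>
    rintro v hv h ⟨j, hj, rfl⟩
    exact inner_mono ih _ (single_buchi_subset_inner S hj hv)

/-- Coverer serves the Büchi objectives according to an enumeration in which each of them occurs
infinitely often. The number of objectives served so far is computed from the history. -/
theorem subset_single_buchi {S : Set V} {J : Set ℕ} {Y : Set V}
    (hY : ∀ j ∈ J, Y ⊆ Inner .buchi G S (α j) Y (Fintype.card V)) :
    Y ⊆ Single .buchi G α S J := by
  classical
  intro v hv
  rcases J.eq_empty_or_nonempty with rfl | ⟨j₀, hj₀⟩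
  · exact ⟨aim fun _ _ => Set.univ, fun f₂ => Or.inr fun j hj => absurd hj (Set.notMem_empty j)⟩
  set e : ℕ → ℕ := fun c => if (Nat.unpair c).1 ∈ J then (Nat.unpair c).1 else j₀ with he
  have heJ : ∀ c, e c ∈ J := fun c => by
    simp only [he]
    split_ifs with h
    · exact h
    · exact hj₀
  set cnt : List V → ℕ := fun ρ => ρ.foldl (fun c u => if u ∈ α (e c) then c + 1 else c) 0 with hcnt
  have hcnt_snoc : ∀ ρ u, cnt (ρ ++ [u]) = if u ∈ α (e (cnt ρ)) then cnt ρ + 1 else cnt ρ :=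
    fun ρ u => by simp [hcnt]
  set X : ℕ → ℕ → Set V := fun c t => Inner .buchi G S (α (e c)) Y t with hX
  set D : List V → V → Set V := fun ρ w =>
    if w ∈ α (e (cnt ρ)) then Y else {u | ∃ t, u ∈ X (cnt ρ) t ∧ w ∉ X (cnt ρ) t} with hD
  refine ⟨aim D, fun f₂ => ?_⟩
  rw [or_iff_not_imp_left]
  intro hS
  push Not at hS
  set x := play (aim D) f₂ v with hx
  set c : ℕ → ℕ := fun s => cnt (past (aim D) f₂ v s) with hc
  have hc_succ : ∀ s, c (s + 1) = if x s ∈ α (e (c s)) then c s + 1 else c s := fun s =>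
    hcnt_snoc _ _
  -- A visit to the current target leads back to `Y`.
  have hhit : ∀ s r, x s ∈ X (c s) r → x s ∈ α (e (c s)) → x (s + 1) ∈ Y := by
    intro s r hr hα
    cases r with
    | zero => exact absurd hr (Set.notMem_empty _)
    | succ r =>
      rcases hr with (h | h) | h
      · exact absurd h (hS s)
      · have := move_mem_of_mem_pre (D := D) (ρ := past (aim D) f₂ v s) (v := x s)
          (by simp only [hD]; rw [if_pos hα]; exact h.2) f₂
        simp only [hD] at this
        rw [if_pos hα] at this
        exact this
      · exact absurd hα h.1
  -- Other moves decrease the distance to the current target.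
  have hmiss : ∀ s r, x s ∈ X (c s) r → x s ∉ α (e (c s)) → ∃ t < r, x (s + 1) ∈ X (c s) t := by
    intro s r hr hα
    have hex : ∃ r, x s ∈ X (c s) r := ⟨r, hr⟩
    have h1 := Nat.find_spec hex
    have h2 : ∀ t < Nat.find hex, x s ∉ X (c s) t := fun t ht => Nat.find_min hex ht
    obtain ⟨t, ht⟩ : ∃ t, Nat.find hex = t + 1 := by
      cases h : Nat.find hex with
      | zero =>
        rw [h] at h1
        exact absurd h1 (Set.notMem_empty _)
      | succ t => exact ⟨t, rfl⟩
    rw [ht] at h1 h2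
    have hpre : x s ∈ Pre G (X (c s) t) := by
      rcases h1 with (h | h) | h
      · exact absurd h (hS s)
      · exact absurd h.1 hα
      · exact h.2
    have hsub : X (c s) t ⊆ {u | ∃ t, u ∈ X (c s) t ∧ x s ∉ X (c s) t} :=
      fun u hu => ⟨t, hu, h2 t (by omega)⟩
    have := move_mem_of_mem_pre (D := D) (ρ := past (aim D) f₂ v s) (v := x s)
      (by
        simp only [hD]
        rw [if_neg hα]
        exact pre_mono hsub hpre) f₂
    simp only [hD] at this
    rw [if_neg hα] at this
    obtain ⟨t', h3, h4⟩ := this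
    refine ⟨t', ?_, h3⟩
    by_contra hle
    exact h4 (inner_buchi_monotone S (α (e (c s))) Y (not_lt.1 hle) hr)
  have hserve : ∀ r s, x s ∈ X (c s) r → ∃ s', c s' = c s ∧ x s' ∈ α (e (c s)) ∧
      x (s' + 1) ∈ Y := by
    intro r
    induction r using Nat.strong_induction_on with
    | _ r ih =>
      intro s hr
      by_cases hα : x s ∈ α (e (c s))
      · exact ⟨s, rfl, hα, hhit s r hr hα⟩
      · obtain ⟨t, ht, h⟩ := hmiss s r hr hα
        have hcs : c (s + 1) = c s := by rw [hc_succ, if_neg hα]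
        rw [← hcs] at h ⊢
        exact ih t ht (s + 1) h
  have hall : ∀ d, ∃ s, c s = d ∧ x s ∈ Y := by
    intro d
    induction d with
    | zero => exact ⟨0, rfl, hv⟩
    | succ d ih =>
      obtain ⟨s, hs, hYs⟩ := ih
      obtain ⟨s', h1, h2, h3⟩ := hserve _ s (hY _ (heJ _) hYs)
      refine ⟨s' + 1, ?_, h3⟩
      rw [hc_succ, h1, if_pos h2, hs]
  have hserve' : ∀ d, ∃ s, c s = d ∧ x s ∈ α (e d) := by
    intro d
    obtain ⟨s, hs, hYs⟩ := hall d
    obtain ⟨s', h1, h2, -⟩ := hserve _ s (hY _ (heJ _) hYs)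
    rw [hs] at h1 h2
    exact ⟨s', h1, h2⟩
  choose T hT using hserve'
  intro j hj
  rw [satisfies_buchi]
  have hinj : Function.Injective fun y => T (Nat.pair j y) := fun y y' h => by
    have h1 := (hT (Nat.pair j y)).1
    have h2 := (hT (Nat.pair j y')).1
    simp only at h
    rw [h, h2] at h1
    exact (Nat.pair_eq_pair.1 h1).2.symm
  refine (Set.infinite_range_of_injective hinj).mono ?_
  rintro _ ⟨y, rfl⟩
  have := (hT (Nat.pair j y)).2
  simpa [he, hj] using this

theorem single_buchi_eq_outer (S : Set V) (J : Set ℕ) :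
    Single .buchi G α S J = Outer .buchi G α S J (Fintype.card V) (Fintype.card V) := by
  refine (single_buchi_subset_outer S J _).antisymm (subset_single_buchi fun j hj v hv => ?_)
  rw [outer_card_eq] at hv
  exact hv (α j) ⟨j, hj, rfl⟩

/-! ### Co-Büchi objectives -/

theorem outer_coBuchi_subset_single (S : Set V) (J : Set ℕ) (i : ℕ) :
    Outer .coBuchi G α S J (Fintype.card V) i ⊆ Single .coBuchi G α S J := by
  classical
  induction i with
  | zero => exact Set.empty_subset _
  | succ i ih =>
    intro v hv
    have hvX := hv (⋃ j ∈ J, α j) rfl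
    set Y := Outer .coBuchi G α S J (Fintype.card V) i with hY
    set X := Inner .coBuchi G S (⋃ j ∈ J, α j) Y (Fintype.card V) with hX
    have hfix : X = S ∪ ((⋃ j ∈ J, α j) ∩ Pre G Y) ∪ ((⋃ j ∈ J, α j)ᶜ ∩ Pre G X) :=
      inner_card_eq S _ Y
    have hSZ : S ⊆ Single .coBuchi G α S J := fun w hw =>
      ⟨aim fun _ _ => Set.univ, fun f₂ => Or.inl ⟨0, hw⟩⟩
    -- It suffices to reach the winning region or to stay in `X` and off the target.
    refine single_single_subset S J ?_
    set D : List V → V → Set V := fun _ w => if w ∈ ⋃ j ∈ J, α j then Y else X with hD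
    refine ⟨aim D, fun f₂ => ?_⟩
    rw [or_iff_not_imp_left]
    intro hZ
    push Not at hZ
    have key : ∀ s, play (aim D) f₂ v s ∈ X ∧ play (aim D) f₂ v s ∉ ⋃ j ∈ J, α j := by
      have hbad : ∀ s, play (aim D) f₂ v s ∈ X → play (aim D) f₂ v s ∉ ⋃ j ∈ J, α j := by
        intro s hs hb
        rw [hfix] at hs
        rcases hs with (h | h) | h
        · exact hZ s (hSZ h)
        · have := move_mem_of_mem_pre (D := D) (ρ := past (aim D) f₂ v s)
            (v := play (aim D) f₂ v s) (by simp only [hD]; rw [if_pos hb]; exact h.2) f₂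
          simp only [hD] at this
          rw [if_pos hb] at this
          exact hZ (s + 1) (ih this)
        · exact h.1 hb
      intro s
      induction s with
      | zero => exact ⟨hvX, hbad 0 hvX⟩
      | succ s ihs =>
        have hX1 : play (aim D) f₂ v (s + 1) ∈ X := by
          have hs := ihs.1
          rw [hfix] at hs
          rcases hs with (h | h) | h
          · exact absurd (hSZ h) (hZ s)
          · exact absurd h.1 ihs.2
          · have := move_mem_of_mem_pre (D := D) (ρ := past (aim D) f₂ v s)
              (v := play (aim D) f₂ v s) (by simp only [hD]; rw [if_neg ihs.2]; exact h.2) f₂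
            simp only [hD] at this
            rw [if_neg ihs.2] at this
            exact this
        exact ⟨hX1, hbad _ hX1⟩
    rw [forall_satisfies_coBuchi]
    convert Set.finite_empty (α := ℕ)
    exact Set.eq_empty_of_forall_notMem fun s hs => (key s).2 hs

/-- From outside the approximation, Disruptor visits the target again and again. -/
theorem single_coBuchi_subset_outer (S : Set V) (J : Set ℕ) :
    Single .coBuchi G α S J ⊆ Outer .coBuchi G α S J (Fintype.card V) (Fintype.card V) := by
  classical
  intro v hv
  by_contra hvC
  set B := ⋃ j ∈ J, α j with hB
  set C := Outer .coBuchi G α S J (Fintype.card V) (Fintype.card V) with hC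
  set X : ℕ → Set V := Inner .coBuchi G S B C with hX
  have hCX : C = X (Fintype.card V) := by
    have h1 : C = Outer .coBuchi G α S J (Fintype.card V) (Fintype.card V + 1) :=
      outer_card_eq _ _ _
    rw [h1]
    ext w
    exact ⟨fun h => h B rfl, fun h s hs => by rw [Set.mem_singleton_iff.1 hs]; exact h⟩
  have hstab : ∀ d, X (Fintype.card V + d) = C := by
    intro d
    induction d with
    | zero => exact hCX.symm
    | succ d ih =>
      have h1 : ∀ d, X (Fintype.card V + d) = X (Fintype.card V + d + 1) := by
        intro d
        induction d with
        | zero => exact inner_card_eq S B C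
        | succ d ih => exact inner_step S B C _ ih
      rw [← Nat.add_assoc, ← h1 d, ih]
  have hCsub : ∀ t, C ⊆ X t := by
    intro t
    rcases Nat.le_total t (Fintype.card V) with h | h
    · rw [hCX]
      exact inner_coBuchi_antitone S B C h
    · rw [← Nat.add_sub_cancel' h, hstab]
  obtain ⟨σ, hσ⟩ := hv
  set D : List V → V → Set V := fun _ w =>
    if w ∈ B then Cᶜ else {u | ∃ t, u ∉ X t ∧ w ∈ X t} with hD
  set f₂ : Strategy G .two := aim D with hf₂
  set x := play σ f₂ v with hx
  have hstep : ∀ s r, x s ∉ X r → x s ∉ S ∧ x (s + 1) ∉ C ∧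
      (x s ∉ B → ∃ t < r, x (s + 1) ∉ X t) := by
    intro s r hr
    have hex : ∃ r, x s ∉ X r := ⟨r, hr⟩
    have h1 := Nat.find_spec hex
    have h2 : ∀ t < Nat.find hex, x s ∈ X t := fun t ht => not_not.1 (Nat.find_min hex ht)
    obtain ⟨t, ht⟩ : ∃ t, Nat.find hex = t + 1 := by
      cases h : Nat.find hex with
      | zero =>
        rw [h] at h1
        exact absurd (Set.mem_univ _) h1
      | succ t => exact ⟨t, rfl⟩
    rw [ht] at h1 h2
    have hS : x s ∉ S := fun h => h1 (Or.inl (Or.inl h))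
    by_cases hb : x s ∈ B
    · have hp : x s ∉ Pre G C := fun h => h1 (Or.inl (Or.inr ⟨hb, h⟩))
      have := move_mem_of_not_mem_pre (D := D) (ρ := past σ f₂ v s) hp
        (by simp only [hD]; rw [if_pos hb]) σ
      simp only [hD] at this
      rw [if_pos hb] at this
      exact ⟨hS, this, fun h => absurd hb h⟩
    · have hp : x s ∉ Pre G (X t) := fun h => h1 (Or.inr ⟨hb, h⟩)
      have := move_mem_of_not_mem_pre (D := D) (ρ := past σ f₂ v s) hp
        (by
          simp only [hD]
          rw [if_neg hb]
          exact fun u hu => ⟨t, hu, h2 t (by omega)⟩) σ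
      simp only [hD] at this
      rw [if_neg hb] at this
      obtain ⟨t', h3, h4⟩ := this
      refine ⟨hS, fun h => h3 (hCsub t' h), fun _ => ⟨t', ?_, h3⟩⟩
      by_contra hle
      exact hr (inner_coBuchi_antitone S B C (not_lt.1 hle) h4)
  have hnC : ∀ s, x s ∉ C := by
    intro s
    induction s with
    | zero => exact hvC
    | succ s ih =>
      rw [hCX] at ih
      exact (hstep s _ ih).2.1
  have hvisit : ∀ r s, x s ∉ X r → ∃ s' ≥ s, x s' ∈ B := by
    intro r
    induction r using Nat.strong_induction_on with
    | _ r ih =>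
      intro s hr
      by_cases hb : x s ∈ B
      · exact ⟨s, le_rfl, hb⟩
      · obtain ⟨t, ht, h⟩ := (hstep s r hr).2.2 hb
        obtain ⟨s', hs', h'⟩ := ih t ht (s + 1) h
        exact ⟨s', by omega, h'⟩
  rcases hσ f₂ with ⟨t, ht⟩ | h
  · have := hnC t
    rw [hCX] at this
    exact (hstep t _ this).1 ht
  · rw [forall_satisfies_coBuchi] at h
    refine Set.infinite_of_forall_exists_gt (fun s => ?_) h
    have := hnC (s + 1)
    rw [hCX] at this
    obtain ⟨s', hs', hb⟩ := hvisit _ _ this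
    exact ⟨s', hb, by omega⟩

/-- A single agent wins if and only if she wins the bounded game. -/
theorem single_eq_outer (S : Set V) (J : Set ℕ) :
    Single γ G α S J = Outer γ G α S J (Fintype.card V) (Fintype.card V) := by
  cases γ with
  | buchi => exact single_buchi_eq_outer S J
  | coBuchi => exact (single_coBuchi_subset_outer S J).antisymm (outer_coBuchi_subset_single S J _)

end Approximations

/-! ### Games that are played in rounds -/

section Alternation

variable {C : ℕ} {Q : ℕ → Prop} {φ : List ℕ → Prop}

theorem alt_of_const (hC : 0 < C) {p : Prop} (f : ℕ) (a : List ℕ)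
    (h : ∀ b, φ (a ++ b) ↔ p) : Alt C Q φ f a ↔ p := by
  induction f generalizing a with
  | zero =>
    change φ a ↔ p
    simpa using h []
  | succ f ih =>
    have h1 : ∀ x, Alt C Q φ f (a ++ [x]) ↔ p := fun x => ih _ fun b => by
      rw [List.append_assoc]
      exact h _
    simp only [Alt, h1]
    have h2 : (∃ x < C, p) ↔ p := ⟨fun ⟨_, _, h⟩ => h, fun h => ⟨0, hC, h⟩⟩
    have h3 : (∀ x < C, p) ↔ p := ⟨fun h => h 0 hC, fun h _ _ => h⟩
    rw [h2, h3]
    tauto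

theorem alt_exists_block (hC : 0 < C) (p f : ℕ) (a : List ℕ)
    (hQ : ∀ k < p, Q (a.length + k)) :
    Alt C Q φ (p + f) a ↔
      ∃ c : ℕ → ℕ, (∀ k, c k < C) ∧ Alt C Q φ f (a ++ (List.range p).map c) := by
  induction p generalizing a with
  | zero => simpa using fun _ => ⟨fun _ => 0, fun _ => hC⟩
  | succ p ih =>
    have h0 : Q a.length := hQ 0 (Nat.succ_pos p)
    have h1 : ∀ x, Alt C Q φ (p + f) (a ++ [x]) ↔ _ := fun x => ih (a ++ [x]) fun k hk => by
      have := hQ (k + 1) (by omega)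
      simpa [Nat.add_assoc, Nat.add_comm 1] using this
    rw [Nat.add_right_comm]
    simp only [Alt, h0, true_and, not_true_eq_false, false_and, or_false, h1]
    constructor
    · rintro ⟨x, hx, c, hc, h⟩
      refine ⟨fun k => Nat.casesOn k x c, fun k => ?_, ?_⟩
      · cases k with
        | zero => exact hx
        | succ k => exact hc k
      · simpa [List.range_succ_eq_map, Function.comp_def] using h
    · rintro ⟨c, hc, h⟩
      refine ⟨c 0, hc 0, fun k => c (k + 1), fun k => hc _, ?_⟩
      simpa [List.range_succ_eq_map, Function.comp_def] using h

theorem alt_not (f : ℕ) (a : List ℕ) :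
    ¬ Alt C Q φ f a ↔ Alt C (fun l => ¬ Q l) (fun b => ¬ φ b) f a := by
  induction f generalizing a with
  | zero => exact Iff.rfl
  | succ f ih =>
    simp only [Alt, ← ih]
    by_cases h : Q a.length <;> simp [h]

theorem alt_forall_block (hC : 0 < C) (p f : ℕ) (a : List ℕ)
    (hQ : ∀ k < p, ¬ Q (a.length + k)) :
    Alt C Q φ (p + f) a ↔
      ∀ c : ℕ → ℕ, (∀ k, c k < C) → Alt C Q φ f (a ++ (List.range p).map c) := by
  rw [← not_iff_not, alt_not, alt_exists_block hC p f a hQ]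
  simp only [← alt_not, not_forall, exists_prop]

end Alternation

/-- The outcome of a play of rounds that is recorded as `a`, where `P r a` and `D r a` say that the
first and the second player keep the rules in round `r`: in one of the first `T` rounds the second
player is the first to break the rules. -/
def FirstOffence (P D : ℕ → List ℕ → Prop) (T : ℕ) (a : List ℕ) : Prop :=
  ∃ r < T, ∀ r' < r + 1, P r' a ∧ (D r' a ↔ r' < r)

/-- The first player wins the game of `f` further rounds after the record `a` of `r` rounds. In
each round, the first player adds `p` numbers below `C` and the second player adds `q` numbers. -/
def RoundsWin (C p q : ℕ) (P D : ℕ → List ℕ → Prop) : ℕ → ℕ → List ℕ → Prop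
  | 0, _, _ => False
  | f + 1, r, a => ∃ c : ℕ → ℕ, (∀ k, c k < C) ∧ P r (a ++ (List.range p).map c) ∧
      ∀ d : ℕ → ℕ, (∀ k, d k < C) → D r (a ++ (List.range p).map c ++ (List.range q).map d) →
        RoundsWin C p q P D f (r + 1) (a ++ (List.range p).map c ++ (List.range q).map d)

/-- An alternation whose matrix looks for the first offence is a game of rounds. -/
theorem alt_firstOffence {C p q : ℕ} {P D : ℕ → List ℕ → Prop} (hC : 0 < C)
    (hP : ∀ r a b, r * (p + q) + p ≤ a.length → (P r (a ++ b) ↔ P r a))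
    (hD : ∀ r a b, (r + 1) * (p + q) ≤ a.length → (D r (a ++ b) ↔ D r a))
    (f r : ℕ) (a : List ℕ) (ha : a.length = r * (p + q)) (h : ∀ r' < r, P r' a ∧ D r' a) :
    Alt C (fun l => l % (p + q) < p) (FirstOffence P D (r + f)) (f * (p + q)) a ↔
      RoundsWin C p q P D f r a := by
  induction f generalizing r a with
  | zero =>
    rw [Nat.zero_mul]
    refine iff_of_false ?_ id
    rintro ⟨r₀, hr, h₀⟩
    exact lt_irrefl _ ((h₀ r₀ (Nat.lt_succ_self _)).2.1 (h r₀ (by omega)).2)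
  | succ f ih =>
    have hlen : (f + 1) * (p + q) = p + (q + f * (p + q)) := by ring
    have hle : ∀ r' < r, (r' + 1) * (p + q) ≤ r * (p + q) := fun r' hr => Nat.mul_le_mul_right _ hr
    have hle' : ∀ r' < r, r' * (p + q) + p ≤ r * (p + q) := fun r' hr => by
      have := hle r' hr
      rw [Nat.add_mul] at this
      omega
    have hext : ∀ b, ∀ r' < r, P r' (a ++ b) ∧ D r' (a ++ b) := fun b r' hr => by
      rw [hP _ _ _ (ha ▸ hle' r' hr), hD _ _ _ (ha ▸ hle r' hr)]
      exact h r' hr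
    rw [hlen, alt_exists_block hC _ _ _ (fun k hk => by
      rw [ha, Nat.mul_comm, Nat.mul_add_mod, Nat.mod_eq_of_lt (by omega)]
      exact hk), RoundsWin]
    refine exists_congr fun c => and_congr_right fun hc => ?_
    set a₁ := a ++ (List.range p).map c with ha₁
    have hl₁ : a₁.length = r * (p + q) + p := by simp [ha₁, ha]
    by_cases hPr : P r a₁
    swap
    -- After an offence of the first player, all complete records are lost for that player.
    · refine iff_of_false ?_ fun h => hPr h.1
      rw [alt_of_const hC (p := False)]
      · exact id
      · refine fun b => iff_of_false ?_ id
        rintro ⟨r₀, hr, h₀⟩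
        rcases Nat.lt_or_ge r₀ r with hlt | hge
        · have := (hext ((List.range p).map c ++ b) r₀ hlt).2
          rw [← List.append_assoc] at this
          exact lt_irrefl _ ((h₀ r₀ (Nat.lt_succ_self _)).2.1 this)
        · exact hPr ((hP r a₁ b hl₁.ge).1 (h₀ r (by omega)).1)
    rw [alt_forall_block hC _ _ _ (fun k hk => by
      rw [hl₁, Nat.add_assoc, Nat.mul_comm, Nat.mul_add_mod, Nat.mod_eq_of_lt (by omega)]
      omega)]
    refine ⟨fun hA => ⟨hPr, fun d hd hDr => ?_⟩, fun hA d hd => ?_⟩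
    all_goals
      have hl₂ : (a₁ ++ (List.range q).map d).length = (r + 1) * (p + q) := by
        simp [hl₁]
        ring
      have hext₂ : ∀ b, ∀ r' < r, P r' (a₁ ++ (List.range q).map d ++ b) ∧
          D r' (a₁ ++ (List.range q).map d ++ b) := fun b r' hr => by
        have := hext ((List.range p).map c ++ (List.range q).map d ++ b) r' hr
        simpa [ha₁] using this
      have hP₂ : ∀ b, P r (a₁ ++ (List.range q).map d ++ b) := fun b => by
        rw [List.append_assoc, hP r a₁ _ hl₁.ge]
        exact hPr
    · refine (ih (r + 1) _ hl₂ fun r' hr => ?_).1 ?_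
      · rcases Nat.lt_succ_iff_lt_or_eq.1 hr with hr | rfl
        · simpa using hext₂ [] r' hr
        · exact ⟨by simpa using hP₂ [], hDr⟩
      · rw [Nat.add_right_comm, Nat.add_assoc]
        exact hA d hd
    · by_cases hDr : D r (a₁ ++ (List.range q).map d)
      · have := (ih (r + 1) _ hl₂ fun r' hr => ?_).2 (hA.2 d hd hDr)
        · rwa [Nat.add_right_comm, Nat.add_assoc] at this
        · rcases Nat.lt_succ_iff_lt_or_eq.1 hr with hr | rfl
          · simpa using hext₂ [] r' hr
          · exact ⟨by simpa using hP₂ [], hDr⟩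
      -- After an offence of the second player, all complete records are won by the first one.
      · rw [alt_of_const hC (p := True)]
        · trivial
        · refine fun b => iff_of_true ⟨r, by omega, fun r' hr => ?_⟩ trivial
          rcases Nat.lt_succ_iff_lt_or_eq.1 hr with hr | rfl
          · exact ⟨(hext₂ b r' hr).1, iff_of_true (hext₂ b r' hr).2 hr⟩
          · refine ⟨hP₂ b, iff_of_false ?_ (lt_irrefl _)⟩
            rwa [hD r' _ b hl₂.ge]

/-! ### Games on records -/

/-- The record of round `r` in the array `a`, if each record has `F` cells. -/
def record (F : ℕ) (a : List ℕ) (r : ℕ) : ℕ → ℕ := fun k => a.getD (r * F + k) 0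

theorem record_append {F : ℕ} {a b : List ℕ} {r k : ℕ} (h : r * F + k < a.length) :
    record F (a ++ b) r k = record F a r k := by
  simp [record, List.getElem?_append_left h]

theorem record_append_map {F : ℕ} {a : List ℕ} {r k l : ℕ} (c : ℕ → ℕ) (ha : a.length = r * F + l)
    {N : ℕ} (hk : k < N) : record F (a ++ (List.range N).map c) r (l + k) = c k := by
  simp only [record, List.getD_eq_getElem?_getD]
  rw [List.getElem?_append_right (by omega),
    show r * F + (l + k) - a.length = k by omega]
  simp [hk]

/-- A game of rounds on records of `p + q` numbers below `C`. The first player fills the first `p`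
cells of each record, and the second player fills the other `q` cells. The rules for a round depend
on the first record, the previous record and the current record. -/
structure RecordGame where
  C : ℕ
  p : ℕ
  q : ℕ
  startP : (ℕ → ℕ) → Prop
  startD : (ℕ → ℕ) → Prop
  moveP : (ℕ → ℕ) → (ℕ → ℕ) → (ℕ → ℕ) → Prop
  moveD : (ℕ → ℕ) → (ℕ → ℕ) → (ℕ → ℕ) → Prop
  C_pos : 0 < C
  startP_congr : ∀ c c', (∀ k < p, c k = c' k) → startP c → startP c'
  startD_congr : ∀ c c', (∀ k < p + q, c k = c' k) → startD c → startD c'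
  moveP_congr : ∀ z z' s s' c c', (∀ k < p + q, z k = z' k) → (∀ k < p + q, s k = s' k) →
    (∀ k < p, c k = c' k) → moveP z s c → moveP z' s' c'
  moveD_congr : ∀ z z' s s' c c', (∀ k < p + q, z k = z' k) → (∀ k < p + q, s k = s' k) →
    (∀ k < p + q, c k = c' k) → moveD z s c → moveD z' s' c'

namespace RecordGame

variable (R : RecordGame)

/-- The first player keeps the rules in round `r` of the recorded play. -/
def RuleP (r : ℕ) (a : List ℕ) : Prop :=
  (r = 0 ∧ R.startP (record (R.p + R.q) a r)) ∨
    ∃ s < r, r = s + 1 ∧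
      R.moveP (record (R.p + R.q) a 0) (record (R.p + R.q) a s) (record (R.p + R.q) a r)

/-- The second player keeps the rules in round `r` of the recorded play. -/
def RuleD (r : ℕ) (a : List ℕ) : Prop :=
  (r = 0 ∧ R.startD (record (R.p + R.q) a r)) ∨
    ∃ s < r, r = s + 1 ∧
      R.moveD (record (R.p + R.q) a 0) (record (R.p + R.q) a s) (record (R.p + R.q) a r)

/-- The first player wins the game of `f` further rounds, if `z` is the first record and `s` is the
last one. -/
def Wins (z : ℕ → ℕ) : ℕ → (ℕ → ℕ) → Prop
  | 0, _ => False
  | f + 1, s => ∃ c : ℕ → ℕ, (∀ k, c k < R.C) ∧ R.moveP z s c ∧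
      ∀ s' : ℕ → ℕ, (∀ k < R.p, s' k = c k) → (∀ k, s' k < R.C) → R.moveD z s s' → Wins z f s'

variable {R}

theorem wins_congr {z z' s s' : ℕ → ℕ} (hz : ∀ k < R.p + R.q, z k = z' k)
    (hs : ∀ k < R.p + R.q, s k = s' k) (f : ℕ) (h : R.Wins z f s) : R.Wins z' f s' := by
  induction f generalizing s s' with
  | zero => exact h
  | succ f ih =>
    obtain ⟨c, hc, hP, h⟩ := h
    refine ⟨c, hc, R.moveP_congr _ _ _ _ _ _ hz hs (fun _ _ => rfl) hP, fun t ht ht' hD => ?_⟩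
    exact ih (fun _ _ => rfl) (h t ht ht' (R.moveD_congr _ _ _ _ _ _ (fun k hk => (hz k hk).symm)
      (fun k hk => (hs k hk).symm) (fun _ _ => rfl) hD))

theorem ruleP_append {r : ℕ} {a b : List ℕ} (h : r * (R.p + R.q) + R.p ≤ a.length) :
    R.RuleP r (a ++ b) ↔ R.RuleP r a := by
  have h1 : ∀ k < R.p, record (R.p + R.q) (a ++ b) r k = record (R.p + R.q) a r k :=
    fun k hk => record_append (by omega)
  have h2 : ∀ s < r, ∀ k < R.p + R.q,
      record (R.p + R.q) (a ++ b) s k = record (R.p + R.q) a s k := fun s hs k hk => by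
    have := Nat.mul_le_mul_right (R.p + R.q) (show s + 1 ≤ r from hs)
    rw [Nat.add_mul] at this
    exact record_append (by omega)
  refine or_congr (and_congr_right fun _ => ⟨R.startP_congr _ _ h1,
    R.startP_congr _ _ fun k hk => (h1 k hk).symm⟩) (exists_congr fun s => and_congr_right fun hs =>
      and_congr_right fun _ => ⟨R.moveP_congr _ _ _ _ _ _ (h2 0 (by omega)) (h2 s hs) h1,
      R.moveP_congr _ _ _ _ _ _ (fun k hk => (h2 0 (by omega) k hk).symm)
        (fun k hk => (h2 s hs k hk).symm) fun k hk => (h1 k hk).symm⟩)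

theorem ruleD_append {r : ℕ} {a b : List ℕ} (h : (r + 1) * (R.p + R.q) ≤ a.length) :
    R.RuleD r (a ++ b) ↔ R.RuleD r a := by
  have h2 : ∀ s ≤ r, ∀ k < R.p + R.q,
      record (R.p + R.q) (a ++ b) s k = record (R.p + R.q) a s k := fun s hs k hk => by
    have := Nat.mul_le_mul_right (R.p + R.q) (show s + 1 ≤ r + 1 by omega)
    rw [Nat.add_mul s] at this
    exact record_append (by omega)
  refine or_congr (and_congr_right fun _ => ⟨R.startD_congr _ _ (h2 r le_rfl),
    R.startD_congr _ _ fun k hk => (h2 r le_rfl k hk).symm⟩) (exists_congr fun s =>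
      and_congr_right fun hs => and_congr_right fun _ =>
      ⟨R.moveD_congr _ _ _ _ _ _ (h2 0 (by omega)) (h2 s hs.le) (h2 r le_rfl),
      R.moveD_congr _ _ _ _ _ _ (fun k hk => (h2 0 (by omega) k hk).symm)
        (fun k hk => (h2 s hs.le k hk).symm) fun k hk => (h2 r le_rfl k hk).symm⟩)

theorem ruleP_zero {a : List ℕ} : R.RuleP 0 a ↔ R.startP (record (R.p + R.q) a 0) := by
  simp [RuleP]

theorem ruleD_zero {a : List ℕ} : R.RuleD 0 a ↔ R.startD (record (R.p + R.q) a 0) := by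
  simp [RuleD]

theorem ruleP_succ {s : ℕ} {a : List ℕ} : R.RuleP (s + 1) a ↔
    R.moveP (record (R.p + R.q) a 0) (record (R.p + R.q) a s) (record (R.p + R.q) a (s + 1)) := by
  refine ⟨?_, fun h => Or.inr ⟨s, by omega, rfl, h⟩⟩
  rintro (⟨h, -⟩ | ⟨s', -, h, h'⟩)
  · omega
  · obtain rfl : s = s' := by omega
    exact h'

theorem ruleD_succ {s : ℕ} {a : List ℕ} : R.RuleD (s + 1) a ↔
    R.moveD (record (R.p + R.q) a 0) (record (R.p + R.q) a s) (record (R.p + R.q) a (s + 1)) := by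
  refine ⟨?_, fun h => Or.inr ⟨s, by omega, rfl, h⟩⟩
  rintro (⟨h, -⟩ | ⟨s', -, h, h'⟩)
  · omega
  · obtain rfl : s = s' := by omega
    exact h'

/-- The cells of a record that is appended in two parts. -/
theorem record_append_two {F p q r k : ℕ} {a : List ℕ} (ha : a.length = r * F) (c d : ℕ → ℕ)
    (hk : k < p + q) :
    record F (a ++ (List.range p).map c ++ (List.range q).map d) r k =
      if k < p then c k else d (k - p) := by
  split_ifs with h
  · rw [record_append (by simp [ha, h])]
    have := record_append_map (F := F) (a := a) (r := r) (l := 0) c ha h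
    rwa [Nat.zero_add] at this
  · have := record_append_map (F := F) (a := a ++ (List.range p).map c) (r := r) (l := p)
      (k := k - p) d (by simp [ha]) (N := q) (by omega)
    rwa [Nat.add_sub_cancel' (by omega)] at this

theorem roundsWin_iff_wins (f s : ℕ) (a : List ℕ) (ha : a.length = (s + 1) * (R.p + R.q)) :
    RoundsWin R.C R.p R.q R.RuleP R.RuleD f (s + 1) a ↔
      R.Wins (record (R.p + R.q) a 0) f (record (R.p + R.q) a s) := by
  induction f generalizing s a with
  | zero => exact Iff.rfl
  | succ f ih =>
    have hold : ∀ b, ∀ r ≤ s, ∀ k < R.p + R.q,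
        record (R.p + R.q) (a ++ b) r k = record (R.p + R.q) a r k := fun b r hr k hk => by
      have := Nat.mul_le_mul_right (R.p + R.q) (show r + 1 ≤ s + 1 by omega)
      rw [Nat.add_mul r] at this
      exact record_append (by omega)
    have hnew : ∀ c, ∀ k < R.p,
        record (R.p + R.q) (a ++ (List.range R.p).map c) (s + 1) k = c k := fun c k hk => by
      have := record_append_map (F := R.p + R.q) (a := a) (r := s + 1) (l := 0) c ha hk
      rwa [Nat.zero_add] at this
    have hlen : ∀ c d, (a ++ (List.range R.p).map c ++ (List.range R.q).map d).length =
        (s + 1 + 1) * (R.p + R.q) := fun c d => by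
      simp [ha]
      ring
    have hold' : ∀ c d, ∀ r ≤ s, ∀ k < R.p + R.q,
        record (R.p + R.q) (a ++ (List.range R.p).map c ++ (List.range R.q).map d) r k =
          record (R.p + R.q) a r k := fun c d r hr k hk => by
      rw [List.append_assoc]
      exact hold _ r hr k hk
    rw [RoundsWin, Wins]
    refine exists_congr fun c => and_congr_right fun hc => and_congr ?_ ?_
    · rw [ruleP_succ]
      exact ⟨R.moveP_congr _ _ _ _ _ _ (hold _ 0 (Nat.zero_le _)) (hold _ s le_rfl) (hnew c),
        R.moveP_congr _ _ _ _ _ _ (fun k hk => (hold _ 0 (Nat.zero_le _) k hk).symm)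
          (fun k hk => (hold _ s le_rfl k hk).symm) fun k hk => (hnew c k hk).symm⟩
    · constructor
      · intro h t ht ht' hD
        have hcell : ∀ k < R.p + R.q, record (R.p + R.q) (a ++ (List.range R.p).map c ++
            (List.range R.q).map fun k => t (R.p + k)) (s + 1) k = t k := fun k hk => by
          rw [record_append_two ha c _ hk]
          split_ifs with hlt
          · exact (ht k hlt).symm
          · rw [Nat.add_sub_cancel' (by omega)]
        have h1 := h (fun k => t (R.p + k)) (fun k => ht' _) (by
          rw [ruleD_succ]
          exact R.moveD_congr _ _ _ _ _ _ (fun k hk => (hold' c _ 0 (Nat.zero_le _) k hk).symm)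
            (fun k hk => (hold' c _ s le_rfl k hk).symm) (fun k hk => (hcell k hk).symm) hD)
        rw [ih _ _ (hlen _ _)] at h1
        exact wins_congr (hold' c _ 0 (Nat.zero_le _)) hcell f h1
      · intro h d hd hD
        have hcell : ∀ k < R.p + R.q, record (R.p + R.q) (a ++ (List.range R.p).map c ++
            (List.range R.q).map d) (s + 1) k = if k < R.p then c k else d (k - R.p) :=
          fun k hk => record_append_two ha c d hk
        rw [ruleD_succ] at hD
        rw [ih _ _ (hlen _ _)]
        refine wins_congr (fun k hk => (hold' c d 0 (Nat.zero_le _) k hk).symm)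
          (fun k hk => (hcell k hk).symm) f (h _ (fun k hk => if_pos hk) (fun k => ?_) ?_)
        · split_ifs
          exacts [hc k, hd _]
        · exact R.moveD_congr _ _ _ _ _ _ (hold' c _ 0 (Nat.zero_le _)) (hold' c _ s le_rfl)
            hcell hD

/-- The alternation that looks for the first offence is the game on records. -/
theorem alt_iff_wins (f : ℕ) :
    Alt R.C (fun l => l % (R.p + R.q) < R.p) (FirstOffence R.RuleP R.RuleD (f + 1))
        ((f + 1) * (R.p + R.q)) [] ↔
      ∃ c : ℕ → ℕ, (∀ k, c k < R.C) ∧ R.startP c ∧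
        ∀ s : ℕ → ℕ, (∀ k < R.p, s k = c k) → (∀ k, s k < R.C) → R.startD s → R.Wins s f s := by
  have h0 := alt_firstOffence (P := R.RuleP) (D := R.RuleD) R.C_pos
    (fun r a b h => ruleP_append h) (fun r a b h => ruleD_append h) (f + 1) 0 [] (by simp) (by simp)
  rw [Nat.zero_add] at h0
  rw [h0, RoundsWin]
  have hz : ([] : List ℕ).length = 0 * (R.p + R.q) := by simp
  refine exists_congr fun c => and_congr_right fun hc => and_congr ?_ ?_
  · rw [ruleP_zero]
    have hnew : ∀ k < R.p, record (R.p + R.q) ([] ++ (List.range R.p).map c) 0 k = c k :=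
      fun k hk => by
        have := record_append_map (F := R.p + R.q) (r := 0) (l := 0) c hz hk
        rwa [Nat.zero_add] at this
    exact ⟨R.startP_congr _ _ hnew, R.startP_congr _ _ fun k hk => (hnew k hk).symm⟩
  · constructor
    · intro h t ht ht' hD
      have hcell : ∀ k < R.p + R.q, record (R.p + R.q) ([] ++ (List.range R.p).map c ++
          (List.range R.q).map fun k => t (R.p + k)) 0 k = t k := fun k hk => by
        rw [record_append_two hz c _ hk]
        split_ifs with hlt
        · exact (ht k hlt).symm
        · rw [Nat.add_sub_cancel' (by omega)]
      have h1 := h (fun k => t (R.p + k)) (fun k => ht' _) (by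
        rw [ruleD_zero]
        exact R.startD_congr _ _ (fun k hk => (hcell k hk).symm) hD)
      rw [roundsWin_iff_wins _ _ _ (by simp)] at h1
      exact wins_congr hcell hcell f h1
    · intro h d hd hD
      have hcell : ∀ k < R.p + R.q, record (R.p + R.q) ([] ++ (List.range R.p).map c ++
          (List.range R.q).map d) 0 k = if k < R.p then c k else d (k - R.p) :=
        fun k hk => record_append_two hz c d hk
      rw [ruleD_zero] at hD
      rw [roundsWin_iff_wins _ _ _ (by simp)]
      refine wins_congr (fun k hk => (hcell k hk).symm)
        (fun k hk => (hcell k hk).symm) f (h _ (fun k hk => if_pos hk) (fun k => ?_) ?_)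
      · split_ifs
        exacts [hc k, hd _]
      · exact R.startD_congr _ _ hcell hD

end RecordGame

/-! ### The coverage game as a game on records -/

/-- A game graph on `0, …, n - 1` and a sequence of objectives, given by predicates on numbers. -/
structure Board where
  n : ℕ
  own : ℕ → Prop
  edge : ℕ → ℕ → Prop
  obj : ℕ → ℕ → Prop

/-- The board describes the graph `G` and the objectives `α`. -/
structure Board.Represents (B : Board) (G : GameGraph (Fin B.n)) (α : ℕ → Set (Fin B.n)) :
    Prop where
  own_iff : ∀ v : Fin B.n, B.own v ↔ G.owner v = .one
  edge_iff : ∀ u v : Fin B.n, B.edge u v ↔ G.edge u v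
  obj_iff : ∀ (j : ℕ) (v : Fin B.n), B.obj j v ↔ v ∈ α j

/-! A record contains the following numbers. Cells `0`, `1`, `2` hold the move of Coverer: whether
she divides her agents (`≠ 0`) or moves (`0`), the vertex to which she moves, and the size of the
first group of agents. Cells `3, …, C + 2` hold the indicator of the objectives of the first group.
Cells `C + 3, …, C + 7` hold the position after the response of Disruptor: the vertex, the number of
agents, the number `i` of visits to targets to be made after the current one, the index of the
current target, and the number of steps left for the current visit. Cells `C + 8, …, 2 * C + 7` hold
the indicator of the objectives to be covered. -/

/-- The current vertex belongs to the current target. -/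
def Hit (γ : ObjectiveType) (C : ℕ) (B : Board) (s : ℕ → ℕ) : Prop :=
  match γ with
  | .buchi => B.obj (s (C + 6)) (s (C + 3))
  | .coBuchi => ∃ x < C, s (C + 8 + x) = 1 ∧ B.obj x (s (C + 3))

/-- The current target is one of the Büchi objectives to be covered. -/
def Focused (γ : ObjectiveType) (C : ℕ) (s : ℕ → ℕ) : Prop :=
  γ = .buchi → ∃ x < C, s (C + 6) = x ∧ s (C + 8 + x) = 1

/-- The rules for Coverer in a round from `s`. She loses at the end of a game in which she has not
reached her goal. -/
def CoverMove (γ : ObjectiveType) (C : ℕ) (B : Board) (s c : ℕ → ℕ) : Prop :=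
  (s (C + 7) = 0 → γ = .coBuchi) ∧
  (s (C + 7) ≠ 0 →
    (c 0 ≠ 0 → 0 < c 2 ∧ c 2 < s (C + 4)) ∧
    (c 0 = 0 → (B.own (s (C + 3)) → c 1 < B.n ∧ B.edge (s (C + 3)) (c 1)) ∧
      (Hit γ C B s → s (C + 5) = 0 → γ = .buchi)))

/-- The rules for Disruptor in a round from `s` that results in `s'`. If Coverer divides her agents,
then he continues the game with one of the groups. Otherwise, he performs the move. He loses at the
end of a game in which Coverer has kept her rules. -/
def DisruptMove (γ : ObjectiveType) (C : ℕ) (B : Board) (s s' : ℕ → ℕ) : Prop :=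
  s (C + 7) ≠ 0 ∧
  (s' 0 ≠ 0 → s' (C + 3) = s (C + 3) ∧ s' (C + 5) + 1 = B.n ∧ s' (C + 7) = B.n ∧
    Focused γ C s' ∧
    ((s' (C + 4) = s' 2 ∧
        ∀ x < C, s' (C + 8 + x) = 1 ↔ s (C + 8 + x) = 1 ∧ s' (3 + x) = 1) ∨
      (s' (C + 4) + s' 2 = s (C + 4) ∧
        ∀ x < C, s' (C + 8 + x) = 1 ↔ s (C + 8 + x) = 1 ∧ ¬ s' (3 + x) = 1))) ∧
  (s' 0 = 0 → s' (C + 3) < B.n ∧ B.edge (s (C + 3)) (s' (C + 3)) ∧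
    (B.own (s (C + 3)) → s' (C + 3) = s' 1) ∧ s' (C + 4) = s (C + 4) ∧
    (∀ x < C, s' (C + 8 + x) = 1 ↔ s (C + 8 + x) = 1) ∧
    (Hit γ C B s → s' (C + 5) + 1 = s (C + 5) ∧ s' (C + 7) = B.n ∧ Focused γ C s') ∧
    (¬ Hit γ C B s → s' (C + 5) = s (C + 5) ∧ s' (C + 6) = s (C + 6) ∧
      s' (C + 7) + 1 = s (C + 7)))

/-- The record with the given move of Coverer and the given position. -/
def position (C : ℕ) (c : ℕ → ℕ) (v κ i j t : ℕ) (J : ℕ → ℕ) : ℕ → ℕ := fun k =>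
  if k < C + 3 then c k else
    if k = C + 3 then v else if k = C + 4 then κ else if k = C + 5 then i else
      if k = C + 6 then j else if k = C + 7 then t else J (k - (C + 8))

section Position

variable {C : ℕ} {c : ℕ → ℕ} {v κ i j t : ℕ} {J : ℕ → ℕ}

theorem position_lt (hc : ∀ k, c k < C) (hv : v < C) (hκ : κ < C) (hi : i < C) (hj : j < C)
    (ht : t < C) (hJ : ∀ x, J x < C) (k : ℕ) : position C c v κ i j t J k < C := by
  unfold position
  split_ifs
  exacts [hc k, hv, hκ, hi, hj, ht, hJ _]

theorem position_of_lt {k : ℕ} (hk : k < C + 3) : position C c v κ i j t J k = c k := if_pos hk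

theorem position_three : position C c v κ i j t J (C + 3) = v := by simp [position]

theorem position_four : position C c v κ i j t J (C + 4) = κ := by simp [position]

theorem position_five : position C c v κ i j t J (C + 5) = i := by simp [position]

theorem position_six : position C c v κ i j t J (C + 6) = j := by simp [position]

theorem position_seven : position C c v κ i j t J (C + 7) = t := by simp [position]

theorem position_add (x : ℕ) : position C c v κ i j t J (C + 8 + x) = J x := by
  simp [position, show ¬ C + 8 + x < C + 3 by omega, show C + 8 + x ≠ C + 3 by omega,
    show C + 8 + x ≠ C + 4 by omega, show C + 8 + x ≠ C + 5 by omega,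
    show C + 8 + x ≠ C + 6 by omega, show C + 8 + x ≠ C + 7 by omega]

end Position

/-- The objectives to be covered in the position `s`. -/
def openSet (C : ℕ) (s : ℕ → ℕ) : Set ℕ := {x | x < C ∧ s (C + 8 + x) = 1}

section Correctness

variable {γ : ObjectiveType} {B : Board} {G : GameGraph (Fin B.n)} {α : ℕ → Set (Fin B.n)}

/-- The current target. -/
def target (γ : ObjectiveType) {V : Type*} (α : ℕ → Set V) (C : ℕ) (s : ℕ → ℕ) : Set V :=
  match γ with
  | .buchi => α (s (C + 6))
  | .coBuchi => ⋃ j ∈ openSet C s, α j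

theorem hit_iff (hB : B.Represents G α) {C : ℕ} {s : ℕ → ℕ} {v : Fin B.n} (hv : s (C + 3) = v) :
    Hit γ C B s ↔ v ∈ target γ α C s := by
  cases γ with
  | buchi => simp [Hit, target, hv, hB.obj_iff]
  | coBuchi => simp [Hit, target, hv, hB.obj_iff, openSet, and_assoc]

/-- The set to which the current vertex should belong, if Coverer is to win. -/
def region (γ : ObjectiveType) {V : Type*} (G : GameGraph V) (α : ℕ → Set V) (C N : ℕ)
    (s : ℕ → ℕ) : Set V :=
  Inner γ G (Divisible γ G α (s (C + 4)) (openSet C s)) (target γ α C s)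
    (Outer γ G α (Divisible γ G α (s (C + 4)) (openSet C s)) (openSet C s) N (s (C + 5)))
    (s (C + 7))

/-- A bound on the number of rounds that remain. -/
def remaining (C N : ℕ) (s : ℕ → ℕ) : ℕ :=
  s (C + 4) * (N + 1) ^ 2 + s (C + 5) * (N + 1) + s (C + 7)

theorem mem_pre_iff (hB : B.Represents G α) {C : ℕ} (hn : B.n < C) (v : Fin B.n)
    (W : Set (Fin B.n)) :
    v ∈ Pre G W ↔ ∃ u < C, (B.own v → u < B.n ∧ B.edge v u) ∧
      ∀ v' : Fin B.n, B.edge v v' → (B.own v → v'.1 = u) → v' ∈ W := by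
  simp only [Pre, Set.mem_ofPred_eq, hB.own_iff, hB.edge_iff]
  cases h : G.owner v with
  | one =>
    simp only [true_and, reduceCtorEq, false_and, or_false, forall_const]
    constructor
    · rintro ⟨u, hE, hu⟩
      refine ⟨u, by omega, ⟨u.2, (hB.edge_iff _ _).2 hE⟩, fun v' _ hv => ?_⟩
      rwa [Fin.ext hv]
    · rintro ⟨u, -, ⟨hu, hE⟩, h⟩
      have hE' := (hB.edge_iff v ⟨u, hu⟩).1 hE
      exact ⟨⟨u, hu⟩, hE', h _ hE' rfl⟩
  | two =>
    simp only [reduceCtorEq, false_and, false_or, true_and, IsEmpty.forall_iff, true_implies]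
    exact ⟨fun h => ⟨0, by omega, h⟩, fun ⟨_, _, h⟩ => h⟩

variable {R : RecordGame} {z : ℕ → ℕ} {f : ℕ}

/-- The positions at the beginning of the wait for the next visit, with a target that Disruptor
chooses. -/
theorem forall_fresh_iff (hp : R.p = R.C + 3) (hn : B.n < R.C)
    (ih : ∀ (s : ℕ → ℕ) (v : Fin B.n), (∀ k, s k < R.C) → s (R.C + 3) = v → 0 < s (R.C + 4) →
      s (R.C + 5) < B.n → s (R.C + 7) ≤ B.n → remaining R.C B.n s < f →
      (R.Wins z f s ↔ v ∈ region γ G α R.C B.n s))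
    {c : ℕ → ℕ} (hc : ∀ k, c k < R.C) (v : Fin B.n) {κ i : ℕ} {J : Set ℕ} (hκ : 0 < κ)
    (hκC : κ < R.C) (hi : i < B.n) (hJ : ∀ x ∈ J, x < R.C)
    (hf : κ * (B.n + 1) ^ 2 + i * (B.n + 1) + B.n < f) :
    (∀ s' : ℕ → ℕ, (∀ k < R.p, s' k = c k) → (∀ k, s' k < R.C) → s' (R.C + 3) = v →
      s' (R.C + 4) = κ → s' (R.C + 5) = i → s' (R.C + 7) = B.n →
      (∀ x < R.C, s' (R.C + 8 + x) = 1 ↔ x ∈ J) → Focused γ R.C s' → R.Wins z f s') ↔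
      v ∈ Outer γ G α (Divisible γ G α κ J) J B.n (i + 1) := by
  classical
  have hopen : ∀ s : ℕ → ℕ, (∀ x < R.C, s (R.C + 8 + x) = 1 ↔ x ∈ J) → openSet R.C s = J :=
    fun s hs => by
      ext x
      exact ⟨fun h => (hs x h.1).1 h.2, fun h => ⟨hJ x h, (hs x (hJ x h)).2 h⟩⟩
  have hv := v.2
  constructor
  · intro h T hT
    obtain ⟨j, hj, hfoc, htar⟩ : ∃ j < R.C, (γ = .buchi → j ∈ J) ∧
        ∀ s : ℕ → ℕ, openSet R.C s = J → s (R.C + 6) = j → target γ α R.C s = T := by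
      cases γ with
      | buchi =>
        obtain ⟨j, hj, rfl⟩ := hT
        exact ⟨j, hJ j hj, fun _ => hj, fun s _ hs => by rw [target, hs]⟩
      | coBuchi =>
        refine ⟨0, by omega, by simp, fun s hs _ => ?_⟩
        rw [target, hs]
        exact (show T = _ from hT).symm
    set s' := position R.C c v κ i j B.n (fun x => if x ∈ J then 1 else 0) with hs'
    have hJ' : ∀ x < R.C, s' (R.C + 8 + x) = 1 ↔ x ∈ J := fun x _ => by
      rw [hs', position_add]
      simp
    have hlt : ∀ k, s' k < R.C :=
      position_lt hc (by omega) hκC (by omega) hj hn fun x => by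
        split_ifs <;> omega
    have h3 : s' (R.C + 3) = v := position_three
    have h4 : s' (R.C + 4) = κ := position_four
    have h5 : s' (R.C + 5) = i := position_five
    have h6 : s' (R.C + 6) = j := position_six
    have h7 : s' (R.C + 7) = B.n := position_seven
    have := h s' (fun k hk => position_of_lt (by omega)) hlt h3 h4 h5 h7 hJ'
      fun hγ => ⟨j, hj, h6, (hJ' j hj).2 (hfoc hγ)⟩
    rw [ih s' v hlt h3 (by omega) (by omega) (by omega) (by rwa [remaining, h4, h5, h7]), region,
      h4, h5, h7, hopen s' hJ', htar s' (hopen s' hJ') h6] at this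
    exact this
  · intro h s' hs' hlt h3 h4 h5 h7 hJ' hfoc
    rw [ih s' v hlt h3 (by omega) (by omega) (by omega) (by rwa [remaining, h4, h5, h7]), region,
      h4, h5, h7, hopen s' hJ']
    refine h _ ?_
    cases γ with
    | buchi =>
      obtain ⟨x, hx, h6, h8⟩ := hfoc rfl
      exact ⟨x, (hJ' x hx).1 h8, by rw [target, h6]⟩
    | coBuchi =>
      rw [target, hopen s' hJ']
      rfl

/-- The game on records determines the bounded approximations of the winning regions. -/
theorem wins_iff_mem_region (hB : B.Represents G α) (hp : R.p = R.C + 3) (hn : B.n < R.C)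
    (hP : ∀ s c, R.moveP z s c ↔ CoverMove γ R.C B s c)
    (hD : ∀ s s', R.moveD z s s' ↔ DisruptMove γ R.C B s s') (f : ℕ) (s : ℕ → ℕ) (v : Fin B.n)
    (hs : ∀ k, s k < R.C) (h3 : s (R.C + 3) = v) (h4 : 0 < s (R.C + 4)) (h5 : s (R.C + 5) < B.n)
    (h7 : s (R.C + 7) ≤ B.n) (hf : remaining R.C B.n s < f) :
    R.Wins z f s ↔ v ∈ region γ G α R.C B.n s := by
  classical
  induction f generalizing s v with
  | zero => exact absurd hf (Nat.not_lt_zero _)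
  | succ f ih =>
    have hv := v.2
    have hκC := hs (R.C + 4)
    rw [RecordGame.Wins]
    simp only [hP, hD]
    set κ := s (R.C + 4) with hκ
    set i := s (R.C + 5) with hi
    set J := openSet R.C s with hJ
    have hJC : ∀ x ∈ J, x < R.C := fun x hx => hx.1
    have hJs : ∀ x < R.C, s (R.C + 8 + x) = 1 ↔ x ∈ J := fun x hx =>
      ⟨fun h => ⟨hx, h⟩, fun h => h.2⟩
    rcases Nat.eq_zero_or_pos (s (R.C + 7)) with ht | ht
    · have : v ∈ region γ G α R.C B.n s ↔ γ = .coBuchi := by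
        rw [region, ht]
        cases γ <;> simp [Inner, timeout]
      rw [this]
      simp only [CoverMove, DisruptMove, ht]
      constructor
      · rintro ⟨c, -, h, -⟩
        exact h.1 trivial
      · exact fun h => ⟨fun _ => 0, fun _ => R.C_pos, ⟨fun _ => h, by simp⟩, by simp⟩
    · obtain ⟨t, ht⟩ : ∃ t, s (R.C + 7) = t + 1 := ⟨s (R.C + 7) - 1, by omega⟩
      have hrem : κ * (B.n + 1) ^ 2 + i * (B.n + 1) + (t + 1) ≤ f := by
        have := hf
        rw [remaining, ht, ← hκ, ← hi] at this
        omega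
      -- After a division, one of the groups has to cover its objectives.
      have hgroup : ∀ {c : ℕ → ℕ}, (∀ k, c k < R.C) → ∀ {κ' J'}, 0 < κ' → κ' < κ →
          (∀ x ∈ J', x < R.C) →
          ((∀ s' : ℕ → ℕ, (∀ k < R.p, s' k = c k) → (∀ k, s' k < R.C) → s' (R.C + 3) = v →
            s' (R.C + 4) = κ' → s' (R.C + 5) = B.n - 1 → s' (R.C + 7) = B.n →
            (∀ x < R.C, s' (R.C + 8 + x) = 1 ↔ x ∈ J') → Focused γ R.C s' → R.Wins z f s') ↔
            v ∈ Covered γ G α κ' J') := fun {c} hc {κ' J'} h0 h1 hJ' => by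
        have h2 : (B.n - 1) * (B.n + 1) + B.n < (B.n + 1) ^ 2 := by
          obtain ⟨n, hn⟩ : ∃ n, B.n = n + 1 := ⟨B.n - 1, by omega⟩
          rw [hn, Nat.add_sub_cancel]
          nlinarith
        have h3 : (κ' + 1) * (B.n + 1) ^ 2 ≤ κ * (B.n + 1) ^ 2 := Nat.mul_le_mul_right _ h1
        rw [Nat.add_mul] at h3
        rw [forall_fresh_iff hp hn ih hc v h0 (by omega) (by omega) hJ' (by omega),
          Nat.sub_add_cancel (by omega), covered_eq_single h0, single_eq_outer, Fintype.card_fin]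
      have hreg : v ∈ region γ G α R.C B.n s ↔ v ∈ Divisible γ G α κ J ∨
          (Hit γ R.C B s ∧ v ∈ Pre G (Outer γ G α (Divisible γ G α κ J) J B.n i)) ∨
          (¬ Hit γ R.C B s ∧ v ∈ Pre G (Inner γ G (Divisible γ G α κ J) (target γ α R.C s)
            (Outer γ G α (Divisible γ G α κ J) J B.n i) t)) := by
        rw [region, ht, hit_iff hB h3, ← or_assoc]
        rfl
      -- The position after a move to `v'` if the current vertex is not in the target.
      have hnext : ∀ {c : ℕ → ℕ}, (∀ k, c k < R.C) → ∀ v' : Fin B.n,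
          ((∀ s' : ℕ → ℕ, (∀ k < R.p, s' k = c k) → (∀ k, s' k < R.C) → s' (R.C + 3) = v' →
            s' (R.C + 4) = κ → (∀ x < R.C, s' (R.C + 8 + x) = 1 ↔ s (R.C + 8 + x) = 1) →
            s' (R.C + 5) = i → s' (R.C + 6) = s (R.C + 6) → s' (R.C + 7) + 1 = s (R.C + 7) →
            R.Wins z f s') ↔
          v' ∈ Inner γ G (Divisible γ G α κ J) (target γ α R.C s)
            (Outer γ G α (Divisible γ G α κ J) J B.n i) t) := fun {c} hc v' => by
        have key : ∀ s' : ℕ → ℕ, (∀ k, s' k < R.C) → s' (R.C + 3) = v' →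
            s' (R.C + 4) = κ → (∀ x < R.C, s' (R.C + 8 + x) = 1 ↔ s (R.C + 8 + x) = 1) →
            s' (R.C + 5) = i → s' (R.C + 6) = s (R.C + 6) → s' (R.C + 7) + 1 = s (R.C + 7) →
            (R.Wins z f s' ↔ v' ∈ Inner γ G (Divisible γ G α κ J) (target γ α R.C s)
            (Outer γ G α (Divisible γ G α κ J) J B.n i) t) := by
          intro s' hlt g3 g4 gJ g5 g6 g7
          have g7' : s' (R.C + 7) = t := by omega
          have gJ' : openSet R.C s' = J := by
            ext x
            exact and_congr_right fun hx => gJ x hx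
          have gt : target γ α R.C s' = target γ α R.C s := by
            cases γ with
            | buchi => rw [target, target, g6]
            | coBuchi => rw [target, target, gJ']
          rw [ih s' v' hlt g3 (by omega) (by omega) (by omega)
            (by rw [remaining, g4, g5, g7']; omega), region, g4, g5, g7', gJ', gt]
        constructor
        · intro h
          set s' := position R.C c v' κ i (s (R.C + 6)) t (fun x => s (R.C + 8 + x)) with hs'
          have hlt : ∀ k, s' k < R.C :=
            position_lt hc (by omega) (by omega) (by omega) (hs _) (by omega) fun x => hs _
          have g3 : s' (R.C + 3) = v' := position_three
          have g4 : s' (R.C + 4) = κ := position_four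
          have g5 : s' (R.C + 5) = i := position_five
          have g6 : s' (R.C + 6) = s (R.C + 6) := position_six
          have g7 : s' (R.C + 7) = t := position_seven
          have gJ : ∀ x < R.C, s' (R.C + 8 + x) = 1 ↔ s (R.C + 8 + x) = 1 := fun x _ => by
            rw [hs', position_add]
          exact (key s' hlt g3 g4 gJ g5 g6 (by omega)).1
            (h s' (fun k hk => position_of_lt (by omega)) hlt g3 g4 gJ g5 g6 (by omega))
        · intro h s' _ hlt g3 g4 gJ g5 g6 g7
          exact (key s' hlt g3 g4 gJ g5 g6 g7).2 h
      -- The position after a move to `v'` if the current vertex is in the target.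
      have hhit : ∀ {c : ℕ → ℕ}, (∀ k, c k < R.C) → ∀ v' : Fin B.n, (i = 0 → γ = .buchi) →
          ((∀ s' : ℕ → ℕ, (∀ k < R.p, s' k = c k) → (∀ k, s' k < R.C) → s' (R.C + 3) = v' →
            s' (R.C + 4) = κ → (∀ x < R.C, s' (R.C + 8 + x) = 1 ↔ s (R.C + 8 + x) = 1) →
            s' (R.C + 5) + 1 = i → s' (R.C + 7) = B.n → Focused γ R.C s' →
            R.Wins z f s') ↔
          v' ∈ Outer γ G α (Divisible γ G α κ J) J B.n i) := fun {c} hc v' hγ => by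
        rcases Nat.eq_zero_or_pos i with h0 | h0
        · rw [h0, hγ h0]
          exact iff_of_true (fun s' _ _ _ _ _ h => absurd h (Nat.succ_ne_zero _)) trivial
        · obtain ⟨i', hi'⟩ : ∃ i', i = i' + 1 := ⟨i - 1, by omega⟩
          have h1 : i * (B.n + 1) = i' * (B.n + 1) + (B.n + 1) := by rw [hi', Nat.add_mul, one_mul]
          rw [hi', ← forall_fresh_iff hp hn ih hc v' h4 (by omega) (by omega) hJC (by omega)]
          constructor
          · intro h s' g1 g2 g3 g4 g5 g7 g8 g9
            exact h s' g1 g2 g3 g4 (fun x hx => (g8 x hx).trans (hJs x hx).symm) (by omega) g7 g9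
          · intro h s' g1 g2 g3 g4 g8 g5 g7 g9
            exact h s' g1 g2 g3 g4 (by omega) g7 (fun x hx => (g8 x hx).trans (hJs x hx)) g9
      rw [hreg]
      constructor
      · rintro ⟨c, hc, ⟨-, hmove⟩, h⟩
        obtain ⟨hdiv, hmove⟩ := hmove (by omega)
        by_cases h0 : c 0 = 0
        · right
          obtain ⟨hu, hcomp⟩ := hmove h0
          rw [h3] at hu
          by_cases hH : Hit γ R.C B s
          · refine Or.inl ⟨hH, (mem_pre_iff hB hn v _).2 ⟨c 1, hc 1, hu, fun v' hE hv' => ?_⟩⟩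
            refine (hhit hc v' (hcomp hH)).1 fun s' g1 g2 g3 g4 g8 g5 g7 g9 => h s' g1 g2 ?_
            have e0 := g1 0 (by omega)
            have e1 := g1 1 (by omega)
            refine ⟨by omega, fun h => absurd (e0.trans h0) h, fun _ => ⟨by omega, ?_, ?_, g4, g8,
              fun _ => ⟨g5, g7, g9⟩, fun h => absurd hH h⟩⟩
            · rw [h3, g3]
              exact hE
            · rw [h3, g3, e1]
              exact hv'
          · refine Or.inr ⟨hH, (mem_pre_iff hB hn v _).2 ⟨c 1, hc 1, hu, fun v' hE hv' => ?_⟩⟩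
            refine (hnext hc v').1 fun s' g1 g2 g3 g4 g8 g5 g6 g7 => h s' g1 g2 ?_
            have e0 := g1 0 (by omega)
            have e1 := g1 1 (by omega)
            refine ⟨by omega, fun h => absurd (e0.trans h0) h, fun _ => ⟨by omega, ?_, ?_, g4, g8,
              fun h => absurd h hH, fun _ => ⟨g5, g6, g7⟩⟩⟩
            · rw [h3, g3]
              exact hE
            · rw [h3, g3, e1]
              exact hv'
        · left
          obtain ⟨hκ0, hκ1⟩ := hdiv h0
          have hcell : ∀ s' : ℕ → ℕ, (∀ k < R.p, s' k = c k) → ∀ x < R.C, s' (3 + x) = c (3 + x) :=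
            fun s' h x hx => h _ (by omega)
          refine ⟨c 2, {x | c (3 + x) = 1}, hκ0, hκ1, ?_, ?_⟩
          · refine (hgroup hc hκ0 hκ1 fun x hx => hJC x hx.1).1
              fun s' g1 g2 g3 g4 g5 g7 g8 g9 => h s' g1 g2 ?_
            have e0 := g1 0 (by omega)
            have e2 := g1 2 (by omega)
            refine ⟨by omega, fun _ => ⟨by omega, by omega, g7, g9, Or.inl ⟨by omega,
              fun x hx => ?_⟩⟩, fun h => absurd (e0.symm.trans h) h0⟩
            rw [g8 x hx, hcell s' g1 x hx, hJs x hx]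
            rfl
          · refine (hgroup hc (by omega) (by omega) fun x hx => hJC x hx.1).1
              fun s' g1 g2 g3 g4 g5 g7 g8 g9 => h s' g1 g2 ?_
            have e0 := g1 0 (by omega)
            have e2 := g1 2 (by omega)
            refine ⟨by omega, fun _ => ⟨by omega, by omega, g7, g9, Or.inr ⟨by omega,
              fun x hx => ?_⟩⟩, fun h => absurd (e0.symm.trans h) h0⟩
            rw [g8 x hx, hcell s' g1 x hx, hJs x hx]
            rfl
      · rintro (⟨κ₁, X, hκ0, hκ1, hX, hX'⟩ | ⟨hH, hpre⟩ | ⟨hH, hpre⟩)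
        · set c : ℕ → ℕ := fun k => if k = 0 then 1 else if k = 2 then κ₁ else
            if 3 ≤ k ∧ k - 3 ∈ X then 1 else 0 with hcdef
          have hc : ∀ k, c k < R.C := fun k => by
            simp only [hcdef]
            split_ifs <;> omega
          have c0 : c 0 = 1 := rfl
          have c2 : c 2 = κ₁ := rfl
          have c3 : ∀ x, c (3 + x) = 1 ↔ x ∈ X := fun x => by
            simp only [hcdef]
            rw [if_neg (by omega), if_neg (by omega)]
            simp
          refine ⟨c, hc, ⟨fun h => absurd h (by omega), fun _ => ⟨fun _ => by omega, fun h =>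
            absurd h (by omega)⟩⟩, fun s' g1 g2 g => ?_⟩
          have e0 := g1 0 (by omega)
          have e2 := g1 2 (by omega)
          have e3 : ∀ x < R.C, s' (3 + x) = 1 ↔ x ∈ X := fun x hx => by
            rw [g1 _ (by omega)]
            exact c3 x
          obtain ⟨-, g, -⟩ := g
          obtain ⟨g3, g5, g7, g9, ⟨g4, g8⟩ | ⟨g4, g8⟩⟩ := g (by omega)
          · refine (hgroup hc hκ0 hκ1 fun x hx => hJC x hx.1).2 hX s' g1 g2 (by omega) (by omega)
              (by omega) g7 (fun x hx => ?_) g9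
            rw [g8 x hx, hJs x hx, e3 x hx]
            rfl
          · refine (hgroup hc (by omega) (by omega) fun x hx => hJC x hx.1).2 hX' s' g1 g2
              (by omega) (by omega) (by omega) g7 (fun x hx => ?_) g9
            rw [g8 x hx, hJs x hx, e3 x hx]
            rfl
        all_goals
          obtain ⟨u, huC, hu, hW⟩ := (mem_pre_iff hB hn v _).1 hpre
          have hc : ∀ k, (fun k => if k = 1 then u else 0 : ℕ → ℕ) k < R.C := fun k => by
            dsimp only
            split_ifs <;> omega
        · have hcomp : i = 0 → γ = .buchi := fun h0 => by
            cases γ with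
            | buchi => rfl
            | coBuchi =>
              obtain ⟨u', hu'⟩ : ∃ v' : Fin B.n, B.edge v v' ∧ (B.own v → v'.1 = u) := by
                by_cases ho : B.own v
                · exact ⟨⟨u, (hu ho).1⟩, (hu ho).2, fun _ => rfl⟩
                · obtain ⟨v', hv'⟩ := G.total v
                  exact ⟨v', (hB.edge_iff _ _).2 hv', fun h => absurd h ho⟩
              have := hW u' hu'.1 hu'.2
              rw [h0] at this
              exact absurd this (Set.notMem_empty _)
          refine ⟨_, hc, ⟨fun h => absurd h (by omega), fun _ => ⟨fun h => absurd rfl h, fun _ =>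
            ⟨by rw [h3]; exact hu, fun _ => hcomp⟩⟩⟩, fun s' g1 g2 g => ?_⟩
          obtain ⟨-, -, g⟩ := g
          obtain ⟨g3, gE, go, g4, g8, gH, -⟩ := g (g1 0 (by omega))
          obtain ⟨g5, g7, g9⟩ := gH hH
          rw [h3] at gE go
          have e1 : s' 1 = u := g1 1 (by omega)
          rw [e1] at go
          exact (hhit hc ⟨s' (R.C + 3), g3⟩ hcomp).2 (hW ⟨s' (R.C + 3), g3⟩ gE go) s' g1 g2 rfl g4
            g8 g5 g7 g9
        · refine ⟨_, hc, ⟨fun h => absurd h (by omega), fun _ => ⟨fun h => absurd rfl h, fun _ =>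
            ⟨by rw [h3]; exact hu, fun h => absurd h hH⟩⟩⟩, fun s' g1 g2 g => ?_⟩
          obtain ⟨-, -, g⟩ := g
          obtain ⟨g3, gE, go, g4, g8, -, gH⟩ := g (g1 0 (by omega))
          obtain ⟨g5, g6, g7⟩ := gH hH
          rw [h3] at gE go
          have e1 : s' 1 = u := g1 1 (by omega)
          rw [e1] at go
          exact (hnext hc ⟨s' (R.C + 3), g3⟩).2 (hW ⟨s' (R.C + 3), g3⟩ gE go) s' g1 g2 rfl g4
            g8 g5 g6 g7

end Correctness

/-! ### The letters of an input word -/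

section Letters

variable {n m ℓ : ℕ} {w : List (Option Bool)}

/-- The bit `1` is at position `p` of the word. -/
def Bit (w : List (Option Bool)) (p : ℕ) : Prop := w[p]? = some (some true)

/-- The word consists of bit vectors of length `n`, `n`, `ℓ`, and then `n + m` times `n`, each of
them followed by a separator. -/
structure IsFrame (w : List (Option Bool)) (n m ℓ : ℕ) : Prop where
  length_eq : w.length = 2 * n + 3 + ℓ + (n + m) * (n + 1)
  own_bit : ∀ x < n, w[x]? ≠ some none
  own_sep : w[n]? = some none
  init_bit : ∀ x < n, w[n + 1 + x]? ≠ some none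
  init_sep : w[2 * n + 1]? = some none
  agents_bit : ∀ x < ℓ, w[2 * n + 2 + x]? ≠ some none
  agents_sep : w[2 * n + 2 + ℓ]? = some none
  row_sep : ∀ c < n + m, w[2 * n + 3 + ℓ + c * (n + 1) + n]? = some none
  row_bit : ∀ c < n + m, ∀ x < n, w[2 * n + 3 + ℓ + c * (n + 1) + x]? ≠ some none

/-- The word encodes a coverage game on `n` vertices with `m` objectives and a number of agents of
`ℓ` bits. -/
structure IsInput (w : List (Option Bool)) (n m ℓ : ℕ) : Prop where
  frame : IsFrame w n m ℓ
  init : ∃ v < n, Bit w (n + 1 + v) ∧ ∀ u < n, Bit w (n + 1 + u) → u = v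
  total : ∀ u < n, ∃ v < n, Bit w (2 * n + 3 + ℓ + u * (n + 1) + v)
  lead : ℓ = 0 ∨ Bit w (2 * n + 1 + ℓ)

/-- The board that the word describes. -/
def boardOf (w : List (Option Bool)) (n ℓ : ℕ) : Board where
  n := n
  own v := Bit w v
  edge u v := Bit w (2 * n + 3 + ℓ + u * (n + 1) + v)
  obj j v := Bit w (2 * n + 3 + ℓ + (n + j) * (n + 1) + v)

theorem getElem?_congr_of_bit {w w' : List (Option Bool)} {p : ℕ} (h : p < w.length)
    (h' : p < w'.length) (hb : w[p]? ≠ some none) (hb' : w'[p]? ≠ some none)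
    (hw : Bit w p ↔ Bit w' p) : w[p]? = w'[p]? := by
  unfold Bit at hw
  rw [List.getElem?_eq_getElem h] at hb hw ⊢
  rw [List.getElem?_eq_getElem h'] at hb' hw ⊢
  generalize w[p] = x at hb hw ⊢
  generalize w'[p] = y at hb' hw ⊢
  rcases x with _ | _ | _ <;> rcases y with _ | _ | _ <;> simp_all

/-- A word is determined by its frame and its bits. -/
theorem IsFrame.ext {w' : List (Option Bool)} (h : IsFrame w n m ℓ) (h' : IsFrame w' n m ℓ)
    (hown : ∀ x < n, Bit w x ↔ Bit w' x) (hinit : ∀ x < n, Bit w (n + 1 + x) ↔ Bit w' (n + 1 + x))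
    (hag : ∀ x < ℓ, Bit w (2 * n + 2 + x) ↔ Bit w' (2 * n + 2 + x))
    (hrow : ∀ c < n + m, ∀ x < n, Bit w (2 * n + 3 + ℓ + c * (n + 1) + x) ↔
      Bit w' (2 * n + 3 + ℓ + c * (n + 1) + x)) : w = w' := by
  have hlen := h.length_eq
  have hlen' := h'.length_eq
  refine List.ext_getElem? fun p => ?_
  rcases Nat.lt_or_ge p w.length with hp | hp
  swap
  · rw [List.getElem?_eq_none hp, List.getElem?_eq_none (by omega)]
  have hp' : p < w'.length := by omega
  rcases Nat.lt_trichotomy p n with h1 | h1 | h1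
  · exact getElem?_congr_of_bit hp hp' (h.own_bit p h1) (h'.own_bit p h1) (hown p h1)
  · rw [h1, h.own_sep, h'.own_sep]
  obtain ⟨x, rfl⟩ : ∃ x, p = n + 1 + x := ⟨p - (n + 1), by omega⟩
  rcases Nat.lt_trichotomy x n with h2 | h2 | h2
  · exact getElem?_congr_of_bit hp hp' (h.init_bit x h2) (h'.init_bit x h2) (hinit x h2)
  · rw [show n + 1 + x = 2 * n + 1 by omega, h.init_sep, h'.init_sep]
  obtain ⟨y, hy⟩ : ∃ y, n + 1 + x = 2 * n + 2 + y := ⟨x - (n + 1), by omega⟩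
  rw [hy] at hp hp' ⊢
  rcases Nat.lt_trichotomy y ℓ with h3 | h3 | h3
  · exact getElem?_congr_of_bit hp hp' (h.agents_bit y h3) (h'.agents_bit y h3) (hag y h3)
  · rw [h3, h.agents_sep, h'.agents_sep]
  obtain ⟨u, hu⟩ : ∃ u, 2 * n + 2 + y = 2 * n + 3 + ℓ + u := ⟨y - (ℓ + 1), by omega⟩
  rw [hu] at hp hp' ⊢
  have hc : u / (n + 1) < n + m := Nat.div_lt_of_lt_mul (by rw [Nat.mul_comm]; omega)
  have hx : u % (n + 1) ≤ n := Nat.lt_succ_iff.1 (Nat.mod_lt _ (Nat.succ_pos n))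
  have hux : 2 * n + 3 + ℓ + u = 2 * n + 3 + ℓ + u / (n + 1) * (n + 1) + u % (n + 1) := by
    have := Nat.div_add_mod' u (n + 1)
    omega
  rw [hux] at hp hp' ⊢
  rcases hx.lt_or_eq with h4 | h4
  · exact getElem?_congr_of_bit hp hp' (h.row_bit _ hc _ h4) (h'.row_bit _ hc _ h4) (hrow _ hc _ h4)
  · rw [h4, h.row_sep _ hc, h'.row_sep _ hc]

end Letters

/-! ### The letters of the word for a game -/

section Blocks

theorem getElem?_block_lt {b : List Bool} {r : List (Option Bool)} {x : ℕ} (h : x < b.length) :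
    (b.map some ++ [none] ++ r)[x]? = some (some b[x]) := by
  rw [List.getElem?_append_left (by simp; omega), List.getElem?_append_left (by simpa using h)]
  simp [h]

theorem getElem?_block_eq {b : List Bool} {r : List (Option Bool)} {x : ℕ} (h : x = b.length) :
    (b.map some ++ [none] ++ r)[x]? = some none := by
  subst h
  simp

theorem getElem?_block_add {b : List Bool} {r : List (Option Bool)} {x y : ℕ}
    (h : x = b.length + 1 + y) : (b.map some ++ [none] ++ r)[x]? = r[y]? := by
  subst h
  rw [List.getElem?_append_right (by simp)]
  simp

theorem joinBlocks_cons (b : List Bool) (bs : List (List Bool)) :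
    joinBlocks (b :: bs) = b.map some ++ [none] ++ joinBlocks bs := rfl

variable {n : ℕ}

theorem length_joinBlocks {bs : List (List Bool)} (h : ∀ b ∈ bs, b.length = n) :
    (joinBlocks bs).length = bs.length * (n + 1) := by
  induction bs with
  | nil => simp [joinBlocks]
  | cons b bs ih =>
    rw [joinBlocks_cons, List.length_append, ih fun c hc => h c (List.mem_cons_of_mem _ hc)]
    simp [h b]
    ring

theorem getElem?_joinBlocks {bs : List (List Bool)} (h : ∀ b ∈ bs, b.length = n) {c x : ℕ}
    (hx : x < n) (hc : c < bs.length) :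
    (joinBlocks bs)[c * (n + 1) + x]? = some (bs[c][x]?) := by
  induction bs generalizing c with
  | nil => exact absurd hc (Nat.not_lt_zero _)
  | cons b bs ih =>
    have hb := h b List.mem_cons_self
    rw [joinBlocks_cons]
    cases c with
    | zero =>
      rw [Nat.zero_mul, Nat.zero_add, getElem?_block_lt (by omega)]
      simp [hb, hx]
    | succ c =>
      rw [getElem?_block_add (y := c * (n + 1) + x) (by rw [hb]; ring),
        ih (fun c hc => h c (List.mem_cons_of_mem _ hc)) (Nat.lt_of_succ_lt_succ hc)]
      rfl

theorem getElem?_joinBlocks_sep {bs : List (List Bool)} (h : ∀ b ∈ bs, b.length = n) {c : ℕ}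
    (hc : c < bs.length) : (joinBlocks bs)[c * (n + 1) + n]? = some none := by
  induction bs generalizing c with
  | nil => exact absurd hc (Nat.not_lt_zero _)
  | cons b bs ih =>
    have hb := h b List.mem_cons_self
    rw [joinBlocks_cons]
    cases c with
    | zero => rw [Nat.zero_mul, Nat.zero_add, getElem?_block_eq hb.symm]
    | succ c =>
      rw [getElem?_block_add (y := c * (n + 1) + n) (by rw [hb]; ring),
        ih (fun c hc => h c (List.mem_cons_of_mem _ hc)) (Nat.lt_of_succ_lt_succ hc)]

theorem length_bitVector (P : Fin n → Prop) : (bitVector P).length = n := by simp [bitVector]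

theorem getElem_bitVector (P : Fin n → Prop) {x : ℕ} (hx : x < (bitVector P).length) :
    (bitVector P)[x] = true ↔ P ⟨x, by rwa [length_bitVector] at hx⟩ := by
  simp [bitVector]

theorem exists_bits_eq (b : List Bool) (h : ∀ x ∈ b.getLast?, x = true) : ∃ k : ℕ, k.bits = b := by
  induction b with
  | nil => exact ⟨0, by simp⟩
  | cons x b ih =>
    obtain ⟨k, hk⟩ := ih fun y hy => h y (by
      cases b with
      | nil => simp at hy
      | cons => simpa using hy)
    refine ⟨Nat.bit x k, ?_⟩
    rw [Nat.bits_append_bit, hk]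
    rintro rfl
    rw [Nat.zero_bits] at hk
    subst hk
    exact h x (by simp)

theorem getLast?_bits (k : ℕ) : ∀ x ∈ k.bits.getLast?, x = true := by
  induction k using Nat.binaryRec' with
  | zero => simp
  | bit b k hb ih =>
    rw [Nat.bits_append_bit _ _ hb]
    rcases h : k.bits with _ | ⟨y, t⟩
    · have hk : k = 0 := by
        by_contra h0
        have := congrArg List.length h
        rw [Nat.size_eq_bits_len] at this
        exact h0 (Nat.size_eq_zero.1 this)
      simpa using hb hk
    · rw [h] at ih
      simpa using ih

theorem testBit_iff_getElem?_bits (k i : ℕ) : k.testBit i = true ↔ k.bits[i]? = some true := by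
  rw [Nat.testBit_eq_inth, List.getI_eq_getElem?_getD]
  rcases k.bits[i]? with _ | x
  · simp
  · simp

end Blocks

section Encode

variable {n : ℕ} (𝒢 : CoverageGame (Fin n)) (l : List (Set (Fin n)))

/-- The rows of the adjacency matrix, followed by the objectives. -/
noncomputable def rowBlocks : List (List Bool) :=
  (List.ofFn fun v => bitVector (𝒢.graph.edge v)) ++ l.map (fun α => bitVector (· ∈ α))

theorem length_of_mem_rowBlocks : ∀ b ∈ rowBlocks 𝒢 l, b.length = n := by
  intro b hb
  rcases List.mem_append.1 hb with hb | hb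
  · obtain ⟨v, rfl⟩ := (List.mem_ofFn' _ _).1 hb
    exact length_bitVector _
  · obtain ⟨α, -, rfl⟩ := List.mem_map.1 hb
    exact length_bitVector _

theorem length_rowBlocks : (rowBlocks 𝒢 l).length = n + l.length := by simp [rowBlocks]

theorem encode_eq : encode 𝒢 l =
    (bitVector fun v => 𝒢.graph.owner v = Player.one).map some ++ [none] ++
      ((bitVector fun v => v = 𝒢.graph.init).map some ++ [none] ++
        (𝒢.agents.bits.map some ++ [none] ++ joinBlocks (rowBlocks 𝒢 l))) := rfl

theorem encode_own {x : ℕ} (hx : x < n) :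
    (encode 𝒢 l)[x]? = some (bitVector fun v => 𝒢.graph.owner v = Player.one)[x]? := by
  rw [encode_eq, getElem?_block_lt (by rwa [length_bitVector])]
  simp [length_bitVector, hx]

theorem encode_init {x : ℕ} (hx : x < n) :
    (encode 𝒢 l)[n + 1 + x]? = some (bitVector fun v => v = 𝒢.graph.init)[x]? := by
  rw [encode_eq, getElem?_block_add (by rw [length_bitVector]),
    getElem?_block_lt (by rwa [length_bitVector])]
  simp [length_bitVector, hx]

theorem encode_agents {x : ℕ} (hx : x < 𝒢.agents.bits.length) :
    (encode 𝒢 l)[2 * n + 2 + x]? = some 𝒢.agents.bits[x]? := by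
  rw [encode_eq, getElem?_block_add (y := n + 1 + x) (by rw [length_bitVector]; omega),
    getElem?_block_add (by rw [length_bitVector]), getElem?_block_lt hx]
  simp [hx]

theorem encode_rows (y : ℕ) :
    (encode 𝒢 l)[2 * n + 3 + 𝒢.agents.bits.length + y]? = (joinBlocks (rowBlocks 𝒢 l))[y]? := by
  rw [encode_eq, getElem?_block_add (y := n + 2 + 𝒢.agents.bits.length + y)
      (by rw [length_bitVector]; omega),
    getElem?_block_add (y := 𝒢.agents.bits.length + 1 + y) (by rw [length_bitVector]; omega),
    getElem?_block_add rfl]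

theorem encode_row {c x : ℕ} (hx : x < n) (hc : c < (rowBlocks 𝒢 l).length) :
    (encode 𝒢 l)[2 * n + 3 + 𝒢.agents.bits.length + c * (n + 1) + x]? =
      some (rowBlocks 𝒢 l)[c][x]? := by
  rw [Nat.add_assoc _ (c * (n + 1)) x, encode_rows,
    getElem?_joinBlocks (length_of_mem_rowBlocks 𝒢 l) hx hc]

theorem some_getElem?_ne {b : List Bool} {x : ℕ} (h : x < b.length) : some b[x]? ≠ some none := by
  simp [h]

theorem isFrame_encode : IsFrame (encode 𝒢 l) n l.length 𝒢.agents.bits.length where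
  length_eq := by
    rw [encode_eq]
    simp only [List.length_append, List.length_map, length_bitVector, List.length_singleton,
      length_joinBlocks (length_of_mem_rowBlocks 𝒢 l), length_rowBlocks]
    omega
  own_bit x hx := by
    rw [encode_own 𝒢 l hx]
    exact some_getElem?_ne (by rwa [length_bitVector])
  own_sep := by rw [encode_eq, getElem?_block_eq (length_bitVector _).symm]
  init_bit x hx := by
    rw [encode_init 𝒢 l hx]
    exact some_getElem?_ne (by rwa [length_bitVector])
  init_sep := by
    rw [encode_eq, getElem?_block_add (y := n) (by rw [length_bitVector]; omega),
      getElem?_block_eq (length_bitVector _).symm]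
  agents_bit x hx := by
    rw [encode_agents 𝒢 l hx]
    exact some_getElem?_ne hx
  agents_sep := by
    rw [encode_eq, getElem?_block_add (y := n + 1 + 𝒢.agents.bits.length)
        (by rw [length_bitVector]; omega),
      getElem?_block_add (by rw [length_bitVector]), getElem?_block_eq rfl]
  row_sep c hc := by
    rw [Nat.add_assoc _ (c * (n + 1)) n, encode_rows, getElem?_joinBlocks_sep
      (length_of_mem_rowBlocks 𝒢 l) (by rwa [length_rowBlocks])]
  row_bit c hc x hx := by
    rw [← length_rowBlocks 𝒢 l] at hc
    rw [encode_row 𝒢 l hx hc]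
    exact some_getElem?_ne (by rwa [length_of_mem_rowBlocks 𝒢 l _ (List.getElem_mem hc)])

theorem getElem?_bitVector (P : Fin n → Prop) {x : ℕ} (hx : x < n) :
    (bitVector P)[x]? = some true ↔ P ⟨x, hx⟩ := by
  rw [List.getElem?_eq_getElem (by rwa [length_bitVector]), Option.some_inj, getElem_bitVector]

theorem bit_own {x : ℕ} (hx : x < n) :
    Bit (encode 𝒢 l) x ↔ 𝒢.graph.owner ⟨x, hx⟩ = .one := by
  rw [Bit, encode_own 𝒢 l hx, Option.some_inj, getElem?_bitVector _ hx]

theorem bit_init {x : ℕ} (hx : x < n) :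
    Bit (encode 𝒢 l) (n + 1 + x) ↔ ⟨x, hx⟩ = 𝒢.graph.init := by
  rw [Bit, encode_init 𝒢 l hx, Option.some_inj, getElem?_bitVector _ hx]

theorem bit_agents {x : ℕ} (hx : x < 𝒢.agents.bits.length) :
    Bit (encode 𝒢 l) (2 * n + 2 + x) ↔ 𝒢.agents.bits[x]? = some true := by
  rw [Bit, encode_agents 𝒢 l hx, Option.some_inj]

theorem bit_edge {u v : ℕ} (hu : u < n) (hv : v < n) :
    Bit (encode 𝒢 l) (2 * n + 3 + 𝒢.agents.bits.length + u * (n + 1) + v) ↔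
      𝒢.graph.edge ⟨u, hu⟩ ⟨v, hv⟩ := by
  rw [Bit, encode_row 𝒢 l hv (by rw [length_rowBlocks]; omega), Option.some_inj,
    ← getElem?_bitVector (𝒢.graph.edge ⟨u, hu⟩) hv]
  simp [rowBlocks, hu]

theorem bit_obj {j v : ℕ} (hj : j < l.length) (hv : v < n) :
    Bit (encode 𝒢 l) (2 * n + 3 + 𝒢.agents.bits.length + (n + j) * (n + 1) + v) ↔
      ⟨v, hv⟩ ∈ l[j] := by
  rw [Bit, encode_row 𝒢 l hv (by rw [length_rowBlocks]; omega), Option.some_inj,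
    ← getElem?_bitVector (· ∈ l[j]) hv]
  simp [rowBlocks]

theorem isInput_encode : IsInput (encode 𝒢 l) n l.length 𝒢.agents.bits.length where
  frame := isFrame_encode 𝒢 l
  init := ⟨𝒢.graph.init, 𝒢.graph.init.2, (bit_init 𝒢 l 𝒢.graph.init.2).2 rfl, fun u hu h =>
    congrArg Fin.val ((bit_init 𝒢 l hu).1 h)⟩
  total u hu := by
    obtain ⟨v, hv⟩ := 𝒢.graph.total ⟨u, hu⟩
    exact ⟨v, v.2, (bit_edge 𝒢 l hu v.2).2 hv⟩
  lead := by
    rcases Nat.eq_zero_or_pos 𝒢.agents.bits.length with h | h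
    · exact Or.inl h
    · right
      rw [show 2 * n + 1 + 𝒢.agents.bits.length = 2 * n + 2 + (𝒢.agents.bits.length - 1) by omega,
        bit_agents 𝒢 l (by omega), ← List.getLast?_eq_getElem?]
      have := getLast?_bits 𝒢.agents
      rcases hx : 𝒢.agents.bits.getLast? with _ | x
      · rw [List.getLast?_eq_none_iff] at hx
        simp [hx] at h
      · rw [this x (by simp [hx])]

/-- The board of the word for a game describes the game. -/
theorem represents_encode :
    Board.Represents (boardOf (encode 𝒢 l) n 𝒢.agents.bits.length) 𝒢.graph
      fun j => {v : Fin n | (boardOf (encode 𝒢 l) n 𝒢.agents.bits.length).obj j v} where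
  own_iff v := bit_own 𝒢 l v.2
  edge_iff u v := bit_edge 𝒢 l u.2 v.2
  obj_iff _ _ := Iff.rfl

/-- Each word of the right form encodes a game. -/
theorem IsInput.exists_encode {w : List (Option Bool)} {m ℓ : ℕ} (h : IsInput w n m ℓ) :
    ∃ (𝒢 : CoverageGame (Fin n)) (l : List (Set (Fin n))), {α | α ∈ l} = 𝒢.objectives ∧
      w = encode 𝒢 l ∧ l.length = m ∧ 𝒢.agents.bits.length = ℓ := by
  classical
  obtain ⟨v₀, hv₀, hb₀, huniq⟩ := h.init
  obtain ⟨k, hk⟩ := exists_bits_eq (List.ofFn fun i : Fin ℓ => decide (Bit w (2 * n + 2 + i))) (by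
    intro x hx
    rcases h.lead with h0 | h0
    · subst h0
      simp at hx
    · rw [List.getLast?_eq_getElem?] at hx
      rcases Nat.eq_zero_or_pos ℓ with h1 | h1
      · subst h1
        simp at hx
      · rw [List.length_ofFn, List.getElem?_ofFn, dif_pos (by omega)] at hx
        rw [show 2 * n + 1 + ℓ = 2 * n + 2 + (ℓ - 1) by omega] at h0
        simpa [h0] using hx.symm)
  set l : List (Set (Fin n)) := List.ofFn fun j : Fin m => {v | (boardOf w n ℓ).obj j v} with hl
  set 𝒢 : CoverageGame (Fin n) :=
    { graph :=
        { owner := fun v => if Bit w v then .one else .two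
          init := ⟨v₀, hv₀⟩
          edge := fun u v => (boardOf w n ℓ).edge u v
          total := fun u => by
            obtain ⟨v, hv, hE⟩ := h.total u u.2
            exact ⟨⟨v, hv⟩, hE⟩ }
      agents := k
      objectives := {α | α ∈ l} } with h𝒢
  have hm : l.length = m := by simp [hl]
  have hℓ : 𝒢.agents.bits.length = ℓ := by
    change k.bits.length = ℓ
    simp [hk]
  refine ⟨𝒢, l, rfl, ?_, hm, hℓ⟩
  have hfr := isFrame_encode 𝒢 l
  rw [hm, hℓ] at hfr
  refine h.frame.ext hfr (fun x hx => ?_) (fun x hx => ?_) (fun x hx => ?_) fun c hc x hx => ?_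
  · rw [bit_own 𝒢 l hx]
    by_cases hb : Bit w x <;> simp [h𝒢, hb]
  · rw [bit_init 𝒢 l hx]
    constructor
    · exact fun hb => Fin.ext (huniq x hx hb)
    · intro he
      obtain rfl : x = v₀ := congrArg Fin.val he
      exact hb₀
  · rw [bit_agents 𝒢 l (by rwa [hℓ])]
    change _ ↔ k.bits[x]? = some true
    rw [hk, List.getElem?_ofFn, dif_pos hx]
    simp
  · rw [← hℓ]
    rcases Nat.lt_or_ge c n with hcn | hcn
    · rw [bit_edge 𝒢 l hcn hx, hℓ]
      rfl
    · obtain ⟨j, rfl⟩ : ∃ j, c = n + j := ⟨c - n, by omega⟩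
      rw [bit_obj 𝒢 l (by rw [hm]; omega) hx, hℓ]
      simp only [hl, List.getElem_ofFn]
      rfl

end Encode

/-! ### The coverage problem as a game on records -/

section Start

variable (γ : ObjectiveType) (w : List (Option Bool))

/-- The number `κ` does not exceed the number of agents in the word: no number below `κ` has the
same bits as that number. If `κ ≤ w.length`, then the bits from `w.length` on are zero for both. -/
def Enough (n ℓ κ : ℕ) : Prop :=
  ¬ ∃ x < κ, ∀ i < w.length, (i < ℓ ∧ Bit w (2 * n + 2 + i)) ↔ x / 2 ^ i % 2 = 1

/-- The rules for Coverer in the first round. She describes the input by the numbers of vertices,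
objectives, and bits of the number of agents, and chooses the number of agents to use. -/
def CoverStart (c : ℕ → ℕ) : Prop :=
  IsInput w (c 0) (c 1) (c 3) ∧ (c 1 = 0 ∨ (0 < c 2 ∧ Enough w (c 0) (c 3) (c 2)))

/-- The rules for Disruptor in the first round. He loses if there are no objectives, and otherwise
he sets up the initial position, where he chooses the first target. -/
def DisruptStart (C : ℕ) (s : ℕ → ℕ) : Prop :=
  s 1 ≠ 0 ∧ s (C + 3) < s 0 ∧ Bit w (s 0 + 1 + s (C + 3)) ∧ s (C + 4) = s 2 ∧
    s (C + 5) + 1 = s 0 ∧ s (C + 7) = s 0 ∧ (∀ x < C, s (C + 8 + x) = 1 ↔ x < s 1) ∧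
    Focused γ C s

/-- The coverage game as a game on records. -/
def coverageRecords : RecordGame where
  C := w.length + 1
  p := w.length + 1 + 3
  q := w.length + 1 + 5
  startP := CoverStart w
  startD := DisruptStart γ w (w.length + 1)
  moveP z := CoverMove γ (w.length + 1) (boardOf w (z 0) (z 3))
  moveD z := DisruptMove γ (w.length + 1) (boardOf w (z 0) (z 3))
  C_pos := Nat.succ_pos _
  startP_congr c c' h := by
    simp only [CoverStart, h 0 (by omega), h 1 (by omega), h 2 (by omega), h 3 (by omega)]
    exact id
  startD_congr c c' h := by
    have hJ : ∀ x < w.length + 1, c (w.length + 1 + 8 + x) = c' (w.length + 1 + 8 + x) :=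
      fun x hx => h _ (by omega)
    have hF : Focused γ (w.length + 1) c ↔ Focused γ (w.length + 1) c' :=
      imp_congr_right fun _ => exists_congr fun x => and_congr_right fun hx => by
        rw [hJ x hx, h (w.length + 1 + 6) (by omega)]
    have h1 : ∀ m, (∀ x < w.length + 1, c (w.length + 1 + 8 + x) = 1 ↔ x < m) ↔
        ∀ x < w.length + 1, c' (w.length + 1 + 8 + x) = 1 ↔ x < m :=
      fun m => forall₂_congr fun x hx => by rw [hJ x hx]
    simp only [DisruptStart, hF, h1, h 0 (by omega), h 1 (by omega), h 2 (by omega),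
      h (w.length + 1 + 3) (by omega), h (w.length + 1 + 4) (by omega),
      h (w.length + 1 + 5) (by omega), h (w.length + 1 + 7) (by omega)]
    exact id
  moveP_congr z z' s s' c c' hz hs hc := by
    have hJ : ∀ x < w.length + 1, s (w.length + 1 + 8 + x) = s' (w.length + 1 + 8 + x) :=
      fun x hx => hs _ (by omega)
    have hH : ∀ B, Hit γ (w.length + 1) B s ↔ Hit γ (w.length + 1) B s' := fun B => by
      cases γ
      · simp only [Hit, hs (w.length + 1 + 3) (by omega), hs (w.length + 1 + 6) (by omega)]
      · simp only [Hit, hs (w.length + 1 + 3) (by omega)]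
        exact exists_congr fun x => and_congr_right fun hx => by rw [hJ x hx]
    simp only [CoverMove, hH, hz 0 (by omega), hz 3 (by omega), hc 0 (by omega), hc 1 (by omega),
      hc 2 (by omega), hs (w.length + 1 + 3) (by omega), hs (w.length + 1 + 4) (by omega),
      hs (w.length + 1 + 5) (by omega), hs (w.length + 1 + 7) (by omega)]
    exact id
  moveD_congr z z' s s' c c' hz hs hc := by
    have hJ : ∀ x < w.length + 1, s (w.length + 1 + 8 + x) = s' (w.length + 1 + 8 + x) :=
      fun x hx => hs _ (by omega)
    have hJ' : ∀ x < w.length + 1, c (w.length + 1 + 8 + x) = c' (w.length + 1 + 8 + x) :=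
      fun x hx => hc _ (by omega)
    have hX : ∀ x < w.length + 1, c (3 + x) = c' (3 + x) := fun x hx => hc _ (by omega)
    have hH : ∀ B, Hit γ (w.length + 1) B s ↔ Hit γ (w.length + 1) B s' := fun B => by
      cases γ
      · simp only [Hit, hs (w.length + 1 + 3) (by omega), hs (w.length + 1 + 6) (by omega)]
      · simp only [Hit, hs (w.length + 1 + 3) (by omega)]
        exact exists_congr fun x => and_congr_right fun hx => by rw [hJ x hx]
    have hF : Focused γ (w.length + 1) c ↔ Focused γ (w.length + 1) c' :=
      imp_congr_right fun _ => exists_congr fun x => and_congr_right fun hx => by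
        rw [hJ' x hx, hc (w.length + 1 + 6) (by omega)]
    have h1 : (∀ x < w.length + 1, c (w.length + 1 + 8 + x) = 1 ↔ s (w.length + 1 + 8 + x) = 1) ↔
        ∀ x < w.length + 1, c' (w.length + 1 + 8 + x) = 1 ↔ s' (w.length + 1 + 8 + x) = 1 :=
      forall₂_congr fun x hx => by rw [hJ x hx, hJ' x hx]
    have h2 : (∀ x < w.length + 1, c (w.length + 1 + 8 + x) = 1 ↔
        s (w.length + 1 + 8 + x) = 1 ∧ c (3 + x) = 1) ↔
        ∀ x < w.length + 1, c' (w.length + 1 + 8 + x) = 1 ↔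
          s' (w.length + 1 + 8 + x) = 1 ∧ c' (3 + x) = 1 :=
      forall₂_congr fun x hx => by rw [hJ x hx, hJ' x hx, hX x hx]
    have h3 : (∀ x < w.length + 1, c (w.length + 1 + 8 + x) = 1 ↔
        s (w.length + 1 + 8 + x) = 1 ∧ ¬ c (3 + x) = 1) ↔
        ∀ x < w.length + 1, c' (w.length + 1 + 8 + x) = 1 ↔
          s' (w.length + 1 + 8 + x) = 1 ∧ ¬ c' (3 + x) = 1 :=
      forall₂_congr fun x hx => by rw [hJ x hx, hJ' x hx, hX x hx]
    simp only [DisruptMove, hH, hF, h1, h2, h3, hz 0 (by omega), hz 3 (by omega), hc 0 (by omega),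
      hc 1 (by omega), hc 2 (by omega), hs (w.length + 1 + 3) (by omega),
      hs (w.length + 1 + 4) (by omega), hs (w.length + 1 + 5) (by omega),
      hs (w.length + 1 + 6) (by omega), hs (w.length + 1 + 7) (by omega),
      hc (w.length + 1 + 3) (by omega), hc (w.length + 1 + 4) (by omega),
      hc (w.length + 1 + 5) (by omega), hc (w.length + 1 + 6) (by omega),
      hc (w.length + 1 + 7) (by omega)]
    exact id

end Start

section Winner

variable {γ : ObjectiveType} {n : ℕ} {𝒢 : CoverageGame (Fin n)} {l : List (Set (Fin n))}

/-- The game does not depend on the description of the input, as long as the numbers of vertices and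
of bits are the same. -/
theorem wins_coverageRecords_congr {w : List (Option Bool)} {z z' : ℕ → ℕ} (h0 : z 0 = z' 0)
    (h3 : z 3 = z' 3) (f : ℕ) (s : ℕ → ℕ) :
    (coverageRecords γ w).Wins z f s ↔ (coverageRecords γ w).Wins z' f s := by
  induction f generalizing s with
  | zero => exact Iff.rfl
  | succ f ih =>
    have hP : (coverageRecords γ w).moveP z = (coverageRecords γ w).moveP z' := by
      simp only [coverageRecords, h0, h3]
    have hD : (coverageRecords γ w).moveD z = (coverageRecords γ w).moveD z' := by
      simp only [coverageRecords, h0, h3]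
    simp only [RecordGame.Wins, hP, hD, ih]

theorem covererWins_iff {α : ℕ → Set (Fin n)} (hl : {α | α ∈ l} = 𝒢.objectives)
    (hα : ∀ j (hj : j < l.length), α j = l[j]) :
    CovererWins γ 𝒢 ↔ 𝒢.graph.init ∈ Covered γ 𝒢.graph α 𝒢.agents {j | j < l.length} := by
  refine exists_congr fun F => forall_congr' fun f₂ => ?_
  have h1 : Covers γ 𝒢 F f₂ ↔ ∀ A ∈ l, ∃ i, Satisfies γ (outcome (F i) f₂) A := by
    rw [Covers, ← hl, Set.ext_iff]
    simp only [Set.mem_iUnion, sat, Set.mem_ofPred_eq]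
    refine forall_congr' fun A => ⟨fun h hA => ?_, fun h => ⟨fun ⟨i, hi⟩ => hi.1, fun hA => ?_⟩⟩
    · obtain ⟨i, hi⟩ := h.2 hA
      exact ⟨i, hi.2⟩
    · obtain ⟨i, hi⟩ := h hA
      exact ⟨i, hA, hi⟩
  rw [h1]
  simp only [outcome_eq_play]
  constructor
  · intro h j hj
    rw [hα j hj]
    exact h _ (List.getElem_mem hj)
  · intro h A hA
    obtain ⟨j, hj, rfl⟩ := List.getElem_of_mem hA
    rw [← hα j hj]
    exact h j hj

theorem not_mem_covered_zero {V : Type*} {G : GameGraph V} {α : ℕ → Set V} {J : Set ℕ} {j : ℕ}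
    (hj : j ∈ J) (v : V) : v ∉ Covered γ G α 0 J := by
  rintro ⟨F, hF⟩
  obtain ⟨i, -⟩ := hF (aim fun _ _ => Set.univ) j hj
  exact i.elim0

theorem enough_encode {κ : ℕ} (hκ : κ ≤ (encode 𝒢 l).length) :
    Enough (encode 𝒢 l) n 𝒢.agents.bits.length κ ↔ κ ≤ 𝒢.agents := by
  have hbit : ∀ i, (i < 𝒢.agents.bits.length ∧ Bit (encode 𝒢 l) (2 * n + 2 + i)) ↔
      𝒢.agents.testBit i = true := fun i => by
    rw [testBit_iff_getElem?_bits]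
    constructor
    · exact fun h => (bit_agents 𝒢 l h.1).1 h.2
    · intro h
      have hi := (List.getElem?_eq_some_iff.1 h).1
      exact ⟨hi, (bit_agents 𝒢 l hi).2 h⟩
  have hlen : 𝒢.agents.bits.length ≤ (encode 𝒢 l).length := by
    rw [(isFrame_encode 𝒢 l).length_eq]
    omega
  have htest : ∀ x i : ℕ, x / 2 ^ i % 2 = 1 ↔ x.testBit i = true := fun x i => by
    rw [Nat.testBit_eq_decide_div_mod_eq, decide_eq_true_iff]
  simp only [Enough, hbit, htest]
  rw [← not_lt, not_iff_not]
  constructor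
  -- Beyond the length of the word, the bits of both numbers vanish.
  · rintro ⟨x, hx, h⟩
    suffices 𝒢.agents = x by omega
    refine Nat.eq_of_testBit_eq fun i => ?_
    rcases Nat.lt_or_ge i (encode 𝒢 l).length with hi | hi
    · exact Bool.eq_iff_iff.2 (h i hi)
    · have h1 : 𝒢.agents.testBit i = false := by
        rw [Bool.eq_false_iff, Ne, testBit_iff_getElem?_bits, List.getElem?_eq_none (by omega)]
        simp
      rw [h1, Nat.testBit_lt_two_pow]
      exact lt_of_lt_of_le (by omega) (Nat.lt_two_pow_self (n := i)).le
  · exact fun h => ⟨𝒢.agents, h, fun i _ => Iff.rfl⟩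

/-- The game on records after Coverer has described the input. -/
theorem forall_start_iff {c : ℕ → ℕ} {𝒢 : CoverageGame (Fin (c 0))} {l : List (Set (Fin (c 0)))}
    {w : List (Option Bool)} (hw : w = encode 𝒢 l) (h1 : c 1 = l.length)
    (h3 : c 3 = 𝒢.agents.bits.length) (hc : ∀ k, c k < w.length + 1) (h2 : 0 < c 2)
    (hl : l ≠ []) :
    (∀ s : ℕ → ℕ, (∀ k < w.length + 1 + 3, s k = c k) → (∀ k, s k < w.length + 1) →
      DisruptStart γ w (w.length + 1) s →
      (coverageRecords γ w).Wins s ((w.length + 1) ^ 3) s) ↔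
    𝒢.graph.init ∈ Covered γ 𝒢.graph (fun j => {v | (boardOf w (c 0) (c 3)).obj j v}) (c 2)
      {j | j < l.length} := by
  have hB : Board.Represents (boardOf w (c 0) (c 3)) 𝒢.graph
      fun j => {v | (boardOf w (c 0) (c 3)).obj j v} := by
    rw [h3, hw]
    exact represents_encode 𝒢 l
  have hn := hc 0
  have hn0 : 0 < c 0 := 𝒢.graph.init.pos
  have h2C := hc 2
  have hm := hc 1
  rw [h1] at hm
  -- The cube of the range of the numbers bounds the number of rounds from each initial position.
  have hbound : c 2 * (c 0 + 1) ^ 2 + (c 0 - 1) * (c 0 + 1) + c 0 < (w.length + 1) ^ 3 := by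
    obtain ⟨k, hk⟩ : ∃ k, c 0 = k + 1 := ⟨c 0 - 1, by omega⟩
    have e1 : (c 0 - 1) * (c 0 + 1) + c 0 < (c 0 + 1) ^ 2 := by
      rw [hk, Nat.add_sub_cancel]
      nlinarith
    calc c 2 * (c 0 + 1) ^ 2 + (c 0 - 1) * (c 0 + 1) + c 0
        < c 2 * (c 0 + 1) ^ 2 + (c 0 + 1) ^ 2 := by omega
      _ = (c 2 + 1) * (c 0 + 1) ^ 2 := by ring
      _ ≤ (w.length + 1) * (w.length + 1) ^ 2 :=
        Nat.mul_le_mul (by omega) (Nat.pow_le_pow_left (by omega) 2)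
      _ = (w.length + 1) ^ 3 := by ring
  have hfresh := forall_fresh_iff (R := coverageRecords γ w) (z := c) (γ := γ) (G := 𝒢.graph)
    (B := boardOf w (c 0) (c 3)) (f := (w.length + 1) ^ 3) rfl hn
    (fun s v hs g3 g4 g5 g7 hf => wins_iff_mem_region (R := coverageRecords γ w) hB rfl hn
      (fun _ _ => Iff.rfl) (fun _ _ => Iff.rfl) _ s v hs g3 g4 g5 g7 hf)
    hc 𝒢.graph.init h2 h2C (show c 0 - 1 < c 0 by omega) (J := {j | j < l.length})
    (fun x hx => lt_trans hx hm) hbound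
  rw [show c 0 - 1 + 1 = c 0 by omega] at hfresh
  rw [covered_eq_single h2, single_eq_outer, Fintype.card_fin]
  refine Iff.trans ?_ hfresh
  have hinit : ∀ x, (x < c 0 ∧ Bit w (c 0 + 1 + x)) ↔ x = 𝒢.graph.init := fun x => by
    rw [hw]
    constructor
    · exact fun h => congrArg Fin.val ((bit_init 𝒢 l h.1).1 h.2)
    · rintro rfl
      exact ⟨Fin.is_lt _, (bit_init 𝒢 l (Fin.is_lt _)).2 rfl⟩
  constructor
  · intro h s g1 g2 g3 g4 g5 g7 g8 g9
    have e0 := g1 0 (Nat.succ_pos _)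
    have e1 := g1 1 (by simp [coverageRecords])
    have e2 := g1 2 (by simp [coverageRecords])
    have e3 := g1 3 (by simp [coverageRecords])
    rw [← wins_coverageRecords_congr e0 e3]
    refine h s g1 g2 ⟨?_, ?_⟩
    · rw [e1, h1]
      simpa using hl
    · rw [e0, e1, e2, ← and_assoc, hinit]
      exact ⟨g3, g4, by have := g5; dsimp only [coverageRecords] at this; omega, g7,
        fun x hx => by rw [h1]; exact g8 x hx, g9⟩
  · rintro h s g1 g2 ⟨-, g⟩
    have e0 := g1 0 (by omega)
    have e1 := g1 1 (by omega)
    have e2 := g1 2 (by omega)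
    have e3 := g1 3 (by omega)
    rw [e0, e1, e2, ← and_assoc, hinit] at g
    obtain ⟨g3, g4, g5, g7, g8, g9⟩ := g
    rw [wins_coverageRecords_congr e0 e3]
    exact h s g1 g2 g3 g4 (by dsimp only [coverageRecords]; omega) g7
      (fun x hx => (g8 x hx).trans (by rw [h1]; rfl)) g9

/-- A word belongs to the coverage problem if and only if Coverer wins the game on records. -/
theorem mem_coverageProblem_iff (w : List (Option Bool)) :
    w ∈ coverageProblem γ ↔ Alt (w.length + 1)
      (fun i => i % ((w.length + 1 + 3) + (w.length + 1 + 5)) < w.length + 1 + 3)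
      (FirstOffence (coverageRecords γ w).RuleP (coverageRecords γ w).RuleD
        ((w.length + 1) ^ 3 + 1))
      (((w.length + 1) ^ 3 + 1) * ((w.length + 1 + 3) + (w.length + 1 + 5))) [] := by
  refine Iff.trans ?_ (RecordGame.alt_iff_wins (R := coverageRecords γ w) _).symm
  change _ ↔ ∃ c : ℕ → ℕ, (∀ k, c k < w.length + 1) ∧ CoverStart w c ∧
    ∀ s : ℕ → ℕ, (∀ k < w.length + 1 + 3, s k = c k) → (∀ k, s k < w.length + 1) →
      DisruptStart γ w (w.length + 1) s → (coverageRecords γ w).Wins s ((w.length + 1) ^ 3) s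
  -- The number of agents to use.
  have hagents : ∀ {n : ℕ} (𝒢 : CoverageGame (Fin n)) (l : List (Set (Fin n))),
      {α | α ∈ l} = 𝒢.objectives → w = encode 𝒢 l → l ≠ [] →
      (CovererWins γ 𝒢 ↔ ∃ κ, 0 < κ ∧ κ ≤ 𝒢.agents ∧ κ ≤ w.length ∧
        𝒢.graph.init ∈ Covered γ 𝒢.graph
          (fun j => {v | (boardOf w n 𝒢.agents.bits.length).obj j v}) κ {j | j < l.length}) := by
    intro n 𝒢 l hobj hw hl
    have hpos := List.length_pos_iff.2 hl
    have hlen := (isFrame_encode 𝒢 l).length_eq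
    rw [← hw] at hlen
    have hle : l.length ≤ w.length := by
      have := Nat.le_mul_of_pos_right (n + l.length) (show 0 < n + 1 by omega)
      omega
    rw [covererWins_iff (α := fun j => {v | (boardOf w n 𝒢.agents.bits.length).obj j v}) hobj
      fun j hj => by
        ext v
        rw [hw]
        exact bit_obj 𝒢 l hj v.2]
    rcases Nat.eq_zero_or_pos 𝒢.agents with h0 | h0
    · rw [h0]
      refine iff_of_false (not_mem_covered_zero (j := 0) hpos _) ?_
      rintro ⟨κ, h1, h2, -⟩
      omega
    · exact covered_iff_exists_le h0 (show 0 < w.length by omega)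
        (fun j hj => lt_of_lt_of_le hj hle) _
  constructor
  · rintro ⟨n, 𝒢, l, hobj, hw, hwin⟩
    have hin := isInput_encode 𝒢 l
    rw [← hw] at hin
    have hlen := hin.frame.length_eq
    have hle := Nat.le_mul_of_pos_right (n + l.length) (show 0 < n + 1 by omega)
    have hcell : ∀ κ ≤ w.length, ∀ k, (fun k => if k = 0 then n else if k = 1 then l.length else
        if k = 2 then κ else if k = 3 then 𝒢.agents.bits.length else 0 : ℕ → ℕ) k <
          w.length + 1 := fun κ hκ k => by
      dsimp only
      split_ifs <;> omega
    rcases eq_or_ne l [] with hl | hl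
    · refine ⟨_, hcell 0 (Nat.zero_le _), ⟨hin, Or.inl (by simp [hl])⟩, ?_⟩
      rintro s hs - ⟨h, -⟩
      refine absurd ((hs 1 (by omega)).trans ?_) h
      simp [hl]
    · obtain ⟨κ, h0, h1, h2, h⟩ := (hagents 𝒢 l hobj hw hl).1 hwin
      refine ⟨_, hcell κ h2, ⟨hin, Or.inr ⟨h0, ?_⟩⟩, ?_⟩
      · subst hw
        exact (enough_encode h2).2 h1
      · exact (forall_start_iff (c := fun k => if k = 0 then n else if k = 1 then l.length else
          if k = 2 then κ else if k = 3 then 𝒢.agents.bits.length else 0) hw rfl rfl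
          (hcell κ h2) h0 hl).2 h
  · rintro ⟨c, hc, ⟨hin, hstart⟩, h⟩
    obtain ⟨𝒢, l, hobj, hw, hm, hℓ⟩ := hin.exists_encode
    refine ⟨c 0, 𝒢, l, hobj, hw, ?_⟩
    rcases eq_or_ne l [] with hl | hl
    · refine (covererWins_iff (α := fun _ => ∅) hobj (by simp [hl])).2 ?_
      exact ⟨fun _ => aim fun _ _ => Set.univ, fun _ j hj => absurd hj (by simp [hl])⟩
    · have hm0 : c 1 ≠ 0 := by
        rw [← hm]
        simpa using hl
      obtain ⟨h0, h1⟩ := hstart.resolve_left hm0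
      refine (hagents 𝒢 l hobj hw hl).2 ⟨c 2, h0, ?_, Nat.lt_succ_iff.1 (hc 2), ?_⟩
      · rw [← hℓ, hw] at h1
        refine (enough_encode ?_).1 h1
        rw [← hw]
        exact Nat.lt_succ_iff.1 (hc 2)
      · rw [hℓ]
        exact (forall_start_iff hw hm.symm hℓ.symm hc h0 hl).1 h

end Winner

/-! ### The rules as formulas -/

namespace Fml

/-- Disjunction. -/
def disj (φ ψ : Fml) : Fml := neg (conj (neg φ) (neg ψ))

/-- Implication. -/
def impl (φ ψ : Fml) : Fml := neg (conj φ (neg ψ))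

/-- Equivalence. -/
def equiv (φ ψ : Fml) : Fml := conj (impl φ ψ) (impl ψ φ)

/-- Equality of numbers. -/
def eq (t u : Tm) : Fml := conj (neg (lt t u)) (neg (lt u t))

/-- The universal quantifier over the numbers below `t`. -/
def all (t : Tm) (φ : Fml) : Fml := neg (ex t (neg φ))

/-- The formula with the truth value `b`. -/
def const (b : Bool) : Fml := lt (.const 0) (.const b.toNat)

variable {w : List Sym} {a : List ℕ} {d : ℕ} {e : ℕ → ℕ} {φ ψ : Fml} {t u : Tm}

theorem eval_disj : (disj φ ψ).eval w a d e ↔ φ.eval w a d e ∨ ψ.eval w a d e := by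
  simp only [disj, eval]
  tauto

theorem eval_impl : (impl φ ψ).eval w a d e ↔ (φ.eval w a d e → ψ.eval w a d e) := by
  simp only [impl, eval]
  tauto

theorem eval_equiv : (equiv φ ψ).eval w a d e ↔ (φ.eval w a d e ↔ ψ.eval w a d e) := by
  simp only [equiv, eval, eval_impl]
  tauto

theorem eval_eq : (eq t u).eval w a d e ↔ t.eval a e = u.eval a e := by
  simp only [eq, eval]
  omega

theorem eval_all : (all t φ).eval w a d e ↔
    ∀ x < t.eval a e, φ.eval w a (d + 1) (Function.update e d x) := by
  simp only [all, eval, not_exists, not_and, not_not]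

theorem eval_const {b : Bool} : (const b).eval w a d e ↔ b = true := by
  cases b <;> simp [const, eval, Tm.eval]

end Fml

/-! In the formulas for the rules, variable `0` is the length `L` of the input, variable `3` is the
number of the current round, and variable `4` is the number of the preceding round. -/

namespace RuleFml

/-- The bound `L + 1` on the numbers in a record. -/
def bound : Tm := .add (.var 0) (.const 1)

/-- The term `L + 1 + k`. -/
def field (k : ℕ) : Tm := .add bound (.const k)

/-- Cell `k` in the record of round `r`. -/
def cell (r k : Tm) : Tm := .arr (.add (.mul r (.add (field 3) (field 5))) k)

/-- The field `k` in the record of the preceding round. -/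
def old (k : ℕ) : Tm := cell (.var 4) (field k)

/-- The field `k` in the record of the current round. -/
def new (k : ℕ) : Tm := cell (.var 3) (field k)

/-- Cell `k` in the record of the current round. -/
def cur (k : ℕ) : Tm := cell (.var 3) (.const k)

/-- The term `2 * t + k`. -/
def double (t : Tm) (k : ℕ) : Tm := .add (.mul (.const 2) t) (.const k)

/-- The number of vertices. -/
def verts : Tm := cell (.const 0) (.const 0)

/-- Bit `v` in the vector with number `c` behind the number of agents. -/
def rowBit (c v : Tm) : Fml :=
  .inp (.add (.add (.add (double verts 3) (cell (.const 0) (.const 3)))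
    (.mul c (.add verts (.const 1)))) v) (some true)

/-- Expresses `Hit`. -/
def hit : ObjectiveType → Fml
  | .buchi => rowBit (.add verts (old 6)) (old 3)
  | .coBuchi => .ex bound (.conj (.eq (cell (.var 4) (.add (field 8) (.var 5))) (.const 1))
      (rowBit (.add verts (.var 5)) (old 3)))

/-- Expresses `Focused`. -/
def focused : ObjectiveType → Fml
  | .buchi => .ex bound (.conj (.eq (new 6) (.var 5))
      (.eq (cell (.var 3) (.add (field 8) (.var 5))) (.const 1)))
  | .coBuchi => .const true

/-- Expresses that `γ` is the type of Büchi objectives. -/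
def isBuchi : ObjectiveType → Fml
  | .buchi => .const true
  | .coBuchi => .const false

/-- Expresses `CoverMove`. -/
def coverMove (γ : ObjectiveType) : Fml :=
  .conj (.impl (.eq (old 7) (.const 0)) (.neg (isBuchi γ))) (.impl (.neg (.eq (old 7) (.const 0)))
    (.conj
      (.impl (.neg (.eq (cur 0) (.const 0))) (.conj (.lt (.const 0) (cur 2)) (.lt (cur 2) (old 4))))
      (.impl (.eq (cur 0) (.const 0)) (.conj
        (.impl (.inp (old 3) (some true)) (.conj (.lt (cur 1) verts) (rowBit (old 3) (cur 1))))
        (.impl (hit γ) (.impl (.eq (old 5) (.const 0)) (isBuchi γ)))))))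

/-- Expresses that the objective `x` of variable `5` is open in the preceding round. -/
def oldOpen : Fml := .eq (cell (.var 4) (.add (field 8) (.var 5))) (.const 1)

/-- Expresses that the objective `x` of variable `5` is open in the current round. -/
def newOpen : Fml := .eq (cell (.var 3) (.add (field 8) (.var 5))) (.const 1)

/-- Expresses that the objective `x` of variable `5` is chosen for the first group. -/
def chosen : Fml := .eq (cell (.var 3) (.add (.const 3) (.var 5))) (.const 1)

/-- Expresses `DisruptMove`. -/
def disruptMove (γ : ObjectiveType) : Fml :=
  .conj (.neg (.eq (old 7) (.const 0))) (.conj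
    (.impl (.neg (.eq (cur 0) (.const 0))) (.conj (.eq (new 3) (old 3)) (.conj
      (.eq (.add (new 5) (.const 1)) verts) (.conj (.eq (new 7) verts) (.conj (focused γ)
        (.disj
          (.conj (.eq (new 4) (cur 2)) (.all bound (.equiv newOpen (.conj oldOpen chosen))))
          (.conj (.eq (.add (new 4) (cur 2)) (old 4))
            (.all bound (.equiv newOpen (.conj oldOpen (.neg chosen)))))))))))
    (.impl (.eq (cur 0) (.const 0)) (.conj (.lt (new 3) verts) (.conj
      (rowBit (old 3) (new 3)) (.conj
      (.impl (.inp (old 3) (some true)) (.eq (new 3) (cur 1))) (.conj (.eq (new 4) (old 4)) (.conj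
        (.all bound (.equiv newOpen oldOpen)) (.conj
          (.impl (hit γ) (.conj (.eq (.add (new 5) (.const 1)) (old 5))
            (.conj (.eq (new 7) verts) (focused γ))))
          (.impl (.neg (hit γ)) (.conj (.eq (new 5) (old 5)) (.conj (.eq (new 6) (old 6))
            (.eq (.add (new 7) (.const 1)) (old 7)))))))))))))

/-- Expresses that the bit of variable `6` in the number of agents is set. -/
def agentsBit : Fml :=
  .conj (.lt (.var 6) (cur 3)) (.inp (.add (double (cur 0) 2) (.var 6)) (some true))

/-- Expresses `Enough`. Variable `5` is the number to be compared, whose bit `i` is set if the shift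
by `i` yields an odd number. -/
def enough : Fml :=
  .neg (.ex (cur 2) (.all (.var 0) (.equiv agentsBit
    (.ex (.add (.var 5) (.const 1)) (.eq (.shr (.var 5) (.var 6)) (double (.var 7) 1))))))

/-- The position of the first row. -/
def rows : Tm := .add (double (cur 0) 3) (cur 3)

/-- Expresses `IsFrame`. -/
def frame : Fml :=
  .conj (.eq (.var 0) (.add rows (.mul (.add (cur 0) (cur 1)) (.add (cur 0) (.const 1))))) (.conj
    (.all (cur 0) (.neg (.inp (.var 5) none))) (.conj (.inp (cur 0) none) (.conj
    (.all (cur 0) (.neg (.inp (.add (.add (cur 0) (.const 1)) (.var 5)) none))) (.conj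
    (.inp (double (cur 0) 1) none) (.conj
    (.all (cur 3) (.neg (.inp (.add (double (cur 0) 2) (.var 5)) none))) (.conj
    (.inp (.add (double (cur 0) 2) (cur 3)) none) (.conj
    (.all (.add (cur 0) (cur 1))
      (.inp (.add (.add rows (.mul (.var 5) (.add (cur 0) (.const 1)))) (cur 0)) none))
    (.all (.add (cur 0) (cur 1)) (.all (cur 0) (.neg
      (.inp (.add (.add rows (.mul (.var 5) (.add (cur 0) (.const 1)))) (.var 6)) none)))))))))))

/-- Expresses `IsInput`. -/
def input : Fml :=
  .conj frame (.conj
    (.ex (cur 0) (.conj (.inp (.add (.add (cur 0) (.const 1)) (.var 5)) (some true))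
      (.all (cur 0) (.impl (.inp (.add (.add (cur 0) (.const 1)) (.var 6)) (some true))
        (.eq (.var 6) (.var 5)))))) (.conj
    (.all (cur 0) (.ex (cur 0)
      (.inp (.add (.add rows (.mul (.var 5) (.add (cur 0) (.const 1)))) (.var 6)) (some true))))
    (.disj (.eq (cur 3) (.const 0)) (.inp (.add (double (cur 0) 1) (cur 3)) (some true)))))

/-- Expresses `CoverStart`. -/
def coverStart : Fml :=
  .conj input (.disj (.eq (cur 1) (.const 0)) (.conj (.lt (.const 0) (cur 2)) enough))

/-- Expresses `DisruptStart`. -/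
def disruptStart (γ : ObjectiveType) : Fml :=
  .conj (.neg (.eq (cur 1) (.const 0))) (.conj (.lt (new 3) (cur 0)) (.conj
    (.inp (.add (.add (cur 0) (.const 1)) (new 3)) (some true)) (.conj (.eq (new 4) (cur 2)) (.conj
    (.eq (.add (new 5) (.const 1)) (cur 0)) (.conj (.eq (new 7) (cur 0)) (.conj
    (.all bound (.equiv newOpen (.lt (.var 5) (cur 1)))) (focused γ)))))))

/-- Combines the rules for the first round and for the other rounds. In the first round,
variable `4` is irrelevant. -/
def rule (start move : Fml) : Fml :=
  .ex (.add (.var 3) (.const 1)) (.disj (.conj (.eq (.var 3) (.const 0)) start)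
    (.conj (.eq (.var 3) (.add (.var 4) (.const 1))) move))

/-- The number of rounds. -/
def rounds : Tm := .add (.mul bound (.mul bound bound)) (.const 1)

/-- Expresses `FirstOffence`. -/
def firstOffence (γ : ObjectiveType) : Fml :=
  .ex rounds (.all (.add (.var 2) (.const 1)) (.conj (rule coverStart (coverMove γ))
    (.equiv (rule (disruptStart γ) (disruptMove γ)) (.lt (.var 3) (.var 2)))))

/-- Expresses that the next number belongs to Coverer, where variable `1` is the number of numbers
so far. -/
def covererTurn : Fml :=
  .ex (.add (.var 1) (.const 1)) (.ex (field 3)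
    (.eq (.var 1) (.add (.mul (.var 2) (.add (field 3) (field 5))) (.var 3))))

variable {w : List Sym} {a : List ℕ} {d : ℕ} {e : ℕ → ℕ}

theorem eval_cell (r k : Tm) : (cell r k).eval a e =
    record (e 0 + 1 + 3 + (e 0 + 1 + 5)) a (r.eval a e) (k.eval a e) := rfl

theorem eval_field (k : ℕ) : (field k).eval a e = e 0 + 1 + k := rfl

theorem eval_double (t : Tm) (k : ℕ) : (double t k).eval a e = 2 * t.eval a e + k := rfl

theorem eval_hit (γ : ObjectiveType) (h0 : e 0 = w.length) :
    (hit γ).eval w a 5 e ↔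
      Hit γ (w.length + 1) (boardOf w
        (record (w.length + 1 + 3 + (w.length + 1 + 5)) a 0 0)
        (record (w.length + 1 + 3 + (w.length + 1 + 5)) a 0 3))
      (record (w.length + 1 + 3 + (w.length + 1 + 5)) a (e 4)) := by
  cases γ
  · simp only [hit, rowBit, verts, old, Fml.eval, Tm.eval, eval_cell, eval_field, eval_double, h0]
    rfl
  · simp only [hit, rowBit, verts, old, bound, Fml.eval, Fml.eval_eq, Tm.eval, eval_cell,
      eval_field, eval_double, Function.update_self,
      Function.update_of_ne (show (0 : ℕ) ≠ 5 by decide),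
      Function.update_of_ne (show (4 : ℕ) ≠ 5 by decide), h0]
    rfl

theorem eval_focused (γ : ObjectiveType) (h0 : e 0 = w.length) :
    (focused γ).eval w a 5 e ↔
      Focused γ (w.length + 1) (record (w.length + 1 + 3 + (w.length + 1 + 5)) a (e 3)) := by
  cases γ
  · simp only [focused, new, bound, Fml.eval, Fml.eval_eq, Tm.eval, eval_cell, eval_field,
      Function.update_self, Function.update_of_ne (show (0 : ℕ) ≠ 5 by decide),
      Function.update_of_ne (show (3 : ℕ) ≠ 5 by decide), h0, Focused, true_implies]
  · simp [focused, Fml.eval_const, Focused]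

theorem eval_isBuchi (γ : ObjectiveType) : (isBuchi γ).eval w a d e ↔ γ = .buchi := by
  cases γ <;> simp [isBuchi, Fml.eval_const]

theorem eval_coverMove (γ : ObjectiveType) (h0 : e 0 = w.length) :
    (coverMove γ).eval w a 5 e ↔ (coverageRecords γ w).moveP
      (record (w.length + 1 + 3 + (w.length + 1 + 5)) a 0)
      (record (w.length + 1 + 3 + (w.length + 1 + 5)) a (e 4))
      (record (w.length + 1 + 3 + (w.length + 1 + 5)) a (e 3)) := by
  have hγ : γ ≠ .buchi ↔ γ = .coBuchi := by cases γ <;> simp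
  simp only [coverMove, rowBit, verts, old, cur, Fml.eval, Fml.eval_impl, Fml.eval_eq, Tm.eval,
    eval_cell, eval_field, eval_double, eval_isBuchi, eval_hit γ h0, h0, ← ne_eq, hγ]
  rfl

theorem eval_disruptMove (γ : ObjectiveType) (h0 : e 0 = w.length) :
    (disruptMove γ).eval w a 5 e ↔ (coverageRecords γ w).moveD
      (record (w.length + 1 + 3 + (w.length + 1 + 5)) a 0)
      (record (w.length + 1 + 3 + (w.length + 1 + 5)) a (e 4))
      (record (w.length + 1 + 3 + (w.length + 1 + 5)) a (e 3)) := by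
  simp only [disruptMove, newOpen, oldOpen, chosen, bound, rowBit, verts, old, new, cur, Fml.eval,
    Fml.eval_impl, Fml.eval_disj, Fml.eval_all, Fml.eval_equiv, Fml.eval_eq, Tm.eval,
    eval_cell, eval_field, eval_double, eval_hit γ h0, eval_focused γ h0, h0,
    Function.update_self, Function.update_of_ne (show (0 : ℕ) ≠ 5 by decide),
    Function.update_of_ne (show (3 : ℕ) ≠ 5 by decide),
    Function.update_of_ne (show (4 : ℕ) ≠ 5 by decide)]
  rfl

theorem eval_disruptStart (γ : ObjectiveType) (h0 : e 0 = w.length) :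
    (disruptStart γ).eval w a 5 e ↔ (coverageRecords γ w).startD
      (record (w.length + 1 + 3 + (w.length + 1 + 5)) a (e 3)) := by
  simp only [disruptStart, newOpen, bound, new, cur, Fml.eval, Fml.eval_all, Fml.eval_equiv,
    Fml.eval_eq, Tm.eval, eval_cell, eval_field, eval_focused γ h0, h0,
    Function.update_self, Function.update_of_ne (show (0 : ℕ) ≠ 5 by decide),
    Function.update_of_ne (show (3 : ℕ) ≠ 5 by decide)]
  rfl

theorem eval_frame (h0 : e 0 = w.length) :
    frame.eval w a 5 e ↔ IsFrame w
      (record (w.length + 1 + 3 + (w.length + 1 + 5)) a (e 3) 0)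
      (record (w.length + 1 + 3 + (w.length + 1 + 5)) a (e 3) 1)
      (record (w.length + 1 + 3 + (w.length + 1 + 5)) a (e 3) 3) := by
  simp only [frame, rows, cur, Fml.eval, Fml.eval_all, Fml.eval_eq, Tm.eval, eval_cell,
    eval_double, h0, Function.update_self, Function.update_of_ne (show (0 : ℕ) ≠ 5 by decide),
    Function.update_of_ne (show (3 : ℕ) ≠ 5 by decide),
    Function.update_of_ne (show (5 : ℕ) ≠ 6 by decide),
    Function.update_of_ne (show (0 : ℕ) ≠ 6 by decide),
    Function.update_of_ne (show (3 : ℕ) ≠ 6 by decide)]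
  constructor
  · rintro ⟨h1, h2, h3, h4, h5, h6, h7, h8, h9⟩
    exact ⟨h1, h2, h3, h4, h5, h6, h7, h8, h9⟩
  · rintro ⟨h1, h2, h3, h4, h5, h6, h7, h8, h9⟩
    exact ⟨h1, h2, h3, h4, h5, h6, h7, h8, h9⟩

theorem eval_input (h0 : e 0 = w.length) :
    input.eval w a 5 e ↔ IsInput w
      (record (w.length + 1 + 3 + (w.length + 1 + 5)) a (e 3) 0)
      (record (w.length + 1 + 3 + (w.length + 1 + 5)) a (e 3) 1)
      (record (w.length + 1 + 3 + (w.length + 1 + 5)) a (e 3) 3) := by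
  simp only [input, rows, cur, Fml.eval, eval_frame h0, Fml.eval_all, Fml.eval_impl, Fml.eval_disj,
    Fml.eval_eq, Tm.eval, eval_cell, eval_double, h0, Function.update_self,
    Function.update_of_ne (show (0 : ℕ) ≠ 5 by decide),
    Function.update_of_ne (show (3 : ℕ) ≠ 5 by decide),
    Function.update_of_ne (show (5 : ℕ) ≠ 6 by decide),
    Function.update_of_ne (show (0 : ℕ) ≠ 6 by decide),
    Function.update_of_ne (show (3 : ℕ) ≠ 6 by decide)]
  constructor
  · rintro ⟨h1, h2, h3, h4⟩
    exact ⟨h1, h2, h3, h4⟩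
  · rintro ⟨h1, h2, h3, h4⟩
    exact ⟨h1, h2, h3, h4⟩

theorem eval_enough (h0 : e 0 = w.length) :
    enough.eval w a 5 e ↔ Enough w
      (record (w.length + 1 + 3 + (w.length + 1 + 5)) a (e 3) 0)
      (record (w.length + 1 + 3 + (w.length + 1 + 5)) a (e 3) 3)
      (record (w.length + 1 + 3 + (w.length + 1 + 5)) a (e 3) 2) := by
  have hodd : ∀ x i : ℕ, (∃ y < x + 1, x / 2 ^ i = 2 * y + 1) ↔ x / 2 ^ i % 2 = 1 := by
    intro x i
    constructor
    · rintro ⟨y, -, h⟩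
      omega
    · intro h
      have := Nat.div_le_self x (2 ^ i)
      exact ⟨x / 2 ^ i / 2, by omega, by omega⟩
  simp only [enough, agentsBit, cur, Fml.eval, Fml.eval_all, Fml.eval_equiv, Fml.eval_eq, Tm.eval,
    eval_cell, eval_double, h0, Function.update_self,
    Function.update_of_ne (show (0 : ℕ) ≠ 5 by decide),
    Function.update_of_ne (show (3 : ℕ) ≠ 5 by decide),
    Function.update_of_ne (show (5 : ℕ) ≠ 6 by decide),
    Function.update_of_ne (show (0 : ℕ) ≠ 6 by decide),
    Function.update_of_ne (show (3 : ℕ) ≠ 6 by decide),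
    Function.update_of_ne (show (5 : ℕ) ≠ 7 by decide),
    Function.update_of_ne (show (6 : ℕ) ≠ 7 by decide), hodd]
  rfl

theorem eval_coverStart (γ : ObjectiveType) (h0 : e 0 = w.length) :
    coverStart.eval w a 5 e ↔ (coverageRecords γ w).startP
      (record (w.length + 1 + 3 + (w.length + 1 + 5)) a (e 3)) := by
  simp only [coverStart, cur, Fml.eval, Fml.eval_disj, Fml.eval_eq, Tm.eval, eval_cell,
    eval_input h0, eval_enough h0, h0]
  rfl

theorem eval_rule {start move : Fml} {p : Prop} {q : ℕ → Prop} {r : ℕ} (hr : e 3 = r)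
    (hp : ∀ s, start.eval w a 5 (Function.update e 4 s) ↔ p)
    (hq : ∀ s, move.eval w a 5 (Function.update e 4 s) ↔ q s) :
    (rule start move).eval w a 4 e ↔ (r = 0 ∧ p) ∨ ∃ s < r, r = s + 1 ∧ q s := by
  simp only [rule, Fml.eval, Fml.eval_disj, Fml.eval_eq, Tm.eval, hp, hq, Function.update_self,
    Function.update_of_ne (show (3 : ℕ) ≠ 4 by decide), hr]
  constructor
  · rintro ⟨s, hs, h | h⟩
    · exact Or.inl h
    · exact Or.inr ⟨s, by omega, h⟩
  · rintro (h | ⟨s, hs, h⟩)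
    · exact ⟨0, by omega, Or.inl h⟩
    · exact ⟨s, by omega, Or.inr h⟩

theorem eval_ruleP (γ : ObjectiveType) (h0 : e 0 = w.length) :
    (rule coverStart (coverMove γ)).eval w a 4 e ↔ (coverageRecords γ w).RuleP (e 3) a := by
  refine eval_rule rfl (fun s => ?_) fun s => ?_
  · exact eval_coverStart γ (e := Function.update e 4 s) h0
  · exact eval_coverMove γ (e := Function.update e 4 s) h0

theorem eval_ruleD (γ : ObjectiveType) (h0 : e 0 = w.length) :
    (rule (disruptStart γ) (disruptMove γ)).eval w a 4 e ↔
      (coverageRecords γ w).RuleD (e 3) a := by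
  refine eval_rule rfl (fun s => ?_) fun s => ?_
  · exact eval_disruptStart γ (e := Function.update e 4 s) h0
  · exact eval_disruptMove γ (e := Function.update e 4 s) h0

theorem eval_firstOffence (γ : ObjectiveType) (h0 : e 0 = w.length) :
    (firstOffence γ).eval w a 2 e ↔ FirstOffence (coverageRecords γ w).RuleP
      (coverageRecords γ w).RuleD ((w.length + 1) ^ 3 + 1) a := by
  have hT : (w.length + 1) * ((w.length + 1) * (w.length + 1)) = (w.length + 1) ^ 3 := by ring
  simp only [firstOffence, Fml.eval, Fml.eval_all, Fml.eval_equiv, rounds, bound, Tm.eval, h0, hT]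
  refine exists_congr fun r => and_congr_right fun _ => forall₂_congr fun r' _ => ?_
  exact and_congr (eval_ruleP γ (e := Function.update (Function.update e 2 r) 3 r') h0)
    (iff_congr (eval_ruleD γ (e := Function.update (Function.update e 2 r) 3 r') h0) Iff.rfl)

end RuleFml

/-- The alternation for the coverage problem. -/
def coverageAlt (γ : ObjectiveType) : AltSpec where
  rangeTm := RuleFml.bound
  lengthTm := .mul RuleFml.rounds (.add (RuleFml.field 3) (RuleFml.field 5))
  quantFml := RuleFml.covererTurn
  leafFml := RuleFml.firstOffence γ
  range L := L + 1
  length L := ((L + 1) ^ 3 + 1) * ((L + 1 + 3) + (L + 1 + 5))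
  quant L i := i % ((L + 1 + 3) + (L + 1 + 5)) < L + 1 + 3
  range_pos L := Nat.succ_pos L
  range_spec _ _ := rfl
  length_spec a e := by
    simp only [RuleFml.rounds, RuleFml.bound, RuleFml.eval_field, Tm.eval]
    ring
  quant_spec w a e := by
    simp only [RuleFml.covererTurn, Fml.eval, Fml.eval_eq, Tm.eval, RuleFml.eval_field,
      Function.update_self, Function.update_of_ne (show (0 : ℕ) ≠ 2 by decide),
      Function.update_of_ne (show (0 : ℕ) ≠ 3 by decide),
      Function.update_of_ne (show (1 : ℕ) ≠ 2 by decide),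
      Function.update_of_ne (show (1 : ℕ) ≠ 3 by decide),
      Function.update_of_ne (show (2 : ℕ) ≠ 3 by decide)]
    set F := e 0 + 1 + 3 + (e 0 + 1 + 5) with hF
    constructor
    · rintro ⟨k, -, x, hx, h⟩
      rw [h, Nat.mul_comm, Nat.mul_add_mod, Nat.mod_eq_of_lt (by omega)]
      exact hx
    · intro h
      exact ⟨e 1 / F, Nat.lt_succ_iff.2 (Nat.div_le_self _ _), e 1 % F, h,
        (Nat.div_add_mod' _ _).symm⟩

theorem mem_coverageProblem_iff_holds (γ : ObjectiveType) (w : List (Option Bool)) :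
    w ∈ coverageProblem γ ↔ (coverageAlt γ).Holds w := by
  have h : (coverageAlt γ).Leaf w = FirstOffence (coverageRecords γ w).RuleP
      (coverageRecords γ w).RuleD ((w.length + 1) ^ 3 + 1) :=
    funext fun a => propext (RuleFml.eval_firstOffence γ rfl)
  rw [mem_coverageProblem_iff, AltSpec.Holds, h]
  rfl

end CoverageGames

theorem mainTheorem2 (γ : CoverageGames.ObjectiveType) :
    CoverageGames.coverageProblem γ ∈ CoverageGames.PSPACE (Option Bool) := by
  have hid := CoverageGames.PolyBounded.id
  have hsucc := hid.add (.const 1)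
  have h : CoverageGames.coverageProblem γ =
      ({w | (CoverageGames.coverageAlt γ).Holds w} : Language (Option Bool)) :=
    Set.ext fun w => CoverageGames.mem_coverageProblem_iff_holds γ w
  rw [h]
  refine (CoverageGames.coverageAlt γ).mem_PSPACE hsucc ?_
  have hcube := ((hsucc.mul (hsucc.mul hsucc)).add (.const 1)).mul
    ((hsucc.add (.const 3)).add (hsucc.add (.const 5)))
  obtain ⟨p, hp⟩ := hcube
  refine ⟨p, fun L => le_trans (le_of_eq ?_) (hp L)⟩
  simp only [CoverageGames.coverageAlt]
  ring
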